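/- Let $N\ge 2$, $L\ge 1$, $\varepsilon=e^{2\pi i/N}$, $\mathfrak g=\mathfrak{sl}_N(\mathbb C)$, $(A|B)=\operatorname{tr}(AB)$. Let $\gamma=\operatorname{diag}(1,\varepsilon^{-1},\dots,\varepsilon^{1-N})$, let $\beta$ be the $N\times N$ cyclic shift matrix ($\beta_{i,i+1}=1$ for $1\le i<N$, $\beta_{N,1}=1$, other entries $0$), and let $\mathfrak h\subset\mathfrak g$ be the Cartan subalgebra of traceless diagonal matrices. Let $t_1,\dots,t_L\in\mathbb C\setminus\{0\}$ be such that $t_i\ne\varepsilon^a t_j$ for all $i\ne j$ and all $a$ (the coordinates of distinct points $Q_i\ne 0,\infty$ of the orbifold $\mathbb P^1/(t\mapsto\varepsilon t)$). *Affine algebras.* At $Q_i$, with local coordinate $\xi=t-t_i$, put $\hat{\mathfrak g}^{Q_i}=\mathfrak{sl}_N(\mathbb C((\xi)))\oplus\mathbb C\hat k$, with $\hat k$ central and $[A,B]=(AB-BA)+\operatorname{Res}_{\xi=0}\operatorname{tr}(A'B)\,d\xi\cdot\hat k$. At $P\in\{0,\infty\}$, with local coordinate $\xi=t$, respectively $\xi=1/t$,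 let $\mathfrak g^{(P)}$ be the algebra of formal loops $f\in\mathfrak{sl}_N(\mathbb C((\xi)))$ with $f(\varepsilon t)=\gamma f(t)\gamma^{-1}$, and $\hat{\mathfrak g}^{(P)}=\mathfrak g^{(P)}\oplus\mathbb C\hat k$ its central extension by $\frac1N\operatorname{Res}_{\xi=0}\operatorname{tr}(A'B)\,d\xi$. Let $\mathfrak n^{(P)}_+\subset\mathfrak g^{(P)}$ be the loops with only positive powers of $\xi$; $\mathfrak h$ embeds in $\mathfrak g^{(P)}$ as constant loops. *Universal Verma modules.* For $k\in\mathbb C$ put $M(0)_P=U\hat{\mathfrak g}^{(P)}/\bigl(U\hat{\mathfrak g}^{(P)}\mathfrak n^{(P)}_+ +U\hat{\mathfrak g}^{(P)}(\hat k-k)\bigr)$, with cyclic vector $\mathbf 1_P=[1]$ and the right $\mathfrak h$-action $[x]H=[xH]$. *Coinvariants.* Let $\mathfrak g_{\rm out}^{\rm orb}$ be the Lie algebra of rational functions $f:\mathbb P^1\to\mathfrak g$ with $f(\varepsilon t)=\gamma f(t)\gamma^{-1}$ and no poles outside $\{0,\infty\}\cup\{\varepsilon^a t_i\}$. Let $\mathfrak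 g_{\rm out}^{\rm trig}$ be the subalgebra of those $f$ which have no poles outside $\{\varepsilon^at_i\}$ and satisfy $f(\infty)=\beta f(0)\beta^{-1}$. Let $M_i$ ($1\le i\le L$) be a smooth $\hat{\mathfrak g}^{Q_i}$-module on which $\hat k$ acts as $k$, where smooth means: for each $v\in M_i$ there is $m\ge0$ such that $(A_1\xi^{m_1})\cdots(A_\nu\xi^{m_\nu})v=0$ for all $\nu\ge 0$, $A_j\in\mathfrak g$ and $m_j\ge0$ with $m_1+\dots+m_\nu\ge m$. Put $M=M_1\otimes\cdots\otimes M_L$. Functions $f$ act on $M$, respectively on $W=M(0)_0\otimes M\otimes M(0)_\infty$, by the sum over the tensor factors of the actions of their Laurent expansions at $t_1,\dots,t_L$, respectively at $0,t_1,\dots,t_L,\infty$. Put $$CC_{\rm trig}(M)=M/\mathfrak g_{\rm out}^{\rm trig}M,\qquad CC_{\rm orb}(W)=W/\mathfrak g_{\rm out}^{\rm orb}W.$$ For $H\in\mathfrak h$ define $\rho_{1,\beta}(H)$ on $W$ by $$(v_0\otimes v\otimes v_\infty)\,\rho_{1,\beta}(H)=v_0H\otimes v\otimes v_\infty+v_0\otimes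 v\otimes v_\infty(\beta H\beta^{-1});$$ it commutes with $\mathfrak g_{\rm out}^{\rm orb}$ and so acts on $CC_{\rm orb}(W)$. Let $CC_{\rm orb}\cdot\mathfrak h=CC_{\rm orb}(W)\,\rho_{1,\beta}(\mathfrak h)$ be the span of the images of all $\rho_{1,\beta}(H)$, $H\in\mathfrak h$. **Theorem.** There is an isomorphism of vector spaces $$CC_{\rm trig}(M)\;\cong\;CC_{\rm orb}\bigl(M(0)_0\otimes M\otimes M(0)_\infty\bigr)\big/\,CC_{\rm orb}\cdot\mathfrak h,$$ which sends the class of $v\in M$ to the class of $\mathbf 1_0\otimes v\otimes\mathbf 1_\infty$. -/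

import Mathlib

open scoped TensorProduct LaurentSeries

universe u

namespace TwistedWZW

noncomputable section

attribute [local instance 100] LieRing.ofAssociativeRing

/-! ### The matrices `β`, `γ` and the Lie algebra `sl_N` -/

/-- The primitive root of unity `ε = exp (2πi / N)`. -/
def eps (N : ℕ) : ℂˣ :=
  Units.mk0 (Complex.exp (2 * Real.pi * Complex.I / N)) (Complex.exp_ne_zero _)

/-- The cyclic shift matrix: ones above the diagonal and in the lower left corner. -/
def beta (N : ℕ) : Matrix (Fin N) (Fin N) ℂ :=
  Matrix.of fun i j => if (j : ℕ) = ((i : ℕ) + 1) % N then 1 else 0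

/-- `γ = diag (1, ε⁻¹, …, ε^(1-N))`. -/
def gamma (N : ℕ) : Matrix (Fin N) (Fin N) ℂ :=
  Matrix.diagonal fun i => ((((eps N)⁻¹ : ℂˣ) : ℂ)) ^ (i : ℕ)

/-- `Ad g (A) = g A g⁻¹` for a constant matrix `g` and a matrix `A` over a `ℂ`-algebra. -/
def Ad {N : ℕ} {R : Type*} [CommRing R] [Algebra ℂ R] (g : Matrix (Fin N) (Fin N) ℂ)
    (A : Matrix (Fin N) (Fin N) R) : Matrix (Fin N) (Fin N) R :=
  g.map (algebraMap ℂ R) * A * g⁻¹.map (algebraMap ℂ R)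

theorem isUnit_gamma (N : ℕ) : IsUnit (gamma N).det := by
  rw [gamma, Matrix.det_diagonal, isUnit_iff_ne_zero, Finset.prod_ne_zero_iff]
  intro i _
  exact pow_ne_zero _ (Units.ne_zero _)

theorem beta_mul_transpose (N : ℕ) : beta N * (beta N).transpose = 1 := by
  ext i j
  have hN : 0 < N := i.pos
  rw [Matrix.mul_apply, Finset.sum_eq_single ⟨((i : ℕ) + 1) % N, Nat.mod_lt _ hN⟩]
  · simp only [beta, Matrix.of_apply, Matrix.transpose_apply, if_true, one_mul, Matrix.one_apply]
    have h : ((i : ℕ) + 1) % N = ((j : ℕ) + 1) % N ↔ i = j := by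
      constructor
      · intro h
        have h2 : (i : ℕ) ≡ j [MOD N] := Nat.ModEq.add_right_cancel' 1 h
        have h3 := Nat.mod_eq_of_lt i.2
        have h4 := Nat.mod_eq_of_lt j.2
        unfold Nat.ModEq at h2
        exact Fin.ext (by omega)
      · rintro rfl
        rfl
    simp only [h]
  · intro b _ hb
    have : ¬ (b : ℕ) = ((i : ℕ) + 1) % N := fun h => hb (Fin.ext h)
    simp [beta, this]
  · simp

theorem isUnit_beta (N : ℕ) : IsUnit (beta N).det :=
  Matrix.isUnit_det_of_right_inverse (beta_mul_transpose N)

section AdLemmas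

variable {N : ℕ} {R : Type*} [CommRing R] [Algebra ℂ R]

theorem Ad_add (g : Matrix (Fin N) (Fin N) ℂ) (A B : Matrix (Fin N) (Fin N) R) :
    Ad g (A + B) = Ad g A + Ad g B := by
  simp [Ad, mul_add, add_mul]

theorem Ad_sub (g : Matrix (Fin N) (Fin N) ℂ) (A B : Matrix (Fin N) (Fin N) R) :
    Ad g (A - B) = Ad g A - Ad g B := by
  simp [Ad, mul_sub, sub_mul]

theorem Ad_smul (g : Matrix (Fin N) (Fin N) ℂ) (c : ℂ) (A : Matrix (Fin N) (Fin N) R) :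
    Ad g (c • A) = c • Ad g A := by
  simp [Ad]

theorem Ad_zero (g : Matrix (Fin N) (Fin N) ℂ) :
    Ad g (0 : Matrix (Fin N) (Fin N) R) = 0 := by
  simp [Ad]

theorem map_inv_mul_map {g : Matrix (Fin N) (Fin N) ℂ} (hg : IsUnit g.det) :
    g⁻¹.map (algebraMap ℂ R) * g.map (algebraMap ℂ R) = 1 := by
  rw [← Matrix.map_mul, Matrix.nonsing_inv_mul _ hg]
  exact Matrix.map_one _ (map_zero _) (map_one _)

theorem Ad_mul {g : Matrix (Fin N) (Fin N) ℂ} (hg : IsUnit g.det)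
    (A B : Matrix (Fin N) (Fin N) R) : Ad g (A * B) = Ad g A * Ad g B := by
  have h := map_inv_mul_map (R := R) hg
  calc Ad g (A * B)
      = g.map (algebraMap ℂ R) * A * 1 * B * g⁻¹.map (algebraMap ℂ R) := by
        simp [Ad, mul_assoc]
    _ = Ad g A * Ad g B := by
        rw [← h]; simp only [Ad, mul_assoc]

theorem Ad_lie {g : Matrix (Fin N) (Fin N) ℂ} (hg : IsUnit g.det)
    (A B : Matrix (Fin N) (Fin N) R) : Ad g ⁅A, B⁆ = ⁅Ad g A, Ad g B⁆ := by
  simp only [Ring.lie_def, Ad_sub, Ad_mul hg]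

theorem trace_Ad {g : Matrix (Fin N) (Fin N) ℂ} (hg : IsUnit g.det)
    (A : Matrix (Fin N) (Fin N) R) : (Ad g A).trace = A.trace := by
  rw [Ad, Matrix.trace_mul_comm, ← mul_assoc, map_inv_mul_map hg, one_mul]

end AdLemmas

theorem trace_lie {N : ℕ} {R : Type*} [CommRing R] (A B : Matrix (Fin N) (Fin N) R) :
    (⁅A, B⁆ : Matrix (Fin N) (Fin N) R).trace = 0 := by
  rw [Ring.lie_def, Matrix.trace_sub, Matrix.trace_mul_comm, sub_self]

/-- `sl_N(R)` as a Lie algebra over `ℂ`, for a commutative `ℂ`-algebra `R`. -/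
def slN (N : ℕ) (R : Type*) [CommRing R] [Algebra ℂ R] :
    LieSubalgebra ℂ (Matrix (Fin N) (Fin N) R) where
  carrier := {A | A.trace = 0}
  add_mem' {A B} hA hB := by
    simp only [Set.mem_ofPred_eq] at *
    rw [Matrix.trace_add, hA, hB, add_zero]
  zero_mem' := Matrix.trace_zero _ _
  smul_mem' c A hA := by
    simp only [Set.mem_ofPred_eq] at *
    rw [Matrix.trace_smul, hA, smul_zero]
  lie_mem' {A B} _ _ := trace_lie A B

/-- The Cartan subalgebra `h` of `sl_N(ℂ)`: traceless diagonal matrices (it is spanned by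
`γ⁻¹, …, γ^(1-N)`). -/
def cartan (N : ℕ) : Submodule ℂ (Matrix (Fin N) (Fin N) ℂ) where
  carrier := {H | H.IsDiag ∧ H.trace = 0}
  add_mem' {A B} hA hB := ⟨hA.1.add hB.1, by rw [Matrix.trace_add, hA.2, hB.2, add_zero]⟩
  zero_mem' := ⟨Matrix.isDiag_zero, Matrix.trace_zero _ _⟩
  smul_mem' c A hA := ⟨hA.1.smul c, by rw [Matrix.trace_smul, hA.2, smul_zero]⟩

/-! ### Laurent series -/

/-- The field `ℂ((ξ))` of formal Laurent series. -/
def Laur : Type := LaurentSeries ℂ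

instance : Field Laur := inferInstanceAs (Field (LaurentSeries ℂ))

instance : Algebra ℂ Laur := (HahnSeries.instAlgebra : Algebra ℂ (HahnSeries ℤ ℂ))

namespace Laur

/-- The coefficient of `ξ ^ m`. -/
def coeff (m : ℤ) : Laur →ₗ[ℂ] ℂ where
  toFun f := HahnSeries.coeff f m
  map_add' f g := HahnSeries.coeff_add (x := f) (y := g)
  map_smul' _ f := HahnSeries.coeff_smul (x := f)

@[ext] theorem ext {f g : Laur} (h : ∀ m, coeff m f = coeff m g) : f = g :=
  HahnSeries.ext (funext h)

/-- The monomial `c ξ ^ m`. -/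
def monomial (m : ℤ) (c : ℂ) : Laur := HahnSeries.single m c

/-- The variable `ξ`. -/
def xi : Laur := monomial 1 1

theorem coeff_monomial (m n : ℤ) (c : ℂ) : coeff n (monomial m c) = if n = m then c else 0 := by
  refine (HahnSeries.coeff_single (Γ := ℤ)).trans ?_
  congr

theorem algebraMap_eq (c : ℂ) : algebraMap ℂ Laur c = monomial 0 c := rfl

theorem coeff_mul (f g : Laur) (m : ℤ) :
    coeff m (f * g) =
      ∑ p ∈ Finset.antidiagonal (HahnSeries.isPWO_support f) (HahnSeries.isPWO_support g) m,
        coeff p.1 f * coeff p.2 g := HahnSeries.coeff_mul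

theorem coeff_monomial_mul (n m : ℤ) (c : ℂ) (f : Laur) :
    coeff m (monomial n c * f) = c * coeff (m - n) f := by
  have h := HahnSeries.coeff_single_mul_add (Γ := ℤ) (r := c) (b := n) (a := m - n)
    (x := (f : HahnSeries ℤ ℂ))
  rw [sub_add_cancel] at h
  exact h

/-- Multiplication of the `m`-th coefficient by `w m`. -/
def weight (w : ℤ → ℂ) : Laur →ₗ[ℂ] Laur where
  toFun f := HahnSeries.mk (fun m => w m * coeff m f)
    ((HahnSeries.isPWO_support f).mono fun _ hm => right_ne_zero_of_mul hm)
  map_add' f g := Laur.ext fun m =>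
    (congrArg (w m * ·) (map_add (coeff m) f g)).trans (mul_add _ _ _)
  map_smul' c f := Laur.ext fun m =>
    (congrArg (w m * ·) (map_smul (coeff m) c f)).trans (mul_left_comm _ _ _)

theorem coeff_weight (w : ℤ → ℂ) (f : Laur) (m : ℤ) :
    coeff m (weight w f) = w m * coeff m f := rfl

theorem coeff_weight_mul_weight (v w : ℤ → ℂ) (f g : Laur) (m : ℤ) :
    coeff m (weight v f * weight w g) =
      ∑ p ∈ Finset.antidiagonal (HahnSeries.isPWO_support f) (HahnSeries.isPWO_support g) m,
        (v p.1 * w p.2) * (coeff p.1 f * coeff p.2 g) := by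
  have hv : HahnSeries.support (weight v f) ⊆ HahnSeries.support f :=
    fun _ hm => right_ne_zero_of_mul hm
  have hw : HahnSeries.support (weight w g) ⊆ HahnSeries.support g :=
    fun _ hm => right_ne_zero_of_mul hm
  refine (HahnSeries.coeff_mul_left' (HahnSeries.isPWO_support f) hv).trans ?_
  refine (Finset.sum_subset (fun p hp => ?_) (fun p hp hp' => ?_)).trans
    (Finset.sum_congr rfl fun p _ => ?_)
  · rw [Finset.mem_antidiagonal] at hp ⊢
    exact ⟨hp.1, hw hp.2.1, hp.2.2⟩
  · rw [Finset.mem_antidiagonal] at hp hp'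
    have : HahnSeries.coeff (weight w g) p.2 = 0 := by
      by_contra h
      exact hp' ⟨hp.1, h, hp.2.2⟩
    rw [this, mul_zero]
  · change (v p.1 * coeff p.1 f) * (w p.2 * coeff p.2 g) = _
    ring

theorem weight_mul (w : ℤ → ℂ) (hw : ∀ p q, w (p + q) = w p * w q) (f g : Laur) :
    weight w (f * g) = weight w f * weight w g := by
  ext m
  rw [coeff_weight_mul_weight, coeff_weight, coeff_mul, Finset.mul_sum]
  refine Finset.sum_congr rfl fun p hp => ?_
  rw [Finset.mem_antidiagonal] at hp
  rw [← hw, hp.2.2]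

theorem weight_const_one (f : Laur) : weight (fun _ => 1) f = f := by
  ext m; simp [coeff_weight]

theorem weight_id_mul (f g : Laur) :
    weight (fun m => (m : ℂ)) (f * g) =
      weight (fun m => (m : ℂ)) f * g + f * weight (fun m => (m : ℂ)) g := by
  have h1 := fun m => coeff_weight_mul_weight (fun m => (m : ℂ)) (fun _ => 1) f g m
  have h2 := fun m => coeff_weight_mul_weight (fun _ => 1) (fun m => (m : ℂ)) f g m
  simp only [weight_const_one] at h1 h2
  ext m
  rw [map_add, h1, h2, coeff_weight, coeff_mul, Finset.mul_sum, ← Finset.sum_add_distrib]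
  refine Finset.sum_congr rfl fun p hp => ?_
  rw [Finset.mem_antidiagonal] at hp
  rw [← hp.2.2]
  push_cast
  ring

/-- The derivative `d/dξ`. -/
def deriv : Laur →ₗ[ℂ] Laur :=
  (LinearMap.mulLeft ℂ (monomial (-1) 1)).comp (weight fun m => (m : ℂ))

theorem coeff_deriv (f : Laur) (m : ℤ) :
    coeff m (deriv f) = ((m : ℂ) + 1) * coeff (m + 1) f := by
  change coeff m (monomial (-1) 1 * weight (fun m => (m : ℂ)) f) = _
  rw [coeff_monomial_mul, coeff_weight, sub_neg_eq_add]
  push_cast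
  ring

theorem deriv_mul (f g : Laur) : deriv (f * g) = deriv f * g + f * deriv g := by
  change monomial (-1) 1 * weight (fun m => (m : ℂ)) (f * g) =
    monomial (-1) 1 * weight (fun m => (m : ℂ)) f * g +
      f * (monomial (-1) 1 * weight (fun m => (m : ℂ)) g)
  rw [weight_id_mul]
  ring

/-- The automorphism `f(ξ) ↦ f(ζ ξ)`. -/
def rescale (ζ : ℂˣ) : Laur →ₐ[ℂ] Laur :=
  AlgHom.ofLinearMap (weight fun m => ((ζ ^ m : ℂˣ) : ℂ))
    (by
      ext m
      rw [coeff_weight, ← map_one (algebraMap ℂ Laur), algebraMap_eq, coeff_monomial]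
      split_ifs with h
      · simp [h]
      · simp)
    (weight_mul _ fun p q => by rw [zpow_add]; simp)

theorem coeff_rescale (ζ : ℂˣ) (f : Laur) (m : ℤ) :
    coeff m (rescale ζ f) = ((ζ ^ m : ℂˣ) : ℂ) * coeff m f := rfl

theorem rescale_monomial (ζ : ℂˣ) (m : ℤ) (c : ℂ) :
    rescale ζ (monomial m c) = ((ζ ^ m : ℂˣ) : ℂ) • monomial m c := by
  ext n
  rw [coeff_rescale, map_smul, coeff_monomial]
  split_ifs with h
  · simp [h]
  · simp

theorem monomial_mul_monomial (m n : ℤ) (a b : ℂ) :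
    monomial m a * monomial n b = monomial (m + n) (a * b) := HahnSeries.single_mul_single

theorem xi_pow (n : ℕ) : xi ^ n = monomial n 1 := by
  induction n with
  | zero => rw [pow_zero, ← map_one (algebraMap ℂ Laur), algebraMap_eq]; rfl
  | succ n ih => rw [pow_succ, ih, xi, monomial_mul_monomial]; simp

theorem xi_ne_zero : xi ≠ 0 := by
  intro h
  have := congrArg (coeff 1) h
  rw [xi, coeff_monomial] at this
  simp at this

theorem transcendental_xi : Transcendental ℂ xi := by
  rw [transcendental_iff]
  intro p hp
  ext n
  have h := congrArg (coeff n) hp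
  rw [Polynomial.aeval_eq_sum_range, map_sum, map_zero] at h
  rw [Polynomial.coeff_zero]
  simp only [map_smul, xi_pow, coeff_monomial] at h
  by_cases hn : n ∈ Finset.range (p.natDegree + 1)
  · rw [Finset.sum_eq_single n (fun b _ hb => by simp [Ne.symm hb]) (fun h => absurd hn h)] at h
    simpa using h
  · exact Polynomial.coeff_eq_zero_of_natDegree_lt (by
      rw [Finset.mem_range] at hn; omega)

end Laur

open Laur

/-! ### Formal loops and affine Lie algebras -/

section Maps

variable {N : ℕ} {R S : Type*} [CommRing R] [CommRing S] [Algebra ℂ R] [Algebra ℂ S]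

theorem map_lie_matrix (φ : R →ₐ[ℂ] S) (A B : Matrix (Fin N) (Fin N) R) :
    (⁅A, B⁆ : Matrix (Fin N) (Fin N) R).map φ = ⁅A.map φ, B.map φ⁆ := by
  have h := map_sub φ.mapMatrix (A * B) (B * A)
  rw [map_mul, map_mul] at h
  exact h

theorem map_Ad (φ : R →ₐ[ℂ] S) (g : Matrix (Fin N) (Fin N) ℂ) (A : Matrix (Fin N) (Fin N) R) :
    (Ad g A).map φ = Ad g (A.map φ) := by
  have h : ∀ g : Matrix (Fin N) (Fin N) ℂ,
      φ.mapMatrix (g.map (algebraMap ℂ R)) = g.map (algebraMap ℂ S) := by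
    intro g
    ext i j
    simp
  change φ.mapMatrix (Ad g A) = _
  rw [Ad, map_mul, map_mul, h, h]
  rfl

theorem map_smul_matrix (φ : R →ₐ[ℂ] S) (c : ℂ) (A : Matrix (Fin N) (Fin N) R) :
    (c • A).map φ = c • A.map φ := by
  ext i j
  simp

theorem map_add_matrix (φ : R →ₐ[ℂ] S) (A B : Matrix (Fin N) (Fin N) R) :
    (A + B).map φ = A.map φ + B.map φ := by
  ext i j
  simp

theorem trace_map (φ : R →ₐ[ℂ] S) (A : Matrix (Fin N) (Fin N) R) :
    (A.map φ).trace = φ A.trace :=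
  (AddMonoidHom.map_trace φ A).symm

/-- The Lie algebra `{A ∈ sl_N(R) : φ(A) = Ad γ (A)}` for an endomorphism `φ` of `R`. -/
def twistedFixed (N : ℕ) (φ : R →ₐ[ℂ] R) : LieSubalgebra ℂ (Matrix (Fin N) (Fin N) R) where
  carrier := {A | A.trace = 0 ∧ A.map φ = Ad (gamma N) A}
  add_mem' {A B} hA hB := by
    refine ⟨by rw [Matrix.trace_add, hA.1, hB.1, add_zero], ?_⟩
    rw [Ad_add, ← hA.2, ← hB.2]
    exact map_add φ.mapMatrix A B
  zero_mem' := ⟨Matrix.trace_zero _ _, by rw [Ad_zero]; exact map_zero φ.mapMatrix⟩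
  smul_mem' c A hA := by
    refine ⟨by rw [Matrix.trace_smul, hA.1, smul_zero], ?_⟩
    rw [Ad_smul, ← hA.2]
    exact map_smul φ.mapMatrix c A
  lie_mem' {A B} hA hB := by
    refine ⟨trace_lie A B, ?_⟩
    rw [Ad_lie (isUnit_gamma N), ← hA.2, ← hB.2]
    exact map_lie_matrix φ A B

end Maps

/-- The `γ`-twisted loop algebra: `A(ξ) ∈ sl_N(ℂ((ξ)))` with `A(ζ ξ) = Ad γ (A(ξ))`. -/
def twLoop (N : ℕ) (ζ : ℂˣ) : LieSubalgebra ℂ (Matrix (Fin N) (Fin N) Laur) :=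
  twistedFixed N (rescale ζ)

/-- `Res (∇A | B) = Res_{ξ = 0} tr (A'(ξ) B(ξ)) dξ`. -/
def resForm {N : ℕ} (A B : Matrix (Fin N) (Fin N) Laur) : ℂ :=
  coeff (-1) (A.map Laur.deriv * B).trace

section ResForm

variable {N : ℕ}

theorem map_derivative_mul (A B : Matrix (Fin N) (Fin N) Laur) :
    (A * B).map Laur.deriv =
      A.map Laur.deriv * B + A * B.map Laur.deriv := by
  ext1 i j
  simp only [Matrix.map_apply, Matrix.mul_apply, Matrix.add_apply, map_sum, deriv_mul,
    Finset.sum_add_distrib]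

theorem map_derivative_add (A B : Matrix (Fin N) (Fin N) Laur) :
    (A + B).map Laur.deriv =
      A.map Laur.deriv + B.map Laur.deriv :=
  Matrix.map_add _ (map_add _) A B

theorem map_derivative_sub (A B : Matrix (Fin N) (Fin N) Laur) :
    (A - B).map Laur.deriv =
      A.map Laur.deriv - B.map Laur.deriv :=
  Matrix.map_sub _ (map_sub _) A B

theorem resForm_add_left (A B C : Matrix (Fin N) (Fin N) Laur) :
    resForm (A + B) C = resForm A C + resForm B C := by
  rw [resForm, map_derivative_add, add_mul, Matrix.trace_add, map_add]; rfl

theorem resForm_add_right (A B C : Matrix (Fin N) (Fin N) Laur) :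
    resForm A (B + C) = resForm A B + resForm A C := by
  rw [resForm, mul_add, Matrix.trace_add, map_add]; rfl

theorem resForm_smul_right (c : ℂ) (A B : Matrix (Fin N) (Fin N) Laur) :
    resForm A (c • B) = c * resForm A B := by
  rw [resForm, Matrix.mul_smul, Matrix.trace_smul, map_smul]; rfl

theorem resForm_self (A : Matrix (Fin N) (Fin N) Laur) : resForm A A = 0 := by
  have h : resForm A A + resForm A A = 0 := by
    have h1 : coeff (-1) ((A * A).map Laur.deriv).trace = 0 := by
      have : ((A * A).map Laur.deriv).trace =
          Laur.deriv (A * A).trace :=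
        (AddMonoidHom.map_trace Laur.deriv (A * A)).symm
      rw [this, coeff_deriv]
      simp
    rw [map_derivative_mul, Matrix.trace_add, map_add,
      Matrix.trace_mul_comm A] at h1
    exact h1
  linear_combination h / 2

theorem resForm_lie (A B C : Matrix (Fin N) (Fin N) Laur) :
    resForm A ⁅B, C⁆ = resForm ⁅A, B⁆ C + resForm B ⁅A, C⁆ := by
  simp only [resForm, Ring.lie_def, map_derivative_sub, map_derivative_mul]
  rw [← map_add]
  congr 1
  generalize A.map Laur.deriv = A'
  generalize B.map Laur.deriv = B'
  simp only [mul_sub, sub_mul, add_mul, Matrix.trace_sub, Matrix.trace_add]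
  rw [Matrix.trace_mul_comm A' (C * B), Matrix.trace_mul_comm B' (C * A),
    Matrix.trace_mul_comm (A * B') C]
  have e1 : (B * A' * C).trace = (C * B * A').trace := by
    rw [Matrix.trace_mul_comm, ← mul_assoc]
  rw [e1]
  simp only [← mul_assoc]
  ring

end ResForm

/-- The central extension `𝔞 ⊕ ℂ k̂` of an algebra `𝔞` of formal `N × N` loops by the 2-cocycle
`c · Res (∇A | B)`. A pair `(A, z)` stands for `A + z k̂`. -/
def Aff {N : ℕ} (𝔞 : LieSubalgebra ℂ (Matrix (Fin N) (Fin N) Laur)) (_c : ℂ) : Type := 𝔞 × ℂ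

namespace Aff

variable {N : ℕ} {𝔞 : LieSubalgebra ℂ (Matrix (Fin N) (Fin N) Laur)} {c : ℂ}

instance : AddCommGroup (Aff 𝔞 c) := inferInstanceAs (AddCommGroup (𝔞 × ℂ))

instance : Module ℂ (Aff 𝔞 c) := inferInstanceAs (Module ℂ (𝔞 × ℂ))

instance : Bracket (Aff 𝔞 c) (Aff 𝔞 c) where
  bracket x y := ((⁅x.1, y.1⁆ : 𝔞), c * resForm (x.1 : Matrix (Fin N) (Fin N) Laur) (y.1 : Matrix (Fin N) (Fin N) Laur))

theorem ext {x y : Aff 𝔞 c} (h1 : x.1 = y.1) (h2 : x.2 = y.2) : x = y := Prod.ext h1 h2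

theorem lie_fst (x y : Aff 𝔞 c) : ⁅x, y⁆.1 = ⁅x.1, y.1⁆ := rfl

theorem lie_snd (x y : Aff 𝔞 c) :
    ⁅x, y⁆.2 = c * resForm (x.1 : Matrix (Fin N) (Fin N) Laur) (y.1 : Matrix (Fin N) (Fin N) Laur) := rfl

theorem add_fst (x y : Aff 𝔞 c) : (x + y).1 = x.1 + y.1 := rfl

theorem add_snd (x y : Aff 𝔞 c) : (x + y).2 = x.2 + y.2 := rfl

instance : LieRing (Aff 𝔞 c) where
  add_lie x y z := ext (add_lie x.1 y.1 z.1) (by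
    simp only [lie_snd, add_snd, add_fst, AddMemClass.coe_add, resForm_add_left, mul_add])
  lie_add x y z := ext (lie_add x.1 y.1 z.1) (by
    simp only [lie_snd, add_snd, add_fst, AddMemClass.coe_add, resForm_add_right, mul_add])
  lie_self x := ext (lie_self x.1) (by
    rw [lie_snd, resForm_self, mul_zero]; rfl)
  leibniz_lie x y z := ext (leibniz_lie x.1 y.1 z.1) (by
    simp only [lie_snd, add_snd, lie_fst, LieSubalgebra.coe_bracket]
    rw [resForm_lie, mul_add])

instance : LieAlgebra ℂ (Aff 𝔞 c) where
  lie_smul r x y := ext (lie_smul r x.1 y.1) (by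
    change c * resForm _ ((r • y.1 : 𝔞) : Matrix (Fin N) (Fin N) Laur) = r * (c * resForm _ _)
    change c * resForm _ (r • ((y.1 : 𝔞) : Matrix (Fin N) (Fin N) Laur)) = _
    rw [resForm_smul_right]
    ring)

/-- The inclusion of the loop algebra (a linear map, not a homomorphism of Lie algebras). -/
def of : 𝔞 →ₗ[ℂ] Aff 𝔞 c := LinearMap.inl ℂ 𝔞 ℂ

/-- The central element `k̂`. -/
def khat : Aff 𝔞 c := ((0 : 𝔞), (1 : ℂ))

theorem lie_of_of (A B : 𝔞) :
    ⁅(of A : Aff 𝔞 c), (of B : Aff 𝔞 c)⁆ =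
      of ⁅A, B⁆ + (c * resForm (A : Matrix (Fin N) (Fin N) Laur) (B : Matrix (Fin N) (Fin N) Laur)) • khat := by
  refine ext ?_ ?_
  · change ⁅A, B⁆ = ⁅A, B⁆ + _ • (0 : 𝔞)
    simp
  · change c * resForm (A : Matrix (Fin N) (Fin N) Laur) (B : Matrix (Fin N) (Fin N) Laur) =
      0 + _ * 1
    rw [mul_one, zero_add]

theorem lie_khat (x : Aff 𝔞 c) : ⁅x, (khat : Aff 𝔞 c)⁆ = 0 := by
  refine ext (lie_zero x.1) ?_
  change c * resForm _ ((0 : 𝔞) : Matrix (Fin N) (Fin N) Laur) = 0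
  simp [resForm]

end Aff

/-! ### Modules over the untwisted affine algebra -/

/-- The affine Lie algebra `sl_N(ℂ((ξ))) ⊕ ℂ k̂` at a point away from `0` and `∞`. -/
abbrev AffLoc (N : ℕ) : Type := Aff (slN N Laur) 1

/-- The loop `A ⊗ ξ ^ m`, for `A ∈ sl_N(ℂ)`. -/
def loopMonomial {N : ℕ} (A : slN N ℂ) (m : ℤ) : slN N Laur :=
  ⟨(A : Matrix (Fin N) (Fin N) ℂ).map (monomial m), by
    change Matrix.trace _ = 0
    have hA : (A : Matrix (Fin N) (Fin N) ℂ).trace = 0 := A.2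
    ext n
    rw [Matrix.trace, map_sum, map_zero]
    simp only [Matrix.diag_apply, Matrix.map_apply, coeff_monomial]
    split_ifs
    · exact hA
    · simp⟩

/-- Smoothness of a module: every vector is killed by all products
`(A₁ ⊗ ξ ^ m₁) ⋯ (A_ν ⊗ ξ ^ m_ν)` with `m₁, …, m_ν ≥ 0` and `m₁ + ⋯ + m_ν` large enough. -/
def IsSmooth (N : ℕ) (M : Type*) [AddCommGroup M] [LieRingModule (AffLoc N) M] : Prop :=
  ∀ v : M, ∃ m : ℕ, ∀ l : List (slN N ℂ × ℕ), m ≤ (l.map Prod.snd).sum →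
    l.foldr (fun p w => ⁅(Aff.of (loopMonomial p.1 p.2) : AffLoc N), w⁆) v = 0

/-- `k̂` acts as the scalar `k`. -/
def HasLevel (N : ℕ) (k : ℂ) (M : Type*) [AddCommGroup M] [Module ℂ M]
    [LieRingModule (AffLoc N) M] : Prop :=
  ∀ v : M, ⁅(Aff.khat : AffLoc N), v⁆ = k • v

/-! ### The universal Verma module of the twisted affine algebra -/

/-- The `γ`-twisted affine algebra; the cocycle carries the factor `1 / N`. It is `ĝ^(0)` for
`ζ = ε`, in the coordinate `ξ = t`, and `ĝ^(∞)` for `ζ = ε⁻¹`, in the coordinate `ξ = 1 / t`. -/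
abbrev AffTw (N : ℕ) (ζ : ℂˣ) : Type := Aff (twLoop N ζ) (1 / (N : ℂ))

/-- All entries of `A` have only terms `ξ ^ m` with `m ≥ a`. -/
def VanishBelow {N : ℕ} (a : ℤ) (A : Matrix (Fin N) (Fin N) Laur) : Prop :=
  ∀ i j m, m < a → coeff m (A i j) = 0

section VanishBelow

variable {N : ℕ} {a b : ℤ} {A B : Matrix (Fin N) (Fin N) Laur}

theorem coeff_mul_eq_zero {f g : Laur} {m : ℤ} (hf : ∀ m, m < a → coeff m f = 0)
    (hg : ∀ m, m < b → coeff m g = 0) (hm : m < a + b) : coeff m (f * g) = 0 := by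
  rw [Laur.coeff_mul]
  refine Finset.sum_eq_zero fun p hp => ?_
  rw [Finset.mem_antidiagonal] at hp
  by_cases h : p.1 < a
  · rw [hf _ h, zero_mul]
  · rw [hg _ (by have := hp.2.2; omega), mul_zero]

theorem VanishBelow.add (hA : VanishBelow a A) (hB : VanishBelow a B) :
    VanishBelow a (A + B) := fun i j m hm => by
  rw [Matrix.add_apply, map_add, hA i j m hm, hB i j m hm, add_zero]

theorem VanishBelow.sub (hA : VanishBelow a A) (hB : VanishBelow a B) :
    VanishBelow a (A - B) := fun i j m hm => by
  rw [Matrix.sub_apply, map_sub, hA i j m hm, hB i j m hm, sub_zero]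

theorem VanishBelow.zero : VanishBelow a (0 : Matrix (Fin N) (Fin N) Laur) :=
  fun _ _ m _ => map_zero (coeff m)

theorem VanishBelow.smul (c : ℂ) (hA : VanishBelow a A) : VanishBelow a (c • A) :=
  fun i j m hm => by rw [Matrix.smul_apply, map_smul, hA i j m hm, smul_zero]

theorem VanishBelow.mul (hA : VanishBelow a A) (hB : VanishBelow b B) :
    VanishBelow (a + b) (A * B) := fun i j m hm => by
  rw [Matrix.mul_apply, map_sum]
  exact Finset.sum_eq_zero fun k _ => coeff_mul_eq_zero (hA i k) (hB k j) hm

theorem VanishBelow.lie (hA : VanishBelow a A) (hB : VanishBelow b B) :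
    VanishBelow (a + b) ⁅A, B⁆ := by
  rw [Ring.lie_def]
  refine (hA.mul hB).sub ?_
  rw [add_comm]
  exact hB.mul hA

theorem VanishBelow.deriv (hA : VanishBelow (a + 1) A) : VanishBelow a (A.map Laur.deriv) :=
  fun i j m hm => by
    rw [Matrix.map_apply, coeff_deriv, hA i j (m + 1) (by omega), mul_zero]

theorem resForm_eq_zero (hA : VanishBelow 1 A) (hB : VanishBelow 0 B) : resForm A B = 0 := by
  have h : VanishBelow (0 + 0) (A.map Laur.deriv * B) := VanishBelow.mul (VanishBelow.deriv hA) hB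
  rw [resForm, Matrix.trace, map_sum]
  exact Finset.sum_eq_zero fun i _ => h i i (-1) (by norm_num)

end VanishBelow

/-- A constant matrix as a formal loop. -/
def constMat {N : ℕ} (A : Matrix (Fin N) (Fin N) ℂ) : Matrix (Fin N) (Fin N) Laur :=
  A.map (Algebra.ofId ℂ Laur)

theorem constMat_vanishBelow {N : ℕ} (A : Matrix (Fin N) (Fin N) ℂ) :
    VanishBelow 0 (constMat A) := fun i j m hm => by
  change coeff m (monomial 0 (A i j)) = 0
  rw [coeff_monomial, if_neg hm.ne]

theorem Ad_gamma_cartan {N : ℕ} (H : cartan N) :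
    Ad (gamma N) (H : Matrix (Fin N) (Fin N) ℂ) = H := by
  obtain ⟨d, hd⟩ : ∃ d, (H : Matrix (Fin N) (Fin N) ℂ) = Matrix.diagonal d :=
    ⟨_, H.2.1.diagonal_diag.symm⟩
  have hmap : ∀ g : Matrix (Fin N) (Fin N) ℂ, g.map (algebraMap ℂ ℂ) = g := fun g => by
    ext i j
    simp
  have hcomm : gamma N * Matrix.diagonal d = Matrix.diagonal d * gamma N := by
    rw [gamma, Matrix.diagonal_mul_diagonal, Matrix.diagonal_mul_diagonal]
    simp only [mul_comm]
  rw [Ad, hmap, hmap, hd, hcomm, mul_assoc, Matrix.mul_nonsing_inv _ (isUnit_gamma N), mul_one]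

/-- An element of the Cartan subalgebra as a constant twisted loop. -/
def constLoop {N : ℕ} (ζ : ℂˣ) (H : cartan N) : twLoop N ζ :=
  ⟨constMat (H : Matrix (Fin N) (Fin N) ℂ), by
    refine ⟨?_, ?_⟩
    · rw [constMat, trace_map, H.2.2, map_zero]
    · rw [constMat, ← map_Ad, Ad_gamma_cartan]
      ext1 i j
      exact (rescale ζ).commutes _⟩

theorem Ad_beta_diag {N : ℕ} (d : Fin N → ℂ) :
    ∃ d', beta N * Matrix.diagonal d * (beta N)⁻¹ = Matrix.diagonal d' := by
  rcases Nat.eq_zero_or_pos N with rfl | hN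
  · exact ⟨d, Subsingleton.elim _ _⟩
  · refine ⟨fun i => d ⟨((i : ℕ) + 1) % N, Nat.mod_lt _ hN⟩, ?_⟩
    have h : beta N * Matrix.diagonal d =
        Matrix.diagonal (fun i : Fin N => d ⟨((i : ℕ) + 1) % N, Nat.mod_lt _ hN⟩) * beta N := by
      ext i j
      rw [Matrix.mul_diagonal, Matrix.diagonal_mul]
      simp only [beta, Matrix.of_apply]
      split_ifs with hij
      · have : j = ⟨((i : ℕ) + 1) % N, Nat.mod_lt _ hN⟩ := Fin.ext hij
        rw [this, mul_comm]
      · simp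
    rw [h, mul_assoc, Matrix.mul_nonsing_inv _ (isUnit_beta N), mul_one]

/-- `Ad β` on the Cartan subalgebra. -/
def AdBeta {N : ℕ} : cartan N →ₗ[ℂ] cartan N where
  toFun H := ⟨Ad (beta N) (H : Matrix (Fin N) (Fin N) ℂ), by
    refine ⟨?_, by rw [trace_Ad (isUnit_beta N), H.2.2]⟩
    have hmap : ∀ g : Matrix (Fin N) (Fin N) ℂ, g.map (algebraMap ℂ ℂ) = g := fun g => by
      ext i j
      simp
    obtain ⟨d, hd⟩ : ∃ d, (H : Matrix (Fin N) (Fin N) ℂ) = Matrix.diagonal d :=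
      ⟨_, H.2.1.diagonal_diag.symm⟩
    obtain ⟨d', hd'⟩ := Ad_beta_diag d
    rw [Ad, hmap, hmap, hd, hd']
    exact Matrix.isDiag_diagonal d'⟩
  map_add' _ _ := Subtype.ext (Ad_add _ _ _)
  map_smul' _ _ := Subtype.ext (Ad_smul _ _ _)

/-- The subspace `n_{γ,+}` of the twisted loops with strictly positive powers of `ξ`. -/
def nPlus (N : ℕ) (ζ : ℂˣ) : Submodule ℂ (twLoop N ζ) where
  carrier := {A | VanishBelow 1 (A : Matrix (Fin N) (Fin N) Laur)}
  add_mem' hA hB := VanishBelow.add hA hB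
  zero_mem' := VanishBelow.zero
  smul_mem' c _ hA := VanishBelow.smul c hA

section Verma

variable (N : ℕ) (ζ : ℂˣ) (k : ℂ)

/-- The left ideal `J(0) = U ĝ_γ n_{γ,+} + U ĝ_γ (k̂ - k)` of the universal enveloping algebra. -/
def vermaIdeal : Submodule (UniversalEnvelopingAlgebra ℂ (AffTw N ζ))
    (UniversalEnvelopingAlgebra ℂ (AffTw N ζ)) :=
  Submodule.span _
    ({x | ∃ A ∈ nPlus N ζ, x = UniversalEnvelopingAlgebra.ι ℂ (Aff.of A : AffTw N ζ)} ∪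
      {UniversalEnvelopingAlgebra.ι ℂ (Aff.khat : AffTw N ζ) - algebraMap ℂ _ k})

/-- The universal Verma module `M(0) = U ĝ_γ / J(0)` of level `k`. -/
def UVerma : Type := UniversalEnvelopingAlgebra ℂ (AffTw N ζ) ⧸ vermaIdeal N ζ k

instance : AddCommGroup (UVerma N ζ k) :=
  inferInstanceAs (AddCommGroup (UniversalEnvelopingAlgebra ℂ (AffTw N ζ) ⧸ vermaIdeal N ζ k))

instance : Module ℂ (UVerma N ζ k) :=
  inferInstanceAs (Module ℂ (UniversalEnvelopingAlgebra ℂ (AffTw N ζ) ⧸ vermaIdeal N ζ k))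

instance : Module (UniversalEnvelopingAlgebra ℂ (AffTw N ζ)) (UVerma N ζ k) :=
  inferInstanceAs (Module (UniversalEnvelopingAlgebra ℂ (AffTw N ζ))
    (UniversalEnvelopingAlgebra ℂ (AffTw N ζ) ⧸ vermaIdeal N ζ k))

instance : IsScalarTower ℂ (UniversalEnvelopingAlgebra ℂ (AffTw N ζ)) (UVerma N ζ k) :=
  inferInstanceAs (IsScalarTower ℂ (UniversalEnvelopingAlgebra ℂ (AffTw N ζ))
    (UniversalEnvelopingAlgebra ℂ (AffTw N ζ) ⧸ vermaIdeal N ζ k))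

namespace UVerma

/-- The class of `x ∈ U ĝ_γ` in `M(0)`. -/
def mk : UniversalEnvelopingAlgebra ℂ (AffTw N ζ) →ₗ[UniversalEnvelopingAlgebra ℂ (AffTw N ζ)]
    UVerma N ζ k := (vermaIdeal N ζ k).mkQ

/-- The cyclic vector. -/
def vac : UVerma N ζ k := mk N ζ k 1

instance : LieRingModule (AffTw N ζ) (UVerma N ζ k) where
  bracket x v := UniversalEnvelopingAlgebra.ι ℂ x • v
  add_lie x y v := by
    change UniversalEnvelopingAlgebra.ι ℂ (x + y) • v = _
    rw [map_add, add_smul]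
  lie_add x v w := smul_add (UniversalEnvelopingAlgebra.ι ℂ x) v w
  leibniz_lie x y v := by
    change UniversalEnvelopingAlgebra.ι ℂ x • UniversalEnvelopingAlgebra.ι ℂ y • v =
      UniversalEnvelopingAlgebra.ι ℂ ⁅x, y⁆ • v +
        UniversalEnvelopingAlgebra.ι ℂ y • UniversalEnvelopingAlgebra.ι ℂ x • v
    rw [LieHom.map_lie, Ring.lie_def, sub_smul, mul_smul, mul_smul, sub_add_cancel]

theorem lie_def (x : AffTw N ζ) (v : UVerma N ζ k) :
    ⁅x, v⁆ = UniversalEnvelopingAlgebra.ι ℂ x • v := rfl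

instance : LieModule ℂ (AffTw N ζ) (UVerma N ζ k) where
  smul_lie c x v := by rw [lie_def, lie_def, map_smul, smul_assoc]
  lie_smul c x v := by
    rw [lie_def, lie_def]
    exact smul_algebra_smul_comm c (UniversalEnvelopingAlgebra.ι ℂ x) v

variable {N ζ k}

/-- `J(0)` is stable under right multiplication by the Cartan subalgebra. -/
theorem mul_mem_vermaIdeal (H : cartan N) {x : UniversalEnvelopingAlgebra ℂ (AffTw N ζ)}
    (hx : x ∈ vermaIdeal N ζ k) :
    x * UniversalEnvelopingAlgebra.ι ℂ (Aff.of (constLoop ζ H) : AffTw N ζ) ∈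
      vermaIdeal N ζ k := by
  induction hx using Submodule.span_induction with
  | mem x hx =>
    have hcomm : ∀ y z : AffTw N ζ, UniversalEnvelopingAlgebra.ι ℂ y *
        UniversalEnvelopingAlgebra.ι ℂ z = UniversalEnvelopingAlgebra.ι ℂ z *
        UniversalEnvelopingAlgebra.ι ℂ y + UniversalEnvelopingAlgebra.ι ℂ ⁅y, z⁆ := by
      intro y z
      rw [LieHom.map_lie, Ring.lie_def, add_sub_cancel]
    rcases hx with ⟨A, hA, rfl⟩ | hx
    · have hH : VanishBelow 0 ((constLoop ζ H : twLoop N ζ) : Matrix (Fin N) (Fin N) Laur) :=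
        constMat_vanishBelow _
      rw [hcomm, Aff.lie_of_of, resForm_eq_zero hA hH, mul_zero, zero_smul, add_zero]
      refine Submodule.add_mem _ ?_ ?_
      · exact Submodule.smul_mem _ _ (Submodule.subset_span (Or.inl ⟨A, hA, rfl⟩))
      · refine Submodule.subset_span (Or.inl ⟨_, ?_, rfl⟩)
        exact VanishBelow.lie (a := 1) (b := 0) hA hH
    · rw [Set.mem_singleton_iff] at hx
      have h0 : ⁅(Aff.khat : AffTw N ζ), (Aff.of (constLoop ζ H) : AffTw N ζ)⁆ = 0 := by
        rw [← lie_skew, Aff.lie_khat, neg_zero]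
      rw [hx, sub_mul, hcomm, h0, map_zero, add_zero, Algebra.commutes, ← mul_sub]
      exact Submodule.smul_mem _ _ (Submodule.subset_span (Or.inr rfl))
  | zero => rw [zero_mul]; exact Submodule.zero_mem _
  | add x y _ _ hx hy => rw [add_mul]; exact Submodule.add_mem _ hx hy
  | smul a x _ hx => rw [smul_mul_assoc]; exact Submodule.smul_mem _ a hx

/-- The right action `[x] ↦ [x H]` of the Cartan subalgebra on `M(0)`. -/
def rightAct (H : cartan N) :
    UVerma N ζ k →ₗ[UniversalEnvelopingAlgebra ℂ (AffTw N ζ)] UVerma N ζ k :=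
  (vermaIdeal N ζ k).mapQ (vermaIdeal N ζ k)
    (LinearMap.toSpanSingleton (UniversalEnvelopingAlgebra ℂ (AffTw N ζ))
      (UniversalEnvelopingAlgebra ℂ (AffTw N ζ))
      (UniversalEnvelopingAlgebra.ι ℂ (Aff.of (constLoop ζ H) : AffTw N ζ)))
    (fun _ hx => mul_mem_vermaIdeal H hx)

theorem rightAct_mk (H : cartan N) (x : UniversalEnvelopingAlgebra ℂ (AffTw N ζ)) :
    rightAct H (mk N ζ k x) =
      mk N ζ k (x * UniversalEnvelopingAlgebra.ι ℂ (Aff.of (constLoop ζ H) : AffTw N ζ)) := rfl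

/-- The right action as a linear map over `ℂ`. -/
def right (H : cartan N) : UVerma N ζ k →ₗ[ℂ] UVerma N ζ k :=
  (rightAct H).restrictScalars ℂ

theorem right_lie (H : cartan N) (x : AffTw N ζ) (v : UVerma N ζ k) :
    right H ⁅x, v⁆ = ⁅x, right H v⁆ :=
  (rightAct H).map_smul (UniversalEnvelopingAlgebra.ι ℂ x) v

end UVerma

end Verma

/-! ### Meromorphic sections on the sphere

Meromorphic functions on `P¹(ℂ)` are the rational functions in `t`; the points of `P¹(ℂ)` are
the elements of `OnePoint ℂ`. -/

/-- Substitution of a transcendental element `a` for `t`. -/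
def substHom {F : Type*} [Field F] [Algebra ℂ F] (a : F) (ha : Transcendental ℂ a) :
    RatFunc ℂ →ₐ[ℂ] F :=
  RatFunc.liftAlgHom (Polynomial.aeval a)
    (nonZeroDivisors_le_comap_nonZeroDivisors_of_injective _
      (transcendental_iff_injective.mp ha))

theorem substHom_X {F : Type*} [Field F] [Algebra ℂ F] (a : F) (ha : Transcendental ℂ a) :
    substHom a ha RatFunc.X = a := by
  rw [substHom, RatFunc.liftAlgHom_apply]
  simp

theorem ratFunc_hom_ext {F : Type*} [Field F] [Algebra ℂ F] {φ ψ : RatFunc ℂ →ₐ[ℂ] F}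
    (h : φ RatFunc.X = ψ RatFunc.X) : φ = ψ := by
  refine IsLocalization.algHom_ext (nonZeroDivisors (Polynomial ℂ)) ?_
  refine Polynomial.algHom_ext ?_
  change φ (algebraMap (Polynomial ℂ) (RatFunc ℂ) Polynomial.X) =
    ψ (algebraMap (Polynomial ℂ) (RatFunc ℂ) Polynomial.X)
  rw [RatFunc.algebraMap_X, h]

/-- The function `t` in terms of the local coordinate `ξ`: `t = p + ξ` at `p ∈ ℂ`, and
`t = ξ⁻¹` at `∞`. -/
def coordAt : OnePoint ℂ → Laur
  | none => xi⁻¹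
  | some p => algebraMap ℂ Laur p + xi

theorem transcendental_coordAt (P : OnePoint ℂ) : Transcendental ℂ (coordAt P) := by
  cases P with
  | infty => exact fun h => transcendental_xi (inv_inv xi ▸ IsAlgebraic.inv h)
  | coe p =>
    intro h
    refine transcendental_xi ?_
    have := IsAlgebraic.sub h (isAlgebraic_algebraMap p)
    rwa [show coordAt (p : OnePoint ℂ) = algebraMap ℂ Laur p + xi from rfl,
      add_sub_cancel_left] at this

/-- The Laurent expansion of a rational function at a point of `P¹(ℂ)`. -/
def expand (P : OnePoint ℂ) : RatFunc ℂ →ₐ[ℂ] Laur :=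
  substHom (coordAt P) (transcendental_coordAt P)

theorem transcendental_smul_X (c : ℂˣ) : Transcendental ℂ ((c : ℂ) • (RatFunc.X : RatFunc ℂ)) := by
  intro h
  refine RatFunc.transcendental_X (K := ℂ) ?_
  have := IsAlgebraic.smul h ((c⁻¹ : ℂˣ) : ℂ)
  rwa [smul_smul, Units.inv_mul, one_smul] at this

/-- The substitution `f(t) ↦ f(c t)`. -/
def rotate (c : ℂˣ) : RatFunc ℂ →ₐ[ℂ] RatFunc ℂ :=
  substHom ((c : ℂ) • RatFunc.X) (transcendental_smul_X c)

/-- The meromorphic sections of `g^orb`: the `sl_N(ℂ)`-valued rational functions `f(t)` with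
`f(ε t) = Ad γ (f(t))`. -/
def secOrb (N : ℕ) : LieSubalgebra ℂ (Matrix (Fin N) (Fin N) (RatFunc ℂ)) :=
  twistedFixed N (rotate (eps N))

theorem expand_zero_rotate (c : ℂˣ) :
    (expand ((0 : ℂ) : OnePoint ℂ)).comp (rotate c) =
      (rescale c).comp (expand ((0 : ℂ) : OnePoint ℂ)) := by
  have h0 : coordAt ((0 : ℂ) : OnePoint ℂ) = xi := by
    change algebraMap ℂ Laur 0 + xi = xi
    rw [map_zero, zero_add]
  refine ratFunc_hom_ext ?_
  rw [AlgHom.comp_apply, AlgHom.comp_apply, rotate, substHom_X, map_smul, expand, substHom_X, h0,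
    xi, rescale_monomial, zpow_one]

theorem expand_infty_rotate (c : ℂˣ) :
    (expand OnePoint.infty).comp (rotate c) = (rescale c⁻¹).comp (expand OnePoint.infty) := by
  have h0 : coordAt OnePoint.infty = monomial (-1) 1 := by
    change xi⁻¹ = _
    refine inv_eq_of_mul_eq_one_right ?_
    rw [xi, monomial_mul_monomial, ← map_one (algebraMap ℂ Laur), algebraMap_eq]
    simp
  refine ratFunc_hom_ext ?_
  rw [AlgHom.comp_apply, AlgHom.comp_apply, rotate, substHom_X, map_smul, expand, substHom_X, h0,
    rescale_monomial, inv_zpow, zpow_neg, inv_inv, zpow_one]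

theorem map_mem_twistedFixed {N : ℕ} {R S : Type*} [CommRing R] [CommRing S] [Algebra ℂ R]
    [Algebra ℂ S] {φ : R →ₐ[ℂ] R} {ψ : S →ₐ[ℂ] S} (e : R →ₐ[ℂ] S) (h : e.comp φ = ψ.comp e)
    {A : Matrix (Fin N) (Fin N) R} (hA : A ∈ twistedFixed N φ) :
    A.map e ∈ twistedFixed N ψ := by
  refine ⟨by rw [trace_map, hA.1, map_zero], ?_⟩
  rw [← map_Ad, ← hA.2]
  ext1 i j
  exact (DFunLike.congr_fun h (A i j)).symm

section Germs

variable {N : ℕ}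

/-- The germ of a section at a point `P ≠ 0, ∞` of `P¹(ℂ)`. -/
def germ (P : OnePoint ℂ) : secOrb N →ₗ⁅ℂ⁆ slN N Laur where
  toFun f := ⟨(f : Matrix (Fin N) (Fin N) (RatFunc ℂ)).map (expand P), by
    change Matrix.trace _ = 0
    rw [trace_map, f.2.1, map_zero]⟩
  map_add' _ _ := Subtype.ext (map_add_matrix (expand P) _ _)
  map_smul' c _ := Subtype.ext (map_smul_matrix (expand P) c _)
  map_lie' := Subtype.ext (map_lie_matrix (expand P) _ _)

/-- The germ of a section at `0`. -/
def germZero : secOrb N →ₗ⁅ℂ⁆ twLoop N (eps N) where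
  toFun f := ⟨(f : Matrix (Fin N) (Fin N) (RatFunc ℂ)).map (expand ((0 : ℂ) : OnePoint ℂ)),
    map_mem_twistedFixed _ (expand_zero_rotate (eps N)) f.2⟩
  map_add' _ _ := Subtype.ext (map_add_matrix (expand _) _ _)
  map_smul' c _ := Subtype.ext (map_smul_matrix (expand _) c _)
  map_lie' := Subtype.ext (map_lie_matrix (expand _) _ _)

/-- The germ of a section at `∞`. -/
def germInfty : secOrb N →ₗ⁅ℂ⁆ twLoop N (eps N)⁻¹ where
  toFun f := ⟨(f : Matrix (Fin N) (Fin N) (RatFunc ℂ)).map (expand OnePoint.infty),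
    map_mem_twistedFixed _ (expand_infty_rotate (eps N)) f.2⟩
  map_add' _ _ := Subtype.ext (map_add_matrix (expand _) _ _)
  map_smul' c _ := Subtype.ext (map_smul_matrix (expand _) c _)
  map_lie' := Subtype.ext (map_lie_matrix (expand _) _ _)

/-- The section `f` is regular at `P`. -/
def RegularAt (P : OnePoint ℂ) (f : secOrb N) : Prop :=
  VanishBelow 0 ((f : Matrix (Fin N) (Fin N) (RatFunc ℂ)).map (expand P))

/-- The value at `P` of a section that is regular at `P`. -/
def valueAt (P : OnePoint ℂ) (f : secOrb N) : Matrix (Fin N) (Fin N) ℂ :=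
  (f : Matrix (Fin N) (Fin N) (RatFunc ℂ)).map fun r => coeff 0 (expand P r)

theorem RegularAt.add {P : OnePoint ℂ} {f g : secOrb N} (hf : RegularAt P f)
    (hg : RegularAt P g) : RegularAt P (f + g) := by
  have h := VanishBelow.add hf hg
  rwa [← map_add_matrix] at h

theorem RegularAt.zero (P : OnePoint ℂ) : RegularAt P (0 : secOrb N) := by
  intro i j m _
  simp

theorem RegularAt.smul {P : OnePoint ℂ} {f : secOrb N} (c : ℂ) (hf : RegularAt P f) :
    RegularAt P (c • f) := by
  have h := VanishBelow.smul c hf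
  rwa [← map_smul_matrix] at h

theorem RegularAt.lie {P : OnePoint ℂ} {f g : secOrb N} (hf : RegularAt P f)
    (hg : RegularAt P g) : RegularAt P ⁅f, g⁆ := by
  have h := VanishBelow.lie hf hg
  rwa [← map_lie_matrix, zero_add] at h

theorem coeff_zero_mul {f g : Laur} (hf : ∀ m, m < 0 → coeff m f = 0)
    (hg : ∀ m, m < 0 → coeff m g = 0) : coeff 0 (f * g) = coeff 0 f * coeff 0 g := by
  rw [Laur.coeff_mul, Finset.sum_eq_single ((0 : ℤ), (0 : ℤ))]
  · intro p hp hp0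
    rw [Finset.mem_antidiagonal] at hp
    have h := hp.2.2
    by_cases h1 : p.1 < 0
    · rw [hf _ h1, zero_mul]
    · by_cases h2 : p.2 < 0
      · rw [hg _ h2, mul_zero]
      · exact absurd (Prod.ext (by change p.1 = 0; omega) (by change p.2 = 0; omega)) hp0
  · intro h
    rw [Finset.mem_antidiagonal] at h
    by_cases h1 : coeff 0 f = 0
    · rw [h1, zero_mul]
    · by_cases h2 : coeff 0 g = 0
      · rw [h2, mul_zero]
      · exact absurd ⟨h1, h2, add_zero 0⟩ h

theorem valueAt_lie {P : OnePoint ℂ} {f g : secOrb N} (hf : RegularAt P f)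
    (hg : RegularAt P g) : valueAt P ⁅f, g⁆ = ⁅valueAt P f, valueAt P g⁆ := by
  ext i j
  simp only [valueAt, LieSubalgebra.coe_bracket, Ring.lie_def, Matrix.map_apply,
    Matrix.sub_apply, Matrix.mul_apply, map_sub, map_sum, map_mul]
  congr 1
  · exact Finset.sum_congr rfl fun k _ => coeff_zero_mul (hf i k) (hg k j)
  · exact Finset.sum_congr rfl fun k _ => coeff_zero_mul (hg i k) (hf k j)

theorem valueAt_add (P : OnePoint ℂ) (f g : secOrb N) :
    valueAt P (f + g) = valueAt P f + valueAt P g := by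
  ext i j
  simp [valueAt]

theorem valueAt_smul (P : OnePoint ℂ) (c : ℂ) (f : secOrb N) :
    valueAt P (c • f) = c • valueAt P f := by
  ext i j
  change coeff 0 (expand P (c • (f : Matrix (Fin N) (Fin N) (RatFunc ℂ)) i j)) = _
  rw [map_smul, map_smul]
  rfl

theorem valueAt_zero (P : OnePoint ℂ) : valueAt P (0 : secOrb N) = 0 := by
  ext i j
  simp [valueAt]

end Germs

/-- The union of the `C_N`-orbits `{ε ^ a t_i}` of the marked points. -/
def orbitSet (N : ℕ) {L : ℕ} (t : Fin L → ℂ) : Set (OnePoint ℂ) :=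
  {P | ∃ (i : Fin L) (a : ℕ), P = (((eps N : ℂ) ^ a * t i : ℂ) : OnePoint ℂ)}

/-- The Lie algebra of global sections of `g^orb` with poles in `D + 0 + ∞`. -/
def goutOrb (N : ℕ) {L : ℕ} (t : Fin L → ℂ) : LieSubalgebra ℂ (secOrb N) where
  carrier := {f | ∀ P : OnePoint ℂ, P ≠ ((0 : ℂ) : OnePoint ℂ) → P ≠ OnePoint.infty →
    P ∉ orbitSet N t → RegularAt P f}
  add_mem' hf hg P h0 h1 h2 := (hf P h0 h1 h2).add (hg P h0 h1 h2)
  zero_mem' P _ _ _ := RegularAt.zero P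
  smul_mem' c _ hf P h0 h1 h2 := (hf P h0 h1 h2).smul c
  lie_mem' hf hg P h0 h1 h2 := (hf P h0 h1 h2).lie (hg P h0 h1 h2)

/-- The Lie algebra of global sections of `g^trig` with poles in `D`: the sections `f` of `g^orb`
with poles in `D`, regular at `0` and `∞`, with `f(∞) = Ad β (f(0))`. -/
def goutTrig (N : ℕ) {L : ℕ} (t : Fin L → ℂ) : LieSubalgebra ℂ (secOrb N) where
  carrier := {f | (∀ P : OnePoint ℂ, P ∉ orbitSet N t → RegularAt P f) ∧
    RegularAt ((0 : ℂ) : OnePoint ℂ) f ∧ RegularAt OnePoint.infty f ∧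
    valueAt OnePoint.infty f = Ad (beta N) (valueAt ((0 : ℂ) : OnePoint ℂ) f)}
  add_mem' hf hg := ⟨fun P h => (hf.1 P h).add (hg.1 P h), hf.2.1.add hg.2.1,
    hf.2.2.1.add hg.2.2.1, by
      rw [valueAt_add, valueAt_add, Ad_add, hf.2.2.2, hg.2.2.2]⟩
  zero_mem' := ⟨fun P _ => RegularAt.zero P, RegularAt.zero _, RegularAt.zero _, by
    rw [valueAt_zero, valueAt_zero, Ad_zero]⟩
  smul_mem' c _ hf := ⟨fun P h => (hf.1 P h).smul c, hf.2.1.smul c, hf.2.2.1.smul c, by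
    rw [valueAt_smul, valueAt_smul, Ad_smul, hf.2.2.2]⟩
  lie_mem' hf hg := ⟨fun P h => (hf.1 P h).lie (hg.1 P h), hf.2.1.lie hg.2.1,
    hf.2.2.1.lie hg.2.2.1, by
      rw [valueAt_lie hf.2.2.1 hg.2.2.1, valueAt_lie hf.2.1 hg.2.1, Ad_lie (isUnit_beta N),
        hf.2.2.2, hg.2.2.2]⟩

/-! ### Conformal coinvariants -/

section Coinvariants

variable (N : ℕ) {L : ℕ} (t : Fin L → ℂ) (k : ℂ) (M : Fin L → Type u)
  [∀ i, AddCommGroup (M i)] [∀ i, Module ℂ (M i)] [∀ i, LieRingModule (AffLoc N) (M i)]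
  [∀ i, LieModule ℂ (AffLoc N) (M i)]

/-- The tensor product `M₁ ⊗ ⋯ ⊗ M_L`. -/
abbrev Tens : Type u := ⨂[ℂ] i, M i

/-- The action of `(A_i)_i ∈ ⨁_i g^{Q_i}` on `M₁ ⊗ ⋯ ⊗ M_L`: the sum over `i` of the action of
`A_i` on the `i`-th factor. Together with `k̂ ↦ k` this is the action of the central extension
`ĝ^D` on a tensor product of modules of level `k`. -/
def actD (A : Fin L → slN N Laur) : Module.End ℂ (Tens M) :=
  ∑ i, PiTensorProduct.map (Function.update (fun j => (LinearMap.id : M j →ₗ[ℂ] M j)) i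
    (LieModule.toEnd ℂ (AffLoc N) (M i) (Aff.of (A i))))

/-- The action of a section of `g^orb` on `M₁ ⊗ ⋯ ⊗ M_L`, through its germs at the points `t_i`. -/
def actTrig (f : secOrb N) : Module.End ℂ (Tens M) :=
  actD N M fun i => germ ((t i : ℂ) : OnePoint ℂ) f

/-- The subspace `g_out^trig M` of `M = M₁ ⊗ ⋯ ⊗ M_L`. -/
def goutTrigM : Submodule ℂ (Tens M) :=
  Submodule.span ℂ {w | ∃ f ∈ goutTrig N t, ∃ v : Tens M, w = actTrig N t M f v}

/-- The space of conformal coinvariants `CC_trig(M) = M / g_out^trig M`. -/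
abbrev CCtrig : Type u := Tens M ⧸ goutTrigM N t M

/-- `M(0)_0`, the universal Verma module of `ĝ^(0)`. -/
abbrev VermaZero : Type := UVerma N (eps N) k

/-- `M(0)_∞`, the universal Verma module of `ĝ^(∞)`. -/
abbrev VermaInfty : Type := UVerma N (eps N)⁻¹ k

/-- `M(0)_0 ⊗ M ⊗ M(0)_∞`. -/
abbrev TensOrb : Type u := VermaZero N k ⊗[ℂ] (Tens M ⊗[ℂ] VermaInfty N k)

/-- The action of a section of `g^orb` on `M(0)_0 ⊗ M ⊗ M(0)_∞`, through its germs at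
`0, t_1, …, t_L, ∞`. -/
def actOrb (f : secOrb N) : Module.End ℂ (TensOrb N k M) :=
  TensorProduct.map (LieModule.toEnd ℂ (AffTw N (eps N)) (VermaZero N k) (Aff.of (germZero f)))
      LinearMap.id +
    TensorProduct.map LinearMap.id (TensorProduct.map (actTrig N t M f) LinearMap.id) +
    TensorProduct.map LinearMap.id (TensorProduct.map LinearMap.id
      (LieModule.toEnd ℂ (AffTw N (eps N)⁻¹) (VermaInfty N k) (Aff.of (germInfty f))))

/-- The subspace `g_out^orb (M(0)_0 ⊗ M ⊗ M(0)_∞)`. -/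
def goutOrbM : Submodule ℂ (TensOrb N k M) :=
  Submodule.span ℂ {w | ∃ f ∈ goutOrb N t, ∃ v : TensOrb N k M, w = actOrb N t k M f v}

/-- The space of conformal coinvariants `CC_orb(M(0)_0 ⊗ M ⊗ M(0)_∞)`. -/
abbrev CCorb : Type u := TensOrb N k M ⧸ goutOrbM N t k M

/-- The right action `(v₀ ⊗ v ⊗ v_∞) ρ_{1,β}(H) = v₀ H ⊗ v ⊗ v_∞ + v₀ ⊗ v ⊗ v_∞ (Ad β H)`. -/
def rho (H : cartan N) : Module.End ℂ (TensOrb N k M) :=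
  TensorProduct.map (UVerma.right H) LinearMap.id +
    TensorProduct.map LinearMap.id (TensorProduct.map LinearMap.id (UVerma.right (AdBeta H)))

/-- The right action of the Cartan subalgebra commutes with the left action of the sections. -/
theorem rho_actOrb (H : cartan N) (f : secOrb N) (w : TensOrb N k M) :
    rho N k M H (actOrb N t k M f w) = actOrb N t k M f (rho N k M H w) := by
  suffices h : (rho N k M H).comp (actOrb N t k M f) =
      (actOrb N t k M f).comp (rho N k M H) from LinearMap.congr_fun h w
  have h0 : (UVerma.right H).comp
      (LieModule.toEnd ℂ (AffTw N (eps N)) (VermaZero N k) (Aff.of (germZero f))) =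
      LinearMap.comp
        (LieModule.toEnd ℂ (AffTw N (eps N)) (VermaZero N k) (Aff.of (germZero f)))
        (UVerma.right H) := LinearMap.ext fun v => UVerma.right_lie H _ v
  have h1 : (UVerma.right (AdBeta H)).comp
      (LieModule.toEnd ℂ (AffTw N (eps N)⁻¹) (VermaInfty N k) (Aff.of (germInfty f))) =
      LinearMap.comp
        (LieModule.toEnd ℂ (AffTw N (eps N)⁻¹) (VermaInfty N k) (Aff.of (germInfty f)))
        (UVerma.right (AdBeta H)) := LinearMap.ext fun v => UVerma.right_lie (AdBeta H) _ v
  simp only [rho, actOrb, LinearMap.add_comp, LinearMap.comp_add, ← TensorProduct.map_comp,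
    LinearMap.id_comp, LinearMap.comp_id, h0, h1]
  abel

theorem goutOrbM_le_comap_rho (H : cartan N) :
    goutOrbM N t k M ≤ (goutOrbM N t k M).comap (rho N k M H) := by
  refine Submodule.span_le.mpr ?_
  rintro _ ⟨f, hf, v, rfl⟩
  exact Submodule.subset_span ⟨f, hf, rho N k M H v, rho_actOrb N t k M H f v⟩

/-- The action of `ρ_{1,β}(H)` on `CC_orb(M(0)_0 ⊗ M ⊗ M(0)_∞)`. -/
def rhoCC (H : cartan N) : Module.End ℂ (CCorb N t k M) :=
  (goutOrbM N t k M).mapQ (goutOrbM N t k M) (rho N k M H) (goutOrbM_le_comap_rho N t k M H)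

/-- The subspace `CC_orb · h = CC_orb(M(0)_0 ⊗ M ⊗ M(0)_∞) ρ_{1,β}(h)`. -/
def CCorbCartan : Submodule ℂ (CCorb N t k M) :=
  Submodule.span ℂ {w | ∃ (H : cartan N) (x : CCorb N t k M), w = rhoCC N t k M H x}

/-- The class of `1_0 ⊗ v ⊗ 1_∞` in `CC_orb(M(0)_0 ⊗ M ⊗ M(0)_∞) / CC_orb · h`. -/
def vacClass (v : Tens M) : CCorb N t k M ⧸ CCorbCartan N t k M :=
  (CCorbCartan N t k M).mkQ ((goutOrbM N t k M).mkQ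
    (UVerma.vac N (eps N) k ⊗ₜ[ℂ] (v ⊗ₜ[ℂ] UVerma.vac N (eps N)⁻¹ k)))

end Coinvariants

end

end TwistedWZW

/-! The map `v ↦ [1_0 ⊗ v ⊗ 1_∞]` is shown to be surjective with kernel exactly `g_out^trig M`.

Surjectivity rests on density (`exists_goutOrb_approx`). Poles are free on at least one orbit, so
any pair of twisted loops at `0` and `∞` is approximated to any order by the two germs of a single
`f` in `g_out^orb`. Each vector of a universal Verma module is killed by all loops of high order, so
`f` can be made to act on given `x`, `y` exactly as the prescribed pair. Modulo `g_out^orb` the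
loops are thus moved from `x` and `y` onto `M`, and both Verma modules are generated by their cyclic
vectors (`tmul_mem_of_vac_mem`).

If `f` lies in `g_out^trig`, its value `H` at `0` is fixed by `Ad γ`, hence lies in the Cartan
subalgebra, and its value at `∞` is `Ad β (H)`. The positive parts of the germs kill the cyclic
vectors, and `H` acts on a cyclic vector in the same way from the left and from the right. So `f`
sends `1 ⊗ v ⊗ 1` to `1 ⊗ f v ⊗ 1 + (1 ⊗ v ⊗ 1) ρ(H)`, and `g_out^trig M` lies in the kernel.

For the converse, the projection `π : M → CC_trig(M)` is extended to an invariant map on `M(0)_0 ⊗ M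
⊗ M(0)_∞`. The algebra `g_out^orb` acts projectively on `Hom(M, V)` by the contragredient action.
The residue theorem converts the anomaly at the `t_i` into `k / N` times the residues at `0` and
`∞`; the factor `1 / N` appears because the `N` points of an orbit contribute equally
(`dualAction_commutator`). On the functionals killed by sections of high order at `0` and `∞`,
density extends this action to all pairs of twisted loops (`exists_completion`,
`completion_commutator`). The functional `π` is of this kind; it is killed by the positive loops and
by the pairs `(H, Ad β H)`. The universal property of the Verma modules, applied at `∞` and then at
`0`, gives a pairing `B` with `B(1, 1) = π` (`exists_verma_pairing`), and `x ⊗ v ⊗ y ↦ B(x, y)(v)`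
is the extension. -/

namespace TwistedWZW

noncomputable section

attribute [local instance 100] LieRing.ofAssociativeRing

open Laur

/-! ### Orders of Laurent series -/

namespace Laur

/-- The Laurent series with only terms `ξ ^ m`, `m ≥ a`. -/
def ordGE (a : ℤ) : Submodule ℂ Laur where
  carrier := {f | ∀ m, m < a → coeff m f = 0}
  add_mem' hf hg m hm := by rw [map_add, hf m hm, hg m hm, add_zero]
  zero_mem' m _ := map_zero _
  smul_mem' c f hf m hm := by rw [map_smul, hf m hm, smul_zero]

theorem mem_ordGE {a : ℤ} {f : Laur} : f ∈ ordGE a ↔ ∀ m, m < a → coeff m f = 0 := Iff.rfl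

theorem ordGE_anti {a b : ℤ} (h : a ≤ b) : ordGE b ≤ ordGE a :=
  fun _ hf m hm => hf m (hm.trans_le h)

theorem mul_mem_ordGE {a b : ℤ} {f g : Laur} (hf : f ∈ ordGE a) (hg : g ∈ ordGE b) :
    f * g ∈ ordGE (a + b) := fun _ hm => coeff_mul_eq_zero hf hg hm

/-- Among the pairs of exponents with sum `a + b`, every one other than `(a, b)` has a component
below its bound. -/
theorem coeff_mul_of_mem_ordGE {a b : ℤ} {f g : Laur} (hf : f ∈ ordGE a) (hg : g ∈ ordGE b) :
    coeff (a + b) (f * g) = coeff a f * coeff b g := by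
  rw [Laur.coeff_mul, Finset.sum_eq_single (a, b)]
  · intro p hp hp0
    rw [Finset.mem_antidiagonal] at hp
    have h := hp.2.2
    by_cases h1 : p.1 < a
    · rw [hf _ h1, zero_mul]
    · by_cases h2 : p.2 < b
      · rw [hg _ h2, mul_zero]
      · exact absurd (Prod.ext (by change p.1 = a; omega) (by change p.2 = b; omega)) hp0
  · intro h
    rw [Finset.mem_antidiagonal] at h
    by_cases h1 : coeff a f = 0
    · rw [h1, zero_mul]
    · by_cases h2 : coeff b g = 0
      · rw [h2, mul_zero]
      · exact absurd ⟨h1, h2, rfl⟩ h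

theorem monomial_mem_ordGE (m : ℤ) (c : ℂ) : monomial m c ∈ ordGE m := fun n hn => by
  rw [coeff_monomial, if_neg hn.ne]

theorem algebraMap_mem_ordGE (c : ℂ) : algebraMap ℂ Laur c ∈ ordGE 0 := monomial_mem_ordGE 0 c

theorem one_mem_ordGE : (1 : Laur) ∈ ordGE 0 := by
  rw [← map_one (algebraMap ℂ Laur)]
  exact algebraMap_mem_ordGE 1

theorem pow_mem_ordGE {a : ℤ} {f : Laur} (hf : f ∈ ordGE a) (n : ℕ) : f ^ n ∈ ordGE (n * a) := by
  induction n with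
  | zero => simpa using one_mem_ordGE
  | succ n ih =>
    have := mul_mem_ordGE ih hf
    rw [pow_succ]
    convert this using 2
    push_cast
    ring

theorem exists_mem_ordGE_coeff_ne_zero {f : Laur} (hf : f ≠ 0) :
    ∃ a, f ∈ ordGE a ∧ coeff a f ≠ 0 :=
  ⟨HahnSeries.order f, fun _ hm => HahnSeries.coeff_eq_zero_of_lt_order hm,
    fun h => hf (HahnSeries.coeff_order_eq_zero.mp h)⟩

theorem exists_mem_ordGE (f : Laur) : ∃ a, f ∈ ordGE a := by
  by_cases hf : f = 0
  · exact ⟨0, hf ▸ Submodule.zero_mem _⟩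
  · exact (exists_mem_ordGE_coeff_ne_zero hf).imp fun _ h => h.1

theorem coeff_one (m : ℤ) : coeff m 1 = if m = 0 then 1 else 0 := by
  rw [← map_one (algebraMap ℂ Laur), algebraMap_eq, coeff_monomial]

/-- The leading term of `f * f⁻¹ = 1` is the product of the leading terms, so the two orders add up
to zero and the leading coefficients are inverse to each other. -/
theorem inv_mem_ordGE_and_coeff {a : ℤ} {f : Laur} (hf : f ∈ ordGE a) (ha : coeff a f ≠ 0) :
    f⁻¹ ∈ ordGE (-a) ∧ coeff (-a) f⁻¹ = (coeff a f)⁻¹ := by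
  have h0 : f ≠ 0 := by
    rintro rfl
    exact ha (map_zero _)
  obtain ⟨b, hb, hb'⟩ := exists_mem_ordGE_coeff_ne_zero (inv_ne_zero h0)
  have h := coeff_mul_of_mem_ordGE hf hb
  rw [mul_inv_cancel₀ h0, coeff_one] at h
  have hab : a + b = 0 := by
    by_contra hab
    rw [if_neg hab] at h
    exact mul_ne_zero ha hb' h.symm
  obtain rfl : b = -a := by omega
  rw [if_pos hab] at h
  exact ⟨hb, eq_inv_of_mul_eq_one_right h.symm⟩

theorem inv_mem_ordGE {a : ℤ} {f : Laur} (hf : f ∈ ordGE a) (ha : coeff a f ≠ 0) :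
    f⁻¹ ∈ ordGE (-a) := (inv_mem_ordGE_and_coeff hf ha).1

/-- Differentiation usually lowers the order by one, but the constant term disappears, so a power
series stays a power series. -/
theorem deriv_mem_ordGE_zero {f : Laur} (hf : f ∈ ordGE 0) : deriv f ∈ ordGE 0 := fun m hm => by
  rw [coeff_deriv]
  rcases eq_or_ne (m + 1) 0 with h | h
  · have : (m : ℂ) + 1 = 0 := by exact_mod_cast h
    rw [this, zero_mul]
  · rw [hf (m + 1) (by omega), mul_zero]

theorem deriv_algebraMap (c : ℂ) : deriv (algebraMap ℂ Laur c) = 0 := by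
  ext m
  rw [coeff_deriv, algebraMap_eq, coeff_monomial, map_zero]
  split_ifs with h
  · have : (m : ℂ) + 1 = 0 := by exact_mod_cast h
    rw [this, zero_mul]
  · rw [mul_zero]

theorem deriv_one : deriv (1 : Laur) = 0 := by
  rw [← map_one (algebraMap ℂ Laur), deriv_algebraMap]

theorem deriv_monomial (m : ℤ) (c : ℂ) : deriv (monomial m c) = monomial (m - 1) (m * c) := by
  ext n
  rw [coeff_deriv, coeff_monomial, coeff_monomial]
  by_cases h : n = m - 1
  · subst h
    simp
  · rw [if_neg h, if_neg (by omega), mul_zero]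

theorem monomial_neg_one_pow (n : ℕ) : monomial (-1) 1 ^ n = monomial (-(n : ℤ)) 1 := by
  induction n with
  | zero => rw [pow_zero, ← map_one (algebraMap ℂ Laur), algebraMap_eq]; rfl
  | succ n ih =>
    rw [pow_succ, ih, monomial_mul_monomial, mul_one]
    congr 1
    push_cast
    ring

theorem deriv_inv (f : Laur) (hf : f ≠ 0) : deriv f⁻¹ = -(deriv f * (f⁻¹ * f⁻¹)) := by
  have h := deriv_mul f f⁻¹
  rw [mul_inv_cancel₀ hf, deriv_one] at h
  field_simp at h ⊢
  linear_combination -h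

theorem coeff_rescale_deriv (c : ℂˣ) (f : Laur) :
    deriv (rescale c f) = (c : ℂ) • rescale c (deriv f) := by
  ext m
  simp only [coeff_deriv, coeff_rescale, map_smul, zpow_add, zpow_one, Units.val_mul,
    smul_eq_mul]
  ring

end Laur

section

variable {N : ℕ}

theorem VanishBelow.anti {a b : ℤ} (h : a ≤ b) {A : Matrix (Fin N) (Fin N) Laur}
    (hA : VanishBelow b A) : VanishBelow a A := fun i j m hm => hA i j m (hm.trans_le h)

theorem exists_vanishBelow (A : Matrix (Fin N) (Fin N) Laur) : ∃ a, VanishBelow a A := by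
  choose a ha using fun p : Fin N × Fin N => exists_mem_ordGE (A p.1 p.2)
  obtain ⟨b, hb⟩ := (Set.finite_range a).bddBelow
  exact ⟨b, fun i j => ordGE_anti (hb ⟨(i, j), rfl⟩) (ha (i, j))⟩

/-- The product `A' B` has order at least `a + b - 1 ≥ 0`, hence no residue. This is the continuity
of the cocycle for the filtration by order. -/
theorem resForm_eq_zero_of_vanishBelow {a b : ℤ} (hab : 0 < a + b)
    {A B : Matrix (Fin N) (Fin N) Laur} (hA : VanishBelow a A) (hB : VanishBelow b B) :
    resForm A B = 0 := by
  have h : VanishBelow (a - 1 + b) (A.map Laur.deriv * B) :=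
    VanishBelow.mul (VanishBelow.deriv (by rwa [sub_add_cancel])) hB
  rw [resForm, Matrix.trace, map_sum]
  exact Finset.sum_eq_zero fun i _ => h i i (-1) (by omega)

end

/-! ### Expansions of rational functions -/

theorem expand_coe_X (p : ℂ) :
    expand (p : OnePoint ℂ) RatFunc.X = algebraMap ℂ Laur p + xi := substHom_X _ _

theorem coordAt_infty : coordAt OnePoint.infty = monomial (-1) 1 := by
  change xi⁻¹ = _
  refine inv_eq_of_mul_eq_one_right ?_
  rw [xi, monomial_mul_monomial, ← map_one (algebraMap ℂ Laur), algebraMap_eq]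
  simp

theorem expand_infty_X : expand OnePoint.infty RatFunc.X = monomial (-1) 1 :=
  (substHom_X _ _).trans coordAt_infty

/-- The linear function `t - p`. -/
def linFun (p : ℂ) : RatFunc ℂ := RatFunc.X - algebraMap ℂ (RatFunc ℂ) p

theorem expand_coe_linFun (p q : ℂ) :
    expand (q : OnePoint ℂ) (linFun p) = algebraMap ℂ Laur (q - p) + xi := by
  rw [linFun, map_sub, expand_coe_X, AlgHom.commutes, map_sub]
  ring

theorem expand_infty_linFun (p : ℂ) :
    expand OnePoint.infty (linFun p) = monomial (-1) 1 - algebraMap ℂ Laur p := by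
  rw [linFun, map_sub, expand_infty_X, AlgHom.commutes]

theorem linFun_ne_zero (p : ℂ) : linFun p ≠ 0 := by
  intro h
  have h1 := congrArg (fun f => coeff 1 (expand (p : OnePoint ℂ) f)) h
  simp [expand_coe_linFun, xi, coeff_monomial] at h1

theorem coeff_algebraMap (m : ℤ) (c : ℂ) :
    coeff m (algebraMap ℂ Laur c) = if m = 0 then c else 0 := by
  rw [algebraMap_eq, coeff_monomial]

theorem algebraMap_add_xi_mem_ordGE (c : ℂ) : algebraMap ℂ Laur c + xi ∈ ordGE 0 :=
  Submodule.add_mem _ (algebraMap_mem_ordGE c) (ordGE_anti zero_le_one (monomial_mem_ordGE 1 1))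

theorem expand_coe_inv_linFun_mem {p q : ℂ} (h : p ≠ q) :
    expand (q : OnePoint ℂ) (linFun p)⁻¹ ∈ ordGE 0 := by
  rw [map_inv₀, expand_coe_linFun]
  have := inv_mem_ordGE (algebraMap_add_xi_mem_ordGE (q - p))
    (by simp [coeff_algebraMap, xi, coeff_monomial, sub_ne_zero, h.symm])
  simpa using this

/-- Here `(t - p)⁻¹ = ξ / (1 - p ξ)`. The leading coefficient `1` is what balances the residue at
`p`. -/
theorem expand_infty_inv_linFun (p : ℂ) :
    expand OnePoint.infty (linFun p)⁻¹ ∈ ordGE 1 ∧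
      coeff 1 (expand OnePoint.infty (linFun p)⁻¹) = 1 := by
  rw [map_inv₀, expand_infty_linFun]
  have := inv_mem_ordGE_and_coeff (a := -1) (f := monomial (-1) 1 - algebraMap ℂ Laur p)
    (Submodule.sub_mem _ (monomial_mem_ordGE _ _)
      (ordGE_anti (by norm_num) (algebraMap_mem_ordGE p)))
    (by simp [coeff_algebraMap, coeff_monomial])
  simpa [coeff_algebraMap, coeff_monomial] using this

/-! ### Partial fractions and the residue theorem -/

/-- The span of the powers of `t` and of the negative powers of the `t - p`. -/
def partialFractions : Submodule ℂ (RatFunc ℂ) :=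
  Submodule.span ℂ (Set.range (fun n : ℕ => (RatFunc.X : RatFunc ℂ) ^ n) ∪
    Set.range fun q : ℂ × ℕ => (linFun q.1)⁻¹ ^ (q.2 + 1))

theorem X_pow_mem_partialFractions (n : ℕ) : (RatFunc.X : RatFunc ℂ) ^ n ∈ partialFractions :=
  Submodule.subset_span (Or.inl ⟨n, rfl⟩)

theorem inv_linFun_pow_mem_partialFractions (p : ℂ) (n : ℕ) :
    (linFun p)⁻¹ ^ n ∈ partialFractions := by
  cases n with
  | zero => simpa using X_pow_mem_partialFractions 0
  | succ n => exact Submodule.subset_span (Or.inr ⟨(p, n), rfl⟩)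

/-- Two rewritings suffice, each used inductively: `t^(n+1) / (t-p) = t^n + p t^n / (t-p)`, and for
`p ≠ q` the resolution of `1 / ((t-p)(t-q))` as a multiple of `1/(t-p) - 1/(t-q)`. -/
theorem inv_linFun_mul_mem_partialFractions (p : ℂ) {h : RatFunc ℂ} (hh : h ∈ partialFractions) :
    (linFun p)⁻¹ * h ∈ partialFractions := by
  have hp := linFun_ne_zero p
  induction hh using Submodule.span_induction with
  | mem h hh =>
    rcases hh with ⟨n, rfl⟩ | ⟨⟨q, n⟩, rfl⟩
    · dsimp only
      induction n with
      | zero => simpa using inv_linFun_pow_mem_partialFractions p 1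
      | succ n ih =>
        have : (linFun p)⁻¹ * RatFunc.X ^ (n + 1) =
            RatFunc.X ^ n + p • ((linFun p)⁻¹ * RatFunc.X ^ n) := by
          rw [Algebra.smul_def]
          field_simp
          rw [linFun]
          ring
        rw [this]
        exact Submodule.add_mem _ (X_pow_mem_partialFractions n) (Submodule.smul_mem _ _ ih)
    · dsimp only
      rcases eq_or_ne p q with rfl | hpq
      · rw [← pow_succ']
        exact inv_linFun_pow_mem_partialFractions p _
      · have hq := linFun_ne_zero q
        have key : (linFun p)⁻¹ * (linFun q)⁻¹ =
            (p - q)⁻¹ • ((linFun p)⁻¹ - (linFun q)⁻¹) := by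
          have h1 : linFun q - linFun p = algebraMap ℂ (RatFunc ℂ) (p - q) := by
            simp [linFun]
          have h2 : (p - q) • ((linFun p)⁻¹ * (linFun q)⁻¹) = (linFun p)⁻¹ - (linFun q)⁻¹ := by
            rw [Algebra.smul_def, ← h1]
            field_simp
          rw [← h2, smul_smul, inv_mul_cancel₀ (sub_ne_zero.mpr hpq), one_smul]
        induction n with
        | zero =>
          rw [zero_add, pow_one, key]
          exact Submodule.smul_mem _ _ (Submodule.sub_mem _
            (by simpa using inv_linFun_pow_mem_partialFractions p 1)
            (by simpa using inv_linFun_pow_mem_partialFractions q 1))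
        | succ n ih =>
          rw [pow_succ', ← mul_assoc, key, smul_mul_assoc, sub_mul, ← pow_succ']
          exact Submodule.smul_mem _ _ (Submodule.sub_mem _ ih
            (inv_linFun_pow_mem_partialFractions q _))
  | zero => rw [mul_zero]; exact Submodule.zero_mem _
  | add x y _ _ hx hy => rw [mul_add]; exact Submodule.add_mem _ hx hy
  | smul a x _ hx => rw [mul_smul_comm]; exact Submodule.smul_mem _ a hx

theorem algebraMap_polynomial_mem_partialFractions (p : Polynomial ℂ) :
    algebraMap (Polynomial ℂ) (RatFunc ℂ) p ∈ partialFractions := by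
  induction p using Polynomial.induction_on' with
  | add p q hp hq => rw [map_add]; exact Submodule.add_mem _ hp hq
  | monomial n a =>
    rw [← mul_one a, ← smul_eq_mul, ← Polynomial.smul_monomial, ← Polynomial.X_pow_eq_monomial,
      Algebra.smul_def, map_mul, map_pow, RatFunc.algebraMap_X,
      ← IsScalarTower.algebraMap_apply ℂ (Polynomial ℂ) (RatFunc ℂ), ← Algebra.smul_def]
    exact Submodule.smul_mem _ _ (X_pow_mem_partialFractions n)

/-- Over `ℂ` the denominator splits into linear factors, which are divided out one at a time,
starting from the numerator. -/
theorem mem_partialFractions (h : RatFunc ℂ) : h ∈ partialFractions := by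
  rw [← RatFunc.num_div_denom h, div_eq_inv_mul]
  rw [(IsAlgClosed.splits h.denom).eq_prod_roots, map_mul, mul_inv, mul_assoc]
  generalize h.denom.leadingCoeff = c
  have hs : ∀ s : Multiset ℂ, (algebraMap (Polynomial ℂ) (RatFunc ℂ)
      (s.map fun a => Polynomial.X - Polynomial.C a).prod)⁻¹ *
        algebraMap (Polynomial ℂ) (RatFunc ℂ) h.num ∈ partialFractions := by
    intro s
    induction s using Multiset.induction with
    | empty => simpa using algebraMap_polynomial_mem_partialFractions h.num
    | cons a s ih =>
      rw [Multiset.map_cons, Multiset.prod_cons, map_mul, mul_inv, mul_assoc]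
      have ha : algebraMap (Polynomial ℂ) (RatFunc ℂ) (Polynomial.X - Polynomial.C a) =
          linFun a := by
        rw [map_sub, RatFunc.algebraMap_X, linFun, IsScalarTower.algebraMap_apply ℂ (Polynomial ℂ)]
        rfl
      rw [ha]
      exact inv_linFun_mul_mem_partialFractions a ih
  have hc : algebraMap (Polynomial ℂ) (RatFunc ℂ) (Polynomial.C c) =
      algebraMap ℂ (RatFunc ℂ) c :=
    (IsScalarTower.algebraMap_apply ℂ (Polynomial ℂ) (RatFunc ℂ) c).symm
  rw [hc, ← map_inv₀, ← Algebra.smul_def]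
  exact Submodule.smul_mem _ _ (hs _)

/-- Since `dt = -ξ⁻² dξ` at `∞`, the coefficient of `ξ` there is minus the residue of `h dt`. Asking
for all sufficiently large `S`, rather than for the exact set of poles, makes the statement additive
in `h`, so that it can be checked on partial fractions. -/
theorem exists_sum_residue_eq (h : RatFunc ℂ) : ∃ S₀ : Finset ℂ, ∀ S, S₀ ⊆ S →
    ∑ p ∈ S, coeff (-1) (expand (p : OnePoint ℂ) h) = coeff 1 (expand OnePoint.infty h) := by
  have hh := mem_partialFractions h
  induction hh using Submodule.span_induction with
  | mem h hh =>
    rcases hh with ⟨n, rfl⟩ | ⟨⟨q, n⟩, rfl⟩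
    · refine ⟨∅, fun S _ => ?_⟩
      dsimp only
      rw [Finset.sum_eq_zero]
      · rw [map_pow, expand_infty_X]
        rw [monomial_neg_one_pow, coeff_monomial, if_neg (by omega)]
      · intro p _
        rw [map_pow, expand_coe_X]
        have := pow_mem_ordGE (algebraMap_add_xi_mem_ordGE p) n
        exact this _ (by simp)
    · refine ⟨{q}, fun S hS => ?_⟩
      dsimp only
      have hq : q ∈ S := hS (Finset.mem_singleton_self q)
      rw [Finset.sum_eq_single_of_mem q hq]
      · have hx : xi⁻¹ = monomial (-1) 1 := coordAt_infty
        rw [map_pow, map_inv₀, expand_coe_linFun, sub_self, map_zero, zero_add, hx]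
        obtain ⟨h1, h2⟩ := expand_infty_inv_linFun q
        cases n with
        | zero => rw [zero_add, pow_one, map_pow, pow_one, h2, coeff_monomial, if_pos rfl]
        | succ n =>
          rw [monomial_neg_one_pow, coeff_monomial, if_neg (by push_cast; omega)]
          rw [map_pow]
          exact (pow_mem_ordGE h1 (n + 1 + 1) _ (by push_cast; omega)).symm
      · intro p _ hp
        rw [map_pow]
        exact pow_mem_ordGE (expand_coe_inv_linFun_mem hp.symm) (n + 1) _ (by simp)
  | zero => exact ⟨∅, fun S _ => by simp⟩
  | add x y _ _ hx hy =>
    obtain ⟨S, hS⟩ := hx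
    obtain ⟨T, hT⟩ := hy
    refine ⟨S ∪ T, fun U hU => ?_⟩
    simp only [map_add, Finset.sum_add_distrib]
    rw [hS U (Finset.union_subset_left hU), hT U (Finset.union_subset_right hU)]
  | smul a x _ hx =>
    obtain ⟨S, hS⟩ := hx
    refine ⟨S, fun U hU => ?_⟩
    simp only [map_smul]
    rw [← Finset.smul_sum, hS U hU]

/-- The residue theorem on the sphere for the differential `h dt`. -/
theorem sum_residue_eq (h : RatFunc ℂ) (S : Finset ℂ)
    (hS : ∀ p ∉ S, coeff (-1) (expand ((p : ℂ) : OnePoint ℂ) h) = 0) :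
    ∑ p ∈ S, coeff (-1) (expand (p : OnePoint ℂ) h) = coeff 1 (expand OnePoint.infty h) := by
  obtain ⟨S₀, h0⟩ := exists_sum_residue_eq h
  rw [← h0 (S ∪ S₀) Finset.subset_union_right]
  exact Finset.sum_subset Finset.subset_union_left fun p _ hp => hS p hp

/-- `f'` is the derivative of `f` with respect to `t`. -/
def IsDerivative (f f' : RatFunc ℂ) : Prop :=
  ∀ P : OnePoint ℂ, deriv (expand P f) = expand P f' * deriv (coordAt P)

namespace IsDerivative

variable {f g f' g' : RatFunc ℂ}

theorem add (hf : IsDerivative f f') (hg : IsDerivative g g') :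
    IsDerivative (f + g) (f' + g') := fun P => by
  rw [map_add, map_add, hf, hg, map_add, add_mul]

theorem smul (c : ℂ) (hf : IsDerivative f f') : IsDerivative (c • f) (c • f') := fun P => by
  rw [map_smul, map_smul, hf, map_smul, smul_mul_assoc]

theorem mul (hf : IsDerivative f f') (hg : IsDerivative g g') :
    IsDerivative (f * g) (f' * g + f * g') := fun P => by
  rw [map_mul, deriv_mul, hf, hg, map_add, map_mul, map_mul]
  ring

theorem const (c : ℂ) : IsDerivative (algebraMap ℂ _ c) 0 := fun P => by
  rw [AlgHom.commutes, deriv_algebraMap, map_zero, zero_mul]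

theorem X : IsDerivative RatFunc.X 1 := fun P => by rw [map_one, one_mul, expand, substHom_X]

theorem pow (hf : IsDerivative f f') (n : ℕ) : ∃ g', IsDerivative (f ^ n) g' := by
  induction n with
  | zero => exact ⟨_, by simpa using const 1⟩
  | succ n ih =>
    obtain ⟨g', hg⟩ := ih
    rw [pow_succ]
    exact ⟨_, hg.mul hf⟩

theorem inv (h0 : f ≠ 0) (hf : IsDerivative f f') : IsDerivative f⁻¹ (-(f' * (f⁻¹ * f⁻¹))) :=
  fun P => by
  rw [map_inv₀, deriv_inv _ (fun h => h0 ((map_eq_zero _).mp h)), hf, map_neg, map_mul,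
    map_mul, map_inv₀]
  ring

theorem linFun (p : ℂ) : ∃ g', IsDerivative (linFun p) g' := by
  have h := X.add (const (-p))
  rw [map_neg, ← sub_eq_add_neg] at h
  exact ⟨_, h⟩

end IsDerivative

/-- A single rational function has to serve at all points at once. The product and inverse rules
provide it for the powers of `t` and of `(t - q)⁻¹`, and these span. -/
theorem exists_isDerivative (f : RatFunc ℂ) : ∃ f', IsDerivative f f' := by
  have hh := mem_partialFractions f
  induction hh using Submodule.span_induction with
  | mem f hf =>
    rcases hf with ⟨n, rfl⟩ | ⟨⟨q, n⟩, rfl⟩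
    · exact IsDerivative.X.pow n
    · obtain ⟨g', hg⟩ := IsDerivative.linFun q
      exact (hg.inv (linFun_ne_zero q)).pow _
  | zero => exact ⟨0, fun P => by simp⟩
  | add x y _ _ hx hy =>
    obtain ⟨f', hf⟩ := hx
    obtain ⟨g', hg⟩ := hy
    exact ⟨_, hf.add hg⟩
  | smul a x _ hx =>
    obtain ⟨f', hf⟩ := hx
    exact ⟨_, hf.smul a⟩

/-! ### The residue theorem for twisted sections -/

section Residues

variable {N : ℕ}

theorem deriv_coordAt_coe (p : ℂ) : deriv (coordAt (p : OnePoint ℂ)) = 1 := by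
  change deriv (algebraMap ℂ Laur p + xi) = 1
  rw [map_add, deriv_algebraMap, zero_add, xi, deriv_monomial, ← map_one (algebraMap ℂ Laur),
    algebraMap_eq]
  simp

theorem deriv_coordAt_infty : deriv (coordAt OnePoint.infty) = monomial (-2) (-1) := by
  rw [coordAt_infty, deriv_monomial]
  simp

/-- The local forms `tr (A' B) dξ` all come from one global differential `h dt`, where `h` is the
trace of `dA/dt` times `B`. The sign and the shift of index at `∞` come from `dt = -ξ⁻² dξ`. -/
theorem exists_resForm_eq (A B : Matrix (Fin N) (Fin N) (RatFunc ℂ)) : ∃ h : RatFunc ℂ,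
    (∀ p : ℂ, resForm (A.map (expand p)) (B.map (expand p)) = coeff (-1) (expand p h)) ∧
      resForm (A.map (expand OnePoint.infty)) (B.map (expand OnePoint.infty)) =
        -coeff 1 (expand OnePoint.infty h) := by
  choose A' hA' using fun i j => exists_isDerivative (A i j)
  have key : ∀ P : OnePoint ℂ, resForm (A.map (expand P)) (B.map (expand P)) =
      coeff (-1) (deriv (coordAt P) * expand P (∑ i, ∑ j, A' i j * B j i)) := by
    intro P
    rw [resForm, Matrix.trace]
    congr 1
    simp only [map_sum, Finset.mul_sum, Matrix.diag_apply, Matrix.mul_apply, Matrix.map_apply]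
    refine Finset.sum_congr rfl fun i _ => Finset.sum_congr rfl fun j _ => ?_
    rw [hA' i j P, map_mul]
    ring
  refine ⟨_, fun p => by rw [key, deriv_coordAt_coe, one_mul], ?_⟩
  rw [key, deriv_coordAt_infty, coeff_monomial_mul, neg_one_mul]
  rfl

/-- This is the borderline case `a = b = 0`, which `resForm_eq_zero_of_vanishBelow` leaves out; it
uses that the derivative of a regular loop is regular. -/
theorem resForm_eq_zero_of_regular {A B : Matrix (Fin N) (Fin N) Laur} (hA : VanishBelow 0 A)
    (hB : VanishBelow 0 B) : resForm A B = 0 := by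
  have h : VanishBelow (0 + 0) (A.map Laur.deriv * B) :=
    VanishBelow.mul (fun i j => deriv_mem_ordGE_zero (hA i j)) hB
  rw [resForm, Matrix.trace, map_sum]
  exact Finset.sum_eq_zero fun i _ => h i i (-1) (by norm_num)

theorem sum_resForm_eq_zero (A B : Matrix (Fin N) (Fin N) (RatFunc ℂ)) (S : Finset ℂ)
    (hS : ∀ p : ℂ, p ∉ S → VanishBelow 0 (A.map (expand p)) ∧ VanishBelow 0 (B.map (expand p))) :
    ∑ p ∈ S, resForm (A.map (expand (p : OnePoint ℂ))) (B.map (expand (p : OnePoint ℂ))) +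
      resForm (A.map (expand OnePoint.infty)) (B.map (expand OnePoint.infty)) = 0 := by
  obtain ⟨h, h1, h2⟩ := exists_resForm_eq A B
  rw [h2, ← sum_residue_eq h S fun p hp => by
    rw [← h1, resForm_eq_zero_of_regular (hS p hp).1 (hS p hp).2]]
  simp only [h1, add_neg_cancel]

/-- At `t = p + ξ` one has `f(c t) = f(c p + c ξ)`. -/
theorem expand_coe_rotate (c : ℂˣ) (p : ℂ) :
    (expand (p : OnePoint ℂ)).comp (rotate c) =
      (rescale c).comp (expand ((c * p : ℂ) : OnePoint ℂ)) := by
  refine ratFunc_hom_ext ?_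
  rw [AlgHom.comp_apply, AlgHom.comp_apply, rotate, substHom_X, map_smul, expand_coe_X,
    expand_coe_X, map_add, AlgHom.commutes, xi, rescale_monomial, zpow_one, smul_add, map_mul,
    Algebra.smul_def]

/-- The factor `c` from the chain rule cancels the factor `c⁻¹` on the coefficient of `ξ⁻¹`. -/
theorem resForm_rescale (c : ℂˣ) (A B : Matrix (Fin N) (Fin N) Laur) :
    resForm (A.map (rescale c)) (B.map (rescale c)) = resForm A B := by
  have h1 : (A.map (rescale c)).map Laur.deriv = (c : ℂ) • (A.map Laur.deriv).map (rescale c) := by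
    ext1 i j
    exact coeff_rescale_deriv c (A i j)
  have h2 : (A.map Laur.deriv).map (rescale c) * B.map (rescale c) =
      (A.map Laur.deriv * B).map (rescale c) :=
    (map_mul (rescale c).mapMatrix _ _).symm
  rw [resForm, h1, Matrix.smul_mul, h2, Matrix.trace_smul, trace_map, map_smul, coeff_rescale,
    resForm]
  simp

theorem map_linear_Ad {R S : Type*} [CommRing R] [CommRing S] [Algebra ℂ R] [Algebra ℂ S]
    (φ : R →ₗ[ℂ] S) (g : Matrix (Fin N) (Fin N) ℂ) (A : Matrix (Fin N) (Fin N) R) :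
    (Ad g A).map φ = Ad g (A.map φ) := by
  have h : ∀ (a b : ℂ) (r : R),
      φ (algebraMap ℂ R a * r * algebraMap ℂ R b) = algebraMap ℂ S a * φ r * algebraMap ℂ S b := by
    intro a b r
    rw [← Algebra.smul_def, mul_comm, ← Algebra.smul_def, map_smul, map_smul, ← Algebra.smul_def,
      mul_comm, ← Algebra.smul_def]
  ext i j
  simp only [Ad, Matrix.map_apply, Matrix.mul_apply, Finset.sum_mul, map_sum, h]

theorem resForm_Ad {g : Matrix (Fin N) (Fin N) ℂ} (hg : IsUnit g.det)
    (A B : Matrix (Fin N) (Fin N) Laur) : resForm (Ad g A) (Ad g B) = resForm A B := by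
  rw [resForm, map_linear_Ad, ← Ad_mul hg, trace_Ad hg, resForm]

theorem map_expand_map_rotate (c : ℂˣ) (p : ℂ) (A : Matrix (Fin N) (Fin N) (RatFunc ℂ)) :
    (A.map (rotate c)).map (expand (p : OnePoint ℂ)) =
      (A.map (expand ((c * p : ℂ) : OnePoint ℂ))).map (rescale c) := by
  ext1 i j
  exact DFunLike.congr_fun (expand_coe_rotate c p) (A i j)

/-- By equivariance the germs at `ε p` and at `p` differ by a rescaling of `ξ` and by `Ad γ`, and
the residue form is invariant under both. -/
theorem resForm_germ_eps_mul (f g : secOrb N) (p : ℂ) :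
    resForm (germ ((eps N * p : ℂ) : OnePoint ℂ) f : Matrix (Fin N) (Fin N) Laur)
        (germ ((eps N * p : ℂ) : OnePoint ℂ) g : Matrix (Fin N) (Fin N) Laur) =
      resForm (germ (p : OnePoint ℂ) f : Matrix (Fin N) (Fin N) Laur)
        (germ (p : OnePoint ℂ) g : Matrix (Fin N) (Fin N) Laur) := by
  have h : ∀ f : secOrb N, (germ ((eps N * p : ℂ) : OnePoint ℂ) f :
      Matrix (Fin N) (Fin N) Laur).map (rescale (eps N)) =
        Ad (gamma N) (germ (p : OnePoint ℂ) f : Matrix (Fin N) (Fin N) Laur) := by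
    intro f
    change ((f : Matrix (Fin N) (Fin N) (RatFunc ℂ)).map _).map _ = Ad _ (Matrix.map _ _)
    rw [← map_expand_map_rotate, f.2.2, map_Ad]
  rw [← resForm_rescale (eps N), h, h, resForm_Ad (isUnit_gamma N)]

theorem resForm_germ_eps_pow_mul (f g : secOrb N) (p : ℂ) (a : ℕ) :
    resForm (germ (((eps N : ℂ) ^ a * p : ℂ) : OnePoint ℂ) f : Matrix (Fin N) (Fin N) Laur)
        (germ (((eps N : ℂ) ^ a * p : ℂ) : OnePoint ℂ) g : Matrix (Fin N) (Fin N) Laur) =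
      resForm (germ (p : OnePoint ℂ) f : Matrix (Fin N) (Fin N) Laur)
        (germ (p : OnePoint ℂ) g : Matrix (Fin N) (Fin N) Laur) := by
  induction a with
  | zero => rw [pow_zero, one_mul]
  | succ a ih => rw [pow_succ', mul_assoc, resForm_germ_eps_mul, ih]

theorem isPrimitiveRoot_eps (hN : N ≠ 0) : IsPrimitiveRoot (eps N : ℂ) N :=
  Complex.isPrimitiveRoot_exp N hN

variable {L : ℕ} {t : Fin L → ℂ}

theorem injOn_orbit (hN : N ≠ 0) (ht_ne : ∀ i, t i ≠ 0)
    (ht_distinct : ∀ i j, i ≠ j → ∀ a : ℕ, t i ≠ (eps N : ℂ) ^ a * t j) :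
    Set.InjOn (fun x : Fin L × ℕ => (eps N : ℂ) ^ x.2 * t x.1)
      ↑((Finset.univ : Finset (Fin L)) ×ˢ Finset.range N) := by
  rintro ⟨i, a⟩ ha ⟨j, b⟩ hb h
  simp only [Finset.coe_product, Set.mem_prod, Finset.mem_coe, Finset.mem_range] at ha hb h
  have hij : i = j := by
    by_contra hij
    -- The power `ε^(b-a)` is written with a natural exponent, using `ε^N = 1` and `a < N`.
    refine ht_distinct i j hij (N - a + b) ?_
    rw [pow_add, mul_assoc, ← h, ← mul_assoc, ← pow_add, Nat.sub_add_cancel ha.2.le,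
      (isPrimitiveRoot_eps hN).pow_eq_one, one_mul]
  subst hij
  rw [(isPrimitiveRoot_eps hN).pow_inj ha.2 hb.2 (mul_right_cancel₀ (ht_ne i) h)]

/-- The residue theorem for `(∇f | g)`, with `f` and `g` in `g_out^orb`. -/
theorem sum_resForm_goutOrb (hN : N ≠ 0) (ht_ne : ∀ i, t i ≠ 0)
    (ht_distinct : ∀ i j, i ≠ j → ∀ a : ℕ, t i ≠ (eps N : ℂ) ^ a * t j)
    {f g : secOrb N} (hf : f ∈ goutOrb N t) (hg : g ∈ goutOrb N t) :
    ∑ i, resForm (germ (t i : OnePoint ℂ) f : Matrix (Fin N) (Fin N) Laur)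
        (germ (t i : OnePoint ℂ) g : Matrix (Fin N) (Fin N) Laur) +
      1 / (N : ℂ) * (resForm (germZero f : Matrix (Fin N) (Fin N) Laur)
          (germZero g : Matrix (Fin N) (Fin N) Laur) +
        resForm (germInfty f : Matrix (Fin N) (Fin N) Laur)
          (germInfty g : Matrix (Fin N) (Fin N) Laur)) = 0 := by
  classical
  set S : Finset ℂ := ((Finset.univ : Finset (Fin L)) ×ˢ Finset.range N).image
    (fun x : Fin L × ℕ => (eps N : ℂ) ^ x.2 * t x.1) with hS
  have h0 : (0 : ℂ) ∉ S := by
    rw [hS, Finset.mem_image]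
    rintro ⟨x, -, hx⟩
    exact mul_ne_zero (pow_ne_zero _ (Units.ne_zero _)) (ht_ne _) hx
  have hreg : ∀ f ∈ goutOrb N t, ∀ p : ℂ, p ∉ insert 0 S → RegularAt (p : OnePoint ℂ) f := by
    intro f hf p hp
    rw [Finset.mem_insert, not_or] at hp
    refine hf _ (fun h => hp.1 (OnePoint.coe_injective h)) (OnePoint.coe_ne_infty p) ?_
    rintro ⟨i, a, h⟩
    refine hp.2 ?_
    rw [OnePoint.coe_injective h, hS, Finset.mem_image]
    refine ⟨(i, a % N), Finset.mem_product.mpr ⟨Finset.mem_univ _,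
      Finset.mem_range.mpr (Nat.mod_lt _ (Nat.pos_of_ne_zero hN))⟩, ?_⟩
    rw [← pow_mod_orderOf (eps N : ℂ) a, ← (isPrimitiveRoot_eps hN).eq_orderOf]
  -- The possible poles are `0`, `∞` and the full orbits, not only the chosen representatives `t_i`.
  have key := sum_resForm_eq_zero (f : Matrix (Fin N) (Fin N) (RatFunc ℂ))
    (g : Matrix (Fin N) (Fin N) (RatFunc ℂ)) (insert 0 S)
    fun p hp => ⟨hreg f hf p hp, hreg g hg p hp⟩
  rw [Finset.sum_insert h0, hS, Finset.sum_image (injOn_orbit hN ht_ne ht_distinct),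
    Finset.sum_product] at key
  -- Equal contributions along an orbit give a factor `N`; dividing by it produces the `1 / N` of
  -- the twisted cocycle.
  have hsum : ∀ i : Fin L, ∑ a ∈ Finset.range N,
      resForm ((f : Matrix (Fin N) (Fin N) (RatFunc ℂ)).map
          (expand (((eps N : ℂ) ^ a * t i : ℂ) : OnePoint ℂ)))
        ((g : Matrix (Fin N) (Fin N) (RatFunc ℂ)).map
          (expand (((eps N : ℂ) ^ a * t i : ℂ) : OnePoint ℂ))) =
      N * resForm (germ (t i : OnePoint ℂ) f : Matrix (Fin N) (Fin N) Laur)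
        (germ (t i : OnePoint ℂ) g : Matrix (Fin N) (Fin N) Laur) := by
    intro i
    refine (Finset.sum_congr rfl fun a _ => resForm_germ_eps_pow_mul f g (t i) a).trans ?_
    rw [Finset.sum_const, Finset.card_range, nsmul_eq_mul]
  simp only [hsum, ← Finset.mul_sum] at key
  have hN' : (N : ℂ) ≠ 0 := Nat.cast_ne_zero.mpr hN
  have hz : ∀ f : secOrb N, (f : Matrix (Fin N) (Fin N) (RatFunc ℂ)).map
      (expand ((0 : ℂ) : OnePoint ℂ)) = germZero f := fun _ => rfl
  have hi : ∀ f : secOrb N, (f : Matrix (Fin N) (Fin N) (RatFunc ℂ)).map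
      (expand OnePoint.infty) = germInfty f := fun _ => rfl
  rw [hz, hz, hi, hi] at key
  field_simp
  linear_combination key

end Residues

/-! ### Approximation of formal loops by global sections -/

namespace Laur

theorem coeff_zero_pow {f : Laur} (hf : f ∈ ordGE 0) (n : ℕ) :
    coeff 0 (f ^ n) = coeff 0 f ^ n := by
  induction n with
  | zero => rw [pow_zero, pow_zero, coeff_one, if_pos rfl]
  | succ n ih =>
    have h : f ^ n ∈ ordGE 0 := by simpa using pow_mem_ordGE hf n
    rw [pow_succ, pow_succ, ← ih, ← coeff_mul_of_mem_ordGE h hf, add_zero]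

theorem pow_mem_ordGE_zero {f : Laur} (hf : f ∈ ordGE 0) (n : ℕ) : f ^ n ∈ ordGE 0 := by
  simpa using pow_mem_ordGE hf n

theorem geom_sum_mem_ordGE {f : Laur} (hf : f ∈ ordGE 0) (n : ℕ) :
    ∑ i ∈ Finset.range n, f ^ i ∈ ordGE 0 :=
  Submodule.sum_mem _ fun i _ => pow_mem_ordGE_zero hf i

/-- The polynomial `(1 - x^m)^m` equals `1` to order `m` at `x = 0` and `0` to order `m` at `x = 1`.
This is the first half, and `one_sub_pow_pow_mem` is the second; together they turn a function with
values `0` and `1` into a cutoff of any precision. -/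
theorem one_sub_pow_pow_sub_one_mem {x : Laur} (hx : x ∈ ordGE 1) (m : ℕ) :
    (1 - x ^ m) ^ m - 1 ∈ ordGE m := by
  have h0 : x ^ m ∈ ordGE m := by simpa using pow_mem_ordGE hx m
  have h1 : 1 - x ^ m ∈ ordGE 0 :=
    Submodule.sub_mem _ one_mem_ordGE (ordGE_anti (by positivity) h0)
  have h2 : 1 - x ^ m - 1 ∈ ordGE m := by
    rw [sub_sub_cancel_left]
    exact Submodule.neg_mem _ h0
  rw [← geom_sum_mul]
  simpa using mul_mem_ordGE (geom_sum_mem_ordGE h1 m) h2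

theorem one_sub_pow_pow_mem {x : Laur} (hx : x ∈ ordGE 0) (hx1 : x - 1 ∈ ordGE 1) (m : ℕ) :
    (1 - x ^ m) ^ m ∈ ordGE m := by
  have h : 1 - x ^ m ∈ ordGE 1 := by
    rw [← neg_sub, ← geom_sum_mul]
    exact Submodule.neg_mem _ (by simpa using mul_mem_ordGE (geom_sum_mem_ordGE hx m) hx1)
  simpa using pow_mem_ordGE h m

theorem monomial_zpow (m : ℤ) (n : ℤ) : monomial m 1 ^ n = monomial (n * m) 1 := by
  have h1 : monomial 0 1 = 1 := by rw [← map_one (algebraMap ℂ Laur), algebraMap_eq]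
  have hn : ∀ n : ℕ, monomial m 1 ^ n = monomial (n * m) 1 := by
    intro n
    induction n with
    | zero => simp [h1]
    | succ n ih =>
      rw [pow_succ, ih, monomial_mul_monomial, mul_one]
      congr 1
      push_cast
      ring
  obtain ⟨k, rfl | rfl⟩ := n.eq_nat_or_neg
  · rw [zpow_natCast, hn]
  · rw [zpow_neg, zpow_natCast, hn]
    refine inv_eq_of_mul_eq_one_right ?_
    rw [monomial_mul_monomial, mul_one, ← h1]
    congr 1
    ring

theorem algebraMap_mul_monomial (m : ℤ) (c d : ℂ) :
    algebraMap ℂ Laur c * monomial m d = monomial m (c * d) := by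
  rw [algebraMap_eq, monomial_mul_monomial, zero_add]

end Laur

section Approximation

variable {N : ℕ}

theorem expand_zero_X : expand ((0 : ℂ) : OnePoint ℂ) RatFunc.X = monomial 1 1 := by
  rw [expand_coe_X, map_zero, zero_add, xi]

/-- The loop `C t ^ m` with coefficients in the rational functions. -/
def ratMonomial (m : ℤ) (C : Matrix (Fin N) (Fin N) ℂ) : Matrix (Fin N) (Fin N) (RatFunc ℂ) :=
  C.map fun c => algebraMap ℂ _ c * RatFunc.X ^ m

theorem ratMonomial_eq_smul (m : ℤ) (C : Matrix (Fin N) (Fin N) ℂ) :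
    ratMonomial m C = (RatFunc.X : RatFunc ℂ) ^ m • C.map (algebraMap ℂ (RatFunc ℂ)) := by
  ext1 i j
  exact mul_comm _ _

theorem Ad_smul' {R : Type*} [CommRing R] [Algebra ℂ R] (g : Matrix (Fin N) (Fin N) ℂ) (r : R)
    (A : Matrix (Fin N) (Fin N) R) : Ad g (r • A) = r • Ad g A := by
  simp [Ad]

/-- Under `t ↦ ε t` the monomial `C t^m` is multiplied by `ε^m`, so equivariance is an eigenvector
condition on `C`. -/
theorem ratMonomial_mem_secOrb {m : ℤ} {C : Matrix (Fin N) (Fin N) ℂ} (hC : C.trace = 0)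
    (hC' : ((eps N ^ m : ℂˣ) : ℂ) • C = Ad (gamma N) C) : ratMonomial m C ∈ secOrb N := by
  have h1 : (C.map (Algebra.ofId ℂ (RatFunc ℂ))).trace = 0 := by rw [trace_map, hC, map_zero]
  refine ⟨?_, ?_⟩
  · rw [ratMonomial_eq_smul, Matrix.trace_smul]
    exact (congrArg _ h1).trans (smul_zero _)
  · have h2 : Ad (gamma N) (C.map (algebraMap ℂ (RatFunc ℂ))) =
        ((eps N ^ m : ℂˣ) : ℂ) • C.map (algebraMap ℂ (RatFunc ℂ)) := by
      have := map_Ad (Algebra.ofId ℂ (RatFunc ℂ)) (gamma N) C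
      rw [← hC', map_smul_matrix] at this
      exact this.symm
    rw [ratMonomial_eq_smul, Ad_smul', h2, ← ratMonomial_eq_smul]
    ext1 i j
    simp only [ratMonomial, Matrix.map_apply, Matrix.smul_apply, map_mul, AlgHom.commutes,
      map_zpow₀, smul_eq_mul]
    rw [rotate, substHom_X, Algebra.smul_def, mul_zpow, Algebra.smul_def, ← map_zpow₀,
      Units.val_zpow_eq_zpow_val]
    ring

theorem map_expand_zero_ratMonomial (m : ℤ) (C : Matrix (Fin N) (Fin N) ℂ) :
    (ratMonomial m C).map (expand ((0 : ℂ) : OnePoint ℂ)) = C.map (monomial m) := by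
  ext1 i j
  simp only [ratMonomial, Matrix.map_apply, map_mul, AlgHom.commutes, map_zpow₀, expand_zero_X]
  rw [monomial_zpow, algebraMap_mul_monomial, mul_one, mul_one]

theorem map_expand_infty_ratMonomial (m : ℤ) (C : Matrix (Fin N) (Fin N) ℂ) :
    (ratMonomial m C).map (expand OnePoint.infty) = C.map (monomial (-m)) := by
  ext1 i j
  simp only [ratMonomial, Matrix.map_apply, map_mul, AlgHom.commutes, map_zpow₀, expand_infty_X]
  rw [monomial_zpow, algebraMap_mul_monomial, mul_one, mul_neg, mul_one]

theorem expand_coe_X_zpow_mem {p : ℂ} (hp : p ≠ 0) (m : ℤ) :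
    expand (p : OnePoint ℂ) (RatFunc.X ^ m) ∈ ordGE 0 := by
  have h0 := algebraMap_add_xi_mem_ordGE p
  have h1 : (algebraMap ℂ Laur p + xi)⁻¹ ∈ ordGE 0 := by
    simpa using inv_mem_ordGE h0 (by simpa [coeff_algebraMap, xi, coeff_monomial] using hp)
  rw [map_zpow₀, expand_coe_X]
  obtain ⟨k, rfl | rfl⟩ := m.eq_nat_or_neg
  · rw [zpow_natCast]
    exact pow_mem_ordGE_zero h0 k
  · rw [zpow_neg, zpow_natCast, ← inv_pow]
    exact pow_mem_ordGE_zero h1 k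

theorem regular_ratMonomial {p : ℂ} (hp : p ≠ 0) (m : ℤ) (C : Matrix (Fin N) (Fin N) ℂ) :
    VanishBelow 0 ((ratMonomial m C).map (expand (p : OnePoint ℂ))) := by
  intro i j
  change expand _ (algebraMap ℂ _ _ * RatFunc.X ^ m) ∈ ordGE 0
  rw [← Algebra.smul_def, map_smul]
  exact Submodule.smul_mem _ _ (expand_coe_X_zpow_mem hp m)

/-- The coefficients of a twisted loop are eigenvectors of `Ad γ`. -/
theorem coeff_twLoop {ζ : ℂˣ} (a : twLoop N ζ) (m : ℤ) :
    ((a : Matrix (Fin N) (Fin N) Laur).map (coeff m)).trace = 0 ∧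
      ((ζ ^ m : ℂˣ) : ℂ) • (a : Matrix (Fin N) (Fin N) Laur).map (coeff m) =
        Ad (gamma N) ((a : Matrix (Fin N) (Fin N) Laur).map (coeff m)) := by
  constructor
  · have h := congrArg (coeff m) a.2.1
    rw [map_zero, Matrix.trace, map_sum] at h
    exact h
  · rw [← map_linear_Ad, ← a.2.2]
    ext1 i j
    exact (coeff_rescale ζ _ m).symm

theorem vanishBelow_sum_monomial_sub {p n : ℤ} {A : Matrix (Fin N) (Fin N) Laur}
    (hA : VanishBelow p A) :
    VanishBelow n (∑ m ∈ Finset.Ico p n, (A.map (coeff m)).map (monomial m) - A) := by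
  intro i j q hq
  rw [Matrix.sub_apply, Matrix.sum_apply, map_sub, map_sum, sub_eq_zero]
  simp only [Matrix.map_apply, coeff_monomial]
  rw [Finset.sum_ite_eq]
  split_ifs with h
  · rfl
  · rw [Finset.mem_Ico, not_and_or] at h
    exact (hA i j q (by omega)).symm

/-- The sections of `g^orb` which are regular outside `0` and `∞`. -/
def laurentSec (N : ℕ) : Submodule ℂ (secOrb N) where
  carrier := {f | ∀ p : ℂ, p ≠ 0 → RegularAt (p : OnePoint ℂ) f}
  add_mem' hf hg p hp := (hf p hp).add (hg p hp)
  zero_mem' _ _ := RegularAt.zero _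
  smul_mem' c _ hf p hp := (hf p hp).smul c

theorem exists_laurentSec_zero (a : twLoop N (eps N)) (n : ℤ) : ∃ f ∈ laurentSec N,
    VanishBelow n ((germZero f : Matrix (Fin N) (Fin N) Laur) -
      (a : Matrix (Fin N) (Fin N) Laur)) := by
  obtain ⟨p, hp⟩ := exists_vanishBelow (a : Matrix (Fin N) (Fin N) Laur)
  let g : ℤ → secOrb N := fun m => ⟨ratMonomial m ((a : Matrix (Fin N) (Fin N) Laur).map (coeff m)),
    ratMonomial_mem_secOrb (coeff_twLoop a m).1 (coeff_twLoop a m).2⟩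
  refine ⟨∑ m ∈ Finset.Ico p n, g m,
    Submodule.sum_mem _ fun m _ q hq => regular_ratMonomial hq _ _, ?_⟩
  have h : (germZero (∑ m ∈ Finset.Ico p n, g m) : Matrix (Fin N) (Fin N) Laur) =
      ∑ m ∈ Finset.Ico p n,
        ((a : Matrix (Fin N) (Fin N) Laur).map (coeff m)).map (monomial m) := by
    rw [map_sum, AddSubmonoidClass.coe_finsetSum]
    exact Finset.sum_congr rfl fun m _ => map_expand_zero_ratMonomial m _
  rw [h]
  exact vanishBelow_sum_monomial_sub hp

theorem exists_laurentSec_infty (a : twLoop N (eps N)⁻¹) (n : ℤ) : ∃ f ∈ laurentSec N,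
    VanishBelow n ((germInfty f : Matrix (Fin N) (Fin N) Laur) -
      (a : Matrix (Fin N) (Fin N) Laur)) := by
  obtain ⟨p, hp⟩ := exists_vanishBelow (a : Matrix (Fin N) (Fin N) Laur)
  let g : ℤ → secOrb N := fun m =>
    -- At `∞` the monomial `ξ^m` is `t^(-m)`, and the eigenvalue `(ε⁻¹)^m` is `ε^(-m)`.
    ⟨ratMonomial (-m) ((a : Matrix (Fin N) (Fin N) Laur).map (coeff m)),
      ratMonomial_mem_secOrb (coeff_twLoop a m).1 (by
        rw [zpow_neg, ← inv_zpow]; exact (coeff_twLoop a m).2)⟩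
  refine ⟨∑ m ∈ Finset.Ico p n, g m,
    Submodule.sum_mem _ fun m _ q hq => regular_ratMonomial hq _ _, ?_⟩
  have h : (germInfty (∑ m ∈ Finset.Ico p n, g m) : Matrix (Fin N) (Fin N) Laur) =
      ∑ m ∈ Finset.Ico p n,
        ((a : Matrix (Fin N) (Fin N) Laur).map (coeff m)).map (monomial m) := by
    rw [map_sum, AddSubmonoidClass.coe_finsetSum]
    refine Finset.sum_congr rfl fun m _ => (map_expand_infty_ratMonomial (-m) _).trans ?_
    rw [neg_neg]
  rw [h]
  exact vanishBelow_sum_monomial_sub hp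

/-- Multiplication of a section by a function of `t ^ N`. -/
def invSmul (e : RatFunc ℂ) (he : rotate (eps N) e = e) (f : secOrb N) : secOrb N :=
  ⟨e • (f : Matrix (Fin N) (Fin N) (RatFunc ℂ)), by
    refine ⟨by rw [Matrix.trace_smul, f.2.1, smul_zero], ?_⟩
    rw [Ad_smul', ← f.2.2]
    ext1 i j
    simp only [Matrix.map_apply, Matrix.smul_apply, smul_eq_mul, map_mul, he]⟩

/-! ### Cutoff functions and simultaneous approximation at `0` and `∞` -/

variable {L : ℕ} {t : Fin L → ℂ}

theorem zero_notMem_orbitSet (ht_ne : ∀ i, t i ≠ 0) :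
    ((0 : ℂ) : OnePoint ℂ) ∉ orbitSet N t := by
  rintro ⟨j, a, h⟩
  exact mul_ne_zero (pow_ne_zero _ (Units.ne_zero _)) (ht_ne j) (OnePoint.coe_injective h).symm

/-- The function `x = t^N / (t^N - t_i^N)` is invariant, has poles only on the orbit of `t_i`, and
takes the values `0` at `0` and `1` at `∞`. Then `(1 - x^m)^m` is the cutoff. A marked point is
needed to carry the poles. -/
theorem exists_cutoff (hN : N ≠ 0) (i : Fin L) (ht_ne : ∀ i, t i ≠ 0) (m : ℕ) : ∃ e : RatFunc ℂ,
    rotate (eps N) e = e ∧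
    (∀ p : ℂ, (p : OnePoint ℂ) ∉ orbitSet N t → expand (p : OnePoint ℂ) e ∈ ordGE 0) ∧
    expand ((0 : ℂ) : OnePoint ℂ) e - 1 ∈ ordGE m ∧ expand OnePoint.infty e ∈ ordGE m := by
  set v : RatFunc ℂ := RatFunc.X ^ N - algebraMap ℂ _ (t i ^ N) with hv
  set x : RatFunc ℂ := RatFunc.X ^ N * v⁻¹ with hx
  have hN1 : (1 : ℤ) ≤ N := by exact_mod_cast Nat.one_le_iff_ne_zero.mpr hN
  have hrot : rotate (eps N) x = x := by
    have h : rotate (eps N) (RatFunc.X ^ N) = RatFunc.X ^ N := by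
      rw [map_pow, rotate, substHom_X, smul_pow, (isPrimitiveRoot_eps hN).pow_eq_one, one_smul]
    rw [hx, hv, map_mul, map_inv₀, map_sub, h, AlgHom.commutes]
  have hvinv : ∀ p : ℂ, (p : OnePoint ℂ) ∉ orbitSet N t →
      expand (p : OnePoint ℂ) v⁻¹ ∈ ordGE 0 := by
    intro p hp
    have h1 := algebraMap_add_xi_mem_ordGE p
    rw [map_inv₀]
    refine (neg_zero (G := ℤ)) ▸ inv_mem_ordGE (a := 0) ?_ ?_
    · rw [hv, map_sub, map_pow, AlgHom.commutes, expand_coe_X]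
      exact Submodule.sub_mem _ (pow_mem_ordGE_zero h1 N) (algebraMap_mem_ordGE _)
    · rw [hv, map_sub, map_pow, AlgHom.commutes, expand_coe_X, map_sub, coeff_zero_pow h1,
        coeff_algebraMap, if_pos rfl, map_add, coeff_algebraMap, if_pos rfl, xi, coeff_monomial,
        if_neg (by norm_num), add_zero, sub_ne_zero]
      intro h
      -- A zero `p` of `t^N - t_i^N` differs from `t_i` by an `N`-th root of unity, hence lies on
      -- the excluded orbit.
      have h2 : (p / t i) ^ N = 1 := by rw [div_pow, h, div_self (pow_ne_zero _ (ht_ne i))]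
      have : NeZero N := ⟨hN⟩
      obtain ⟨a, -, ha⟩ := (isPrimitiveRoot_eps hN).eq_pow_of_pow_eq_one h2
      exact hp ⟨i, a, by rw [ha, div_mul_cancel₀ _ (ht_ne i)]⟩
  refine ⟨(1 - x ^ m) ^ m, ?_, fun p hp => ?_, ?_, ?_⟩
  · simp only [map_pow, map_sub, map_one, hrot]
  · have h : expand (p : OnePoint ℂ) x ∈ ordGE 0 := by
      rw [hx, map_mul, map_pow, expand_coe_X]
      simpa using mul_mem_ordGE (pow_mem_ordGE_zero (algebraMap_add_xi_mem_ordGE p) N) (hvinv p hp)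
    simp only [map_pow, map_sub, map_one]
    exact pow_mem_ordGE_zero (Submodule.sub_mem _ one_mem_ordGE (pow_mem_ordGE_zero h m)) m
  · simp only [map_pow, map_sub, map_one]
    refine one_sub_pow_pow_sub_one_mem ?_ m
    have h := mul_mem_ordGE (pow_mem_ordGE (monomial_mem_ordGE 1 1) N)
      (hvinv 0 (zero_notMem_orbitSet ht_ne))
    rw [hx, map_mul, map_pow, expand_zero_X]
    exact ordGE_anti (by simpa using hN1) h
  · simp only [map_pow, map_sub, map_one]
    have hX : expand OnePoint.infty (RatFunc.X ^ N) = monomial (-(N : ℤ)) 1 := by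
      rw [map_pow, expand_infty_X, monomial_neg_one_pow]
    have h0 : monomial (-(N : ℤ)) 1 - algebraMap ℂ Laur (t i ^ N) ∈ ordGE (-(N : ℤ)) :=
      Submodule.sub_mem _ (monomial_mem_ordGE _ _)
        (ordGE_anti (by omega) (algebraMap_mem_ordGE _))
    have h1 : coeff (-(N : ℤ)) (monomial (-(N : ℤ)) 1 - algebraMap ℂ Laur (t i ^ N)) ≠ 0 := by
      rw [map_sub, coeff_monomial, if_pos rfl, coeff_algebraMap, if_neg (by omega), sub_zero]
      exact one_ne_zero
    have h2 := inv_mem_ordGE h0 h1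
    have hne : monomial (-(N : ℤ)) 1 - algebraMap ℂ Laur (t i ^ N) ≠ 0 := by
      intro h
      rw [h, map_zero] at h1
      exact h1 rfl
    refine one_sub_pow_pow_mem ?_ ?_ m
    · rw [hx, map_mul, hX, map_inv₀, hv, map_sub, hX, AlgHom.commutes]
      simpa using mul_mem_ordGE (monomial_mem_ordGE (-(N : ℤ)) 1) h2
    · rw [hx, map_mul, hX, map_inv₀, hv, map_sub, hX, AlgHom.commutes]
      -- This is `x - 1 = t_i^N / (t^N - t_i^N)`, which vanishes to order `N ≥ 1` at `∞`.
      have h3 : monomial (-(N : ℤ)) 1 * (monomial (-(N : ℤ)) 1 - algebraMap ℂ Laur (t i ^ N))⁻¹ -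
          1 = (t i ^ N) • (monomial (-(N : ℤ)) 1 - algebraMap ℂ Laur (t i ^ N))⁻¹ := by
        rw [Algebra.smul_def]
        field_simp
        ring
      rw [h3]
      exact Submodule.smul_mem _ _ (ordGE_anti (by omega) h2)

/-- The germs at `0` and `∞` of the sections in `g_out^orb` are dense. -/
theorem exists_goutOrb_approx (hN : N ≠ 0) (hL : 1 ≤ L) (ht_ne : ∀ i, t i ≠ 0)
    (a : twLoop N (eps N)) (b : twLoop N (eps N)⁻¹) (n : ℤ) : ∃ f ∈ goutOrb N t,
      VanishBelow n ((germZero f - a : twLoop N (eps N)) : Matrix (Fin N) (Fin N) Laur) ∧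
      VanishBelow n ((germInfty f - b : twLoop N (eps N)⁻¹) : Matrix (Fin N) (Fin N) Laur) := by
  obtain ⟨f, hf, hfa⟩ := exists_laurentSec_zero a n
  obtain ⟨g, hg, hgb⟩ := exists_laurentSec_infty b n
  obtain ⟨q₀, h0⟩ := exists_vanishBelow (germZero (f - g) : Matrix (Fin N) (Fin N) Laur)
  obtain ⟨q₁, h1⟩ := exists_vanishBelow (germInfty (f - g) : Matrix (Fin N) (Fin N) Laur)
  -- The cutoff must be precise enough to absorb the possible poles of `f - g` at `0` and `∞`, of
  -- orders bounded through `q₀` and `q₁`.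
  obtain ⟨e, he, hreg, he0, he1⟩ := exists_cutoff hN ⟨0, hL⟩ ht_ne
    (max (n - q₀) (n - q₁)).toNat
  have hm0 := (le_max_left (n - q₀) (n - q₁)).trans (Int.self_le_toNat _)
  have hm1 := (le_max_right (n - q₀) (n - q₁)).trans (Int.self_le_toNat _)
  -- Near `0`, where `e ≈ 1`, this is close to `f`; near `∞`, where `e ≈ 0`, it is close to `g`.
  refine ⟨g + invSmul e he (f - g), fun P hP0 hPi hPt => ?_, ?_, ?_⟩
  · cases P with
    | infty => exact absurd rfl hPi
    | coe p =>
      have hp : p ≠ 0 := fun h => hP0 (by rw [h])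
      refine (hg p hp).add fun i j => ?_
      have h := mul_mem_ordGE (hreg p hPt) ((laurentSec N).sub_mem hf hg p hp i j)
      rw [zero_add] at h
      change expand (p : OnePoint ℂ) (e * _) ∈ ordGE 0
      rw [map_mul]
      exact h
  · intro i j
    have h := mul_mem_ordGE he0 (h0 i j)
    have h2 := Submodule.add_mem _ (ordGE_anti (by omega) h) (hfa i j)
    refine mem_ordGE.mp ?_
    convert h2 using 1
    change expand _ (_ + e * (_ - _)) - _ = (expand _ e - 1) * expand _ (_ - _) + (expand _ _ - _)
    simp only [map_add, map_mul, map_sub]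
    ring
  · intro i j
    have h := mul_mem_ordGE he1 (h1 i j)
    have h2 := Submodule.add_mem _ (ordGE_anti (by omega) h) (hgb i j)
    refine mem_ordGE.mp ?_
    convert h2 using 1
    change expand _ (_ + e * (_ - _)) - _ = expand _ e * expand _ (_ - _) + (expand _ _ - _)
    simp only [map_add, map_mul, map_sub]
    ring

end Approximation

/-! ### The action on the tensor product of the modules at the marked points -/

section TensorAction

/-- An endomorphism of the `i`-th factor of a tensor product. -/
def onFactor {L : ℕ} (M : Fin L → Type u) [∀ i, AddCommGroup (M i)] [∀ i, Module ℂ (M i)]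
    (i : Fin L) : Module.End ℂ (M i) →ₗ[ℂ] Module.End ℂ (Tens M) where
  toFun u := PiTensorProduct.map (Function.update (fun j => (LinearMap.id : M j →ₗ[ℂ] M j)) i u)
  map_add' u v := PiTensorProduct.map_update_add _ i u v
  map_smul' c u := PiTensorProduct.map_update_smul _ i c u

variable {L : ℕ} {M : Fin L → Type u} [∀ i, AddCommGroup (M i)] [∀ i, Module ℂ (M i)]

theorem onFactor_apply (i : Fin L) (u : Module.End ℂ (M i)) : onFactor M i u =
    PiTensorProduct.map (Function.update (fun j => (LinearMap.id : M j →ₗ[ℂ] M j)) i u) := rfl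

theorem onFactor_one (i : Fin L) : onFactor M i 1 = 1 := by
  have h : Function.update (fun j => (LinearMap.id : M j →ₗ[ℂ] M j)) i (1 : Module.End ℂ (M i)) =
      fun j => (LinearMap.id : M j →ₗ[ℂ] M j) := Function.update_eq_self i _
  rw [onFactor_apply, h, PiTensorProduct.map_id]
  rfl

theorem onFactor_mul (i : Fin L) (u v : Module.End ℂ (M i)) :
    onFactor M i (u * v) = onFactor M i u * onFactor M i v := by
  rw [onFactor_apply, onFactor_apply, onFactor_apply, Module.End.mul_eq_comp,
    Module.End.mul_eq_comp, ← PiTensorProduct.map_comp]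
  congr 1
  funext j
  rcases eq_or_ne j i with rfl | h
  · simp only [Function.update_self]
  · simp only [Function.update_of_ne h, LinearMap.id_comp]

theorem onFactor_commute {i j : Fin L} (hij : i ≠ j) (u : Module.End ℂ (M i))
    (v : Module.End ℂ (M j)) :
    onFactor M i u * onFactor M j v = onFactor M j v * onFactor M i u := by
  rw [onFactor_apply, onFactor_apply, Module.End.mul_eq_comp,
    Module.End.mul_eq_comp, ← PiTensorProduct.map_comp, ← PiTensorProduct.map_comp]
  congr 1
  funext l
  rcases eq_or_ne l i with rfl | h
  · simp only [Function.update_of_ne hij, LinearMap.comp_id, LinearMap.id_comp]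
  · simp only [Function.update_of_ne h, LinearMap.comp_id, LinearMap.id_comp]

variable {N : ℕ} [∀ i, LieRingModule (AffLoc N) (M i)] [∀ i, LieModule ℂ (AffLoc N) (M i)]

theorem actD_eq (A : Fin L → slN N Laur) :
    actD N M A = ∑ i, onFactor M i (LieModule.toEnd ℂ (AffLoc N) (M i) (Aff.of (A i))) := rfl

theorem toEnd_of_commutator {k : ℂ} {V : Type*} [AddCommGroup V] [Module ℂ V]
    [LieRingModule (AffLoc N) V] [LieModule ℂ (AffLoc N) V] (hlevel : HasLevel N k V)
    (A B : slN N Laur) :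
    LieModule.toEnd ℂ (AffLoc N) V (Aff.of A) * LieModule.toEnd ℂ (AffLoc N) V (Aff.of B) -
        LieModule.toEnd ℂ (AffLoc N) V (Aff.of B) * LieModule.toEnd ℂ (AffLoc N) V (Aff.of A) =
      LieModule.toEnd ℂ (AffLoc N) V (Aff.of ⁅A, B⁆) +
        (k * resForm (A : Matrix (Fin N) (Fin N) Laur) (B : Matrix (Fin N) (Fin N) Laur)) • 1 := by
  have h : LieModule.toEnd ℂ (AffLoc N) V Aff.khat = k • 1 := LinearMap.ext hlevel
  rw [← Ring.lie_def, ← LieHom.map_lie, Aff.lie_of_of, map_add, map_smul, h, smul_smul, one_mul,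
    mul_comm k]

/-- Operators on different factors commute, so only the diagonal terms of the double sum survive,
and the central terms of the factors add up. -/
theorem actD_commutator {k : ℂ} (hlevel : ∀ i, HasLevel N k (M i)) (A B : Fin L → slN N Laur) :
    actD N M A * actD N M B - actD N M B * actD N M A = actD N M (fun i => ⁅A i, B i⁆) +
      (k * ∑ i, resForm (A i : Matrix (Fin N) (Fin N) Laur)
        (B i : Matrix (Fin N) (Fin N) Laur)) • 1 := by
  simp only [actD_eq, Finset.sum_mul_sum]
  rw [Finset.sum_comm (γ := Fin L) (f := fun i j =>
    onFactor M i (LieModule.toEnd ℂ (AffLoc N) (M i) (Aff.of (B i))) *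
      onFactor M j (LieModule.toEnd ℂ (AffLoc N) (M j) (Aff.of (A j)))),
    ← Finset.sum_sub_distrib, Finset.mul_sum, Finset.sum_smul, ← Finset.sum_add_distrib]
  refine Finset.sum_congr rfl fun i _ => ?_
  rw [← Finset.sum_sub_distrib, Finset.sum_eq_single i]
  · rw [← onFactor_mul, ← onFactor_mul, ← map_sub, toEnd_of_commutator (hlevel i), map_add,
      map_smul, onFactor_one]
  · intro j _ hj
    rw [onFactor_commute hj.symm, sub_self]
  · exact fun h => absurd (Finset.mem_univ i) h

/-- The action of the sections on `M₁ ⊗ ⋯ ⊗ M_L` as a linear map. -/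
def actTrigLin (t : Fin L → ℂ) (M : Fin L → Type u) [∀ i, AddCommGroup (M i)]
    [∀ i, Module ℂ (M i)] [∀ i, LieRingModule (AffLoc N) (M i)]
    [∀ i, LieModule ℂ (AffLoc N) (M i)] : secOrb N →ₗ[ℂ] Module.End ℂ (Tens M) :=
  ∑ i, onFactor M i ∘ₗ (LieModule.toEnd ℂ (AffLoc N) (M i) : AffLoc N →ₗ[ℂ] _) ∘ₗ Aff.of ∘ₗ
    (germ ((t i : ℂ) : OnePoint ℂ) : secOrb N →ₗ⁅ℂ⁆ slN N Laur).toLinearMap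

theorem actTrigLin_apply (t : Fin L → ℂ) (f : secOrb N) :
    actTrigLin t M f = actTrig N t M f := by
  rw [actTrigLin, LinearMap.sum_apply]
  rfl

end TensorAction

/-! ### Extension of a representation to a completion -/

section Completion

variable {G A D : Type*} [LieRing G] [LieAlgebra ℂ G] [LieRing A] [LieAlgebra ℂ A]
  [AddCommGroup D] [Module ℂ D]

/-- The vectors killed by all `g ∈ G` whose image lies deep enough in the filtration `F`. -/
def smoothVectors (Y : G →ₗ[ℂ] Module.End ℂ D) (j : G →ₗ⁅ℂ⁆ A) {F : ℤ → Submodule ℂ A}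
    (hF : Antitone F) : Submodule ℂ D where
  carrier := {φ | ∃ n, ∀ g, j g ∈ F n → Y g φ = 0}
  add_mem' := by
    rintro φ ψ ⟨n, hn⟩ ⟨m, hm⟩
    refine ⟨max n m, fun g hg => ?_⟩
    rw [map_add, hn g (hF (le_max_left n m) hg), hm g (hF (le_max_right n m) hg), add_zero]
  zero_mem' := ⟨0, fun g _ => map_zero _⟩
  smul_mem' := by
    rintro c φ ⟨n, hn⟩
    exact ⟨n, fun g hg => by rw [map_smul, hn g hg, smul_zero]⟩

variable {Y : G →ₗ[ℂ] Module.End ℂ D} {j : G →ₗ⁅ℂ⁆ A} {F : ℤ → Submodule ℂ A}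
  {hF : Antitone F} {c : A → A → ℂ}

/-- For `f` deep in the filtration, `[f, g]` is still deep and the cocycle vanishes, so `Y f (Y g φ)
= Y g (Y f φ) + Y [f, g] φ = 0`. -/
theorem map_mem_smoothVectors
    (hsmall : ∀ a n, ∃ m, ∀ b ∈ F m, ⁅b, a⁆ ∈ F n ∧ c b a = 0 ∧ c a b = 0)
    (hcomm : ∀ f g, Y f * Y g - Y g * Y f = Y ⁅f, g⁆ + c (j f) (j g) • 1)
    (g : G) {φ : D} (hφ : φ ∈ smoothVectors Y j hF) : Y g φ ∈ smoothVectors Y j hF := by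
  obtain ⟨n, hn⟩ := hφ
  obtain ⟨m, hm⟩ := hsmall (j g) n
  refine ⟨max n m, fun f hf => ?_⟩
  obtain ⟨h1, h2, -⟩ := hm (j f) (hF (le_max_right n m) hf)
  have h := LinearMap.congr_fun (hcomm f g) φ
  rw [h2, zero_smul, add_zero] at h
  change Y f (Y g φ) - Y g (Y f φ) = Y ⁅f, g⁆ φ at h
  rw [hn f (hF (le_max_left n m) hf), hn ⁅f, g⁆ (by rwa [LieHom.map_lie]), map_zero,
    sub_zero] at h
  exact h

/-- Both approximations of `a` are compared with a third one that is fine enough for both depths.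
This makes the extended action independent of choices. -/
theorem eq_of_approx (hF : Antitone F) (hdense : ∀ a n, ∃ g, j g - a ∈ F n) {φ : D}
    {a : A} {n m : ℤ} {f g : G}
    (hn : ∀ h, j h ∈ F n → Y h φ = 0) (hf : j f - a ∈ F n)
    (hm : ∀ h, j h ∈ F m → Y h φ = 0) (hg : j g - a ∈ F m) : Y f φ = Y g φ := by
  obtain ⟨h, hh⟩ := hdense a (max n m)
  have key : ∀ {n' : ℤ} {f' : G}, n' ≤ max n m → (∀ h, j h ∈ F n' → Y h φ = 0) →
      j f' - a ∈ F n' → Y f' φ = Y h φ := by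
    intro n' f' hle hn' hf'
    have h0 := hn' (f' - h) (by
      rw [map_sub, ← sub_sub_sub_cancel_right (j f') (j h) a]
      exact Submodule.sub_mem _ hf' (hF hle hh))
    rwa [map_sub, LinearMap.sub_apply, sub_eq_zero] at h0
  rw [key (le_max_left n m) hn hf, key (le_max_right n m) hm hg]

/-- An element `a` acts on `φ` as any `g` approximating `a` beyond a depth at which `φ` is
annihilated. The stated property characterizes `T`, and linearity follows by choosing convenient
approximations. -/
theorem exists_completion (hdense : ∀ a n, ∃ g, j g - a ∈ F n)
    (hstab : ∀ g, ∀ φ ∈ smoothVectors Y j hF, Y g φ ∈ smoothVectors Y j hF) :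
    ∃ T : A →ₗ[ℂ] Module.End ℂ (smoothVectors Y j hF),
      ∀ (a : A) (φ : smoothVectors Y j hF) (n : ℤ) (g : G),
        (∀ h, j h ∈ F n → Y h (φ : D) = 0) → j g - a ∈ F n → (T a φ : D) = Y g φ := by
  choose g hg using hdense
  choose n hn using fun φ : smoothVectors Y j hF => φ.2
  let T : A → smoothVectors Y j hF → smoothVectors Y j hF := fun a φ =>
    ⟨Y (g a (n φ)) φ, hstab _ _ φ.2⟩
  have hT : ∀ (a : A) (φ : smoothVectors Y j hF) (n : ℤ) (g : G),
      (∀ h, j h ∈ F n → Y h (φ : D) = 0) → j g - a ∈ F n → (T a φ : D) = Y g φ :=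
    fun a φ m f hm hf => eq_of_approx hF (fun a n => ⟨g a n, hg a n⟩) (hn φ)
      (hg a (n φ)) hm hf
  refine ⟨LinearMap.mk₂ ℂ T (fun a b φ => Subtype.ext ?_) (fun r a φ => Subtype.ext ?_)
    (fun a φ ψ => Subtype.ext ?_) (fun r a φ => Subtype.ext ?_), hT⟩
  · rw [hT (a + b) φ (n φ) (g a (n φ) + g b (n φ)) (hn φ) (by
      rw [map_add, add_sub_add_comm]
      exact Submodule.add_mem _ (hg _ _) (hg _ _)), map_add]
    rfl
  · rw [hT (r • a) φ (n φ) (r • g a (n φ)) (hn φ) (by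
      rw [map_smul, ← smul_sub]
      exact Submodule.smul_mem _ _ (hg _ _)), map_smul]
    rfl
  · set m := max (n φ) (n ψ)
    have h1 : ∀ h, j h ∈ F m → Y h (φ : D) = 0 := fun h hh =>
      hn φ h (hF (le_max_left _ _) hh)
    have h2 : ∀ h, j h ∈ F m → Y h (ψ : D) = 0 := fun h hh =>
      hn ψ h (hF (le_max_right _ _) hh)
    rw [hT a (φ + ψ) m (g a m) (fun h hh => by
      rw [Submodule.coe_add, map_add, h1 h hh, h2 h hh, add_zero]) (hg _ _), Submodule.coe_add,
      Submodule.coe_add, hT a φ m (g a m) h1 (hg _ _), hT a ψ m (g a m) h2 (hg _ _), map_add]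
  · rw [hT a (r • φ) (n φ) (g a (n φ)) (fun h hh => by
      rw [Submodule.coe_smul, map_smul, hn φ h hh, smul_zero]) (hg _ _), Submodule.coe_smul,
      map_smul]
    rfl

/-- With fine enough `f ≈ a` and `g' ≈ b`, each term of the identity applied to `φ` is the
corresponding term for `f` and `g'`, so the relation is inherited from `Y`. -/
theorem completion_commutator (hdense : ∀ a n, ∃ g, j g - a ∈ F n)
    (hsmall : ∀ a n, ∃ m, ∀ b ∈ F m, ⁅b, a⁆ ∈ F n ∧ c b a = 0 ∧ c a b = 0)
    (hadd_left : ∀ a b d, c (a + b) d = c a d + c b d)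
    (hadd_right : ∀ a b d, c a (b + d) = c a b + c a d)
    (hcomm : ∀ f g, Y f * Y g - Y g * Y f = Y ⁅f, g⁆ + c (j f) (j g) • 1)
    {T : A →ₗ[ℂ] Module.End ℂ (smoothVectors Y j hF)}
    (hT : ∀ (a : A) (φ : smoothVectors Y j hF) (n : ℤ) (g : G),
        (∀ h, j h ∈ F n → Y h (φ : D) = 0) → j g - a ∈ F n → (T a φ : D) = Y g φ) (a b : A) :
    T a * T b - T b * T a = T ⁅a, b⁆ + c a b • 1 := by
  have hstab := fun g φ hφ => map_mem_smoothVectors (hF := hF) (φ := φ) hsmall hcomm g hφ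
  refine LinearMap.ext fun φ => Subtype.ext ?_
  obtain ⟨n, hn⟩ := φ.2
  obtain ⟨g, hg⟩ := hdense b n
  obtain ⟨n₁, hn₁⟩ := (T b φ).2
  obtain ⟨m₁, hm₁⟩ := hsmall b n
  -- The precision of `f` suffices for its action on `φ` and on `T b φ`, and for `[f - a, b]` and
  -- its cocycle to be negligible.
  obtain ⟨f, hf⟩ := hdense a (max (max n n₁) m₁)
  have hfn := hF ((le_max_left n n₁).trans (le_max_left _ m₁)) hf
  have hfn₁ := hF ((le_max_right n n₁).trans (le_max_left _ m₁)) hf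
  obtain ⟨h1, h2, -⟩ := hm₁ _ (hF (le_max_right (max n n₁) m₁) hf)
  obtain ⟨n₂, hn₂⟩ := (T a φ).2
  obtain ⟨m₂, hm₂⟩ := hsmall (j f) n
  -- The approximation of `b` is chosen after `f`, because `[g' - b, f]` and the cocycle of `f` with
  -- `g' - b` must be negligible too.
  obtain ⟨g', hg'⟩ := hdense b (max (max n n₂) m₂)
  have hgn := hF ((le_max_left n n₂).trans (le_max_left _ m₂)) hg'
  have hgn₂ := hF ((le_max_right n n₂).trans (le_max_left _ m₂)) hg'
  obtain ⟨h3, -, h4⟩ := hm₂ _ (hF (le_max_right (max n n₂) m₂) hg')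
  have e1 : (T a (T b φ) : D) = Y f (Y g' φ) := by
    rw [hT a (T b φ) n₁ f hn₁ hfn₁, hT b φ n g' hn hgn]
  have e2 : (T b (T a φ) : D) = Y g' (Y f φ) := by
    rw [hT b (T a φ) n₂ g' hn₂ hgn₂, hT a φ n f hn hfn]
  have e3 : (T ⁅a, b⁆ φ : D) = Y ⁅f, g'⁆ φ := by
    refine hT _ φ n _ hn ?_
    have : j ⁅f, g'⁆ - ⁅a, b⁆ = ⁅j f - a, b⁆ - ⁅j g' - b, j f⁆ := by
      rw [LieHom.map_lie, sub_lie, sub_lie, ← lie_skew (j f) (j g'), ← lie_skew (j f) b]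
      abel
    rw [this]
    exact Submodule.sub_mem _ h1 h3
  have e4 : c (j f) (j g') = c a b := by
    have e5 := hadd_left (j f - a) a b
    have e6 := hadd_right (j f) (j g' - b) b
    rw [sub_add_cancel, h2, zero_add] at e5
    rw [sub_add_cancel, h4, zero_add, e5] at e6
    exact e6
  have h := LinearMap.congr_fun (hcomm f g') (φ : D)
  change Y f (Y g' φ) - Y g' (Y f φ) = Y ⁅f, g'⁆ φ + c (j f) (j g') • (φ : D) at h
  change (T a (T b φ) : D) - (T b (T a φ) : D) = (T ⁅a, b⁆ φ : D) + c a b • (φ : D)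
  rw [e1, e2, e3, h, e4]

end Completion

/-! ### Universal Verma modules -/

section Verma

/-- The universal property maps the enveloping algebra to `S`; followed by the inclusion, this map
is the identity on generators, hence everywhere. -/
theorem mem_subalgebra_of_ι_mem {K : Type*} [LieRing K] [LieAlgebra ℂ K]
    (S : Subalgebra ℂ (UniversalEnvelopingAlgebra ℂ K))
    (hS : ∀ x, UniversalEnvelopingAlgebra.ι ℂ x ∈ S) (u : UniversalEnvelopingAlgebra ℂ K) :
    u ∈ S := by
  let j : K →ₗ⁅ℂ⁆ S :=
    { toFun := fun x => ⟨UniversalEnvelopingAlgebra.ι ℂ x, hS x⟩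
      map_add' := fun x y => Subtype.ext (map_add _ x y)
      map_smul' := fun c x => Subtype.ext (map_smul _ c x)
      map_lie' := fun {x y} => Subtype.ext (LieHom.map_lie _ x y) }
  have h : S.val.comp (UniversalEnvelopingAlgebra.lift ℂ j) = AlgHom.id ℂ _ := by
    refine UniversalEnvelopingAlgebra.hom_ext ℂ (LieHom.ext fun x => ?_)
    change ((UniversalEnvelopingAlgebra.lift ℂ j (UniversalEnvelopingAlgebra.ι ℂ x) : S) :
      UniversalEnvelopingAlgebra ℂ K) = UniversalEnvelopingAlgebra.ι ℂ x
    rw [UniversalEnvelopingAlgebra.lift_ι_apply]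
    rfl
  rw [← AlgHom.id_apply (R := ℂ) u, ← h]
  exact Subtype.property _

namespace UVerma

variable {N : ℕ} {ζ : ℂˣ} {k : ℂ}

theorem mem_of_lie_mem (S : Submodule ℂ (UVerma N ζ k)) (h0 : vac N ζ k ∈ S)
    (h : ∀ (x : AffTw N ζ), ∀ v ∈ S, ⁅x, v⁆ ∈ S) (v : UVerma N ζ k) : v ∈ S := by
  let S' : Subalgebra ℂ (UniversalEnvelopingAlgebra ℂ (AffTw N ζ)) :=
    { carrier := {u | ∀ v ∈ S, u • v ∈ S}
      mul_mem' := fun {a b} ha hb v hv => by rw [mul_smul]; exact ha _ (hb v hv)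
      add_mem' := fun {a b} ha hb v hv => by
        rw [add_smul]; exact Submodule.add_mem _ (ha v hv) (hb v hv)
      algebraMap_mem' := fun c v hv => by
        rw [algebraMap_smul]; exact Submodule.smul_mem _ c hv }
  obtain ⟨u, rfl⟩ : ∃ u, mk N ζ k u = v := Submodule.mkQ_surjective _ v
  have hu := mem_subalgebra_of_ι_mem S' (fun x v hv => h x v hv) u _ h0
  rwa [vac, ← map_smul, smul_eq_mul, mul_one] at hu

theorem lie_vac (x : AffTw N ζ) :
    ⁅x, vac N ζ k⁆ = mk N ζ k (UniversalEnvelopingAlgebra.ι ℂ x) := by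
  rw [lie_def, vac, ← map_smul, smul_eq_mul, mul_one]

theorem mk_eq_zero {x : UniversalEnvelopingAlgebra ℂ (AffTw N ζ)} (hx : x ∈ vermaIdeal N ζ k) :
    mk N ζ k x = 0 := (Submodule.Quotient.mk_eq_zero _).mpr hx

theorem lie_of_vac {A : twLoop N ζ} (hA : A ∈ nPlus N ζ) :
    ⁅(Aff.of A : AffTw N ζ), vac N ζ k⁆ = 0 := by
  rw [lie_vac]
  exact mk_eq_zero (Submodule.subset_span (Or.inl ⟨A, hA, rfl⟩))

/-- The relation holds on the cyclic vector by construction and propagates because `k̂` is central.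
-/
theorem lie_khat_eq_smul (v : UVerma N ζ k) : ⁅(Aff.khat : AffTw N ζ), v⁆ = k • v := by
  refine mem_of_lie_mem
    (LinearMap.eqLocus (LieModule.toEnd ℂ (AffTw N ζ) (UVerma N ζ k) Aff.khat)
      (k • LinearMap.id)) ?_ (fun x v hv => ?_) v
  · change ⁅(Aff.khat : AffTw N ζ), vac N ζ k⁆ = k • vac N ζ k
    have h : mk N ζ k (UniversalEnvelopingAlgebra.ι ℂ (Aff.khat : AffTw N ζ) -
        algebraMap ℂ _ k) = 0 := mk_eq_zero (Submodule.subset_span (Or.inr rfl))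
    rw [lie_vac, ← sub_eq_zero, ← h, map_sub, vac, ← algebraMap_smul
      (UniversalEnvelopingAlgebra ℂ (AffTw N ζ)) k, ← map_smul, smul_eq_mul, mul_one]
  · change ⁅(Aff.khat : AffTw N ζ), v⁆ = k • v at hv
    change ⁅(Aff.khat : AffTw N ζ), ⁅x, v⁆⁆ = k • ⁅x, v⁆
    rw [leibniz_lie, ← lie_skew, Aff.lie_khat, neg_zero, zero_lie, zero_add, hv, lie_smul]

theorem eq_of_add_smul_khat (x : AffTw N ζ) : x = Aff.of x.1 + x.2 • Aff.khat := by
  refine Aff.ext ?_ ?_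
  · change x.1 = x.1 + x.2 • (0 : twLoop N ζ)
    rw [smul_zero, add_zero]
  · change x.2 = 0 + x.2 * 1
    rw [mul_one, zero_add]

theorem lie_eq_of_add_smul (x : AffTw N ζ) (v : UVerma N ζ k) :
    ⁅x, v⁆ = ⁅(Aff.of x.1 : AffTw N ζ), v⁆ + (x.2 * k) • v := by
  conv_lhs => rw [eq_of_add_smul_khat x]
  rw [add_lie, smul_lie, lie_khat_eq_smul, smul_smul]

/-- A subspace of `M(0)` which contains the cyclic vector and is stable under the loops is
everything. -/
theorem mem_of_lie_of_mem (S : Submodule ℂ (UVerma N ζ k)) (h0 : vac N ζ k ∈ S)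
    (h : ∀ (A : twLoop N ζ), ∀ v ∈ S, ⁅(Aff.of A : AffTw N ζ), v⁆ ∈ S) (v : UVerma N ζ k) :
    v ∈ S := by
  refine mem_of_lie_mem S h0 (fun x v hv => ?_) v
  rw [lie_eq_of_add_smul]
  exact Submodule.add_mem _ (h _ v hv) (Submodule.smul_mem _ _ hv)

/-- The cyclic vector is killed from order `1` on. If `v` is killed by deep loops, so is `B v`: for
`A` deep, `[A, B]` is deep and the cocycle vanishes. -/
theorem exists_lie_of_eq_zero (v : UVerma N ζ k) : ∃ n : ℤ, ∀ A : twLoop N ζ,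
    VanishBelow n (A : Matrix (Fin N) (Fin N) Laur) → ⁅(Aff.of A : AffTw N ζ), v⁆ = 0 := by
  let S : Submodule ℂ (UVerma N ζ k) :=
    { carrier := {v | ∃ n : ℤ, ∀ A : twLoop N ζ,
        VanishBelow n (A : Matrix (Fin N) (Fin N) Laur) → ⁅(Aff.of A : AffTw N ζ), v⁆ = 0}
      add_mem' := by
        rintro v w ⟨n, hn⟩ ⟨m, hm⟩
        refine ⟨max n m, fun A hA => ?_⟩
        rw [lie_add, hn A (hA.anti (le_max_left _ _)), hm A (hA.anti (le_max_right _ _)), add_zero]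
      zero_mem' := ⟨0, fun A _ => lie_zero _⟩
      smul_mem' := by
        rintro c v ⟨n, hn⟩
        exact ⟨n, fun A hA => by rw [lie_smul, hn A hA, smul_zero]⟩ }
  refine mem_of_lie_of_mem S ⟨1, fun A hA => lie_of_vac hA⟩ ?_ v
  rintro B v ⟨n, hn⟩
  obtain ⟨b, hb⟩ := exists_vanishBelow (B : Matrix (Fin N) (Fin N) Laur)
  refine ⟨max n (max (n - b) (1 - b)), fun A hA => ?_⟩
  have h1 : VanishBelow n (A : Matrix (Fin N) (Fin N) Laur) := hA.anti (le_max_left _ _)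
  have h2 : VanishBelow n ((⁅A, B⁆ : twLoop N ζ) : Matrix (Fin N) (Fin N) Laur) := by
    have := (hA.anti (b := max n (max (n - b) (1 - b))) (a := n - b) (by omega)).lie hb
    rwa [sub_add_cancel] at this
  have h3 := resForm_eq_zero_of_vanishBelow (by omega) (hA.anti (a := 1 - b) (by omega)) hb
  rw [leibniz_lie, hn A h1, lie_zero, add_zero, Aff.lie_of_of, h3, mul_zero, zero_smul, add_zero,
    hn _ h2]

theorem right_vac (H : cartan N) :
    right H (vac N ζ k) = ⁅(Aff.of (constLoop ζ H) : AffTw N ζ), vac N ζ k⁆ := by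
  rw [lie_vac]
  refine (rightAct_mk H 1).trans ?_
  rw [one_mul]

variable {E : Type*} [AddCommGroup E] [Module ℂ E]

/-- The representation of the affine algebra of level `k` defined by a projective representation
of the loop algebra. -/
def affRep (k : ℂ) (T : twLoop N ζ →ₗ[ℂ] Module.End ℂ E)
    (hT : ∀ A B, T A * T B - T B * T A = T ⁅A, B⁆ +
      (k * (1 / (N : ℂ) * resForm (A : Matrix (Fin N) (Fin N) Laur)
        (B : Matrix (Fin N) (Fin N) Laur))) • 1) : AffTw N ζ →ₗ⁅ℂ⁆ Module.End ℂ E where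
  toFun x := T x.1 + (k * x.2) • 1
  map_add' x y := by
    rw [Aff.add_fst, Aff.add_snd, map_add, mul_add, add_smul]
    abel
  map_smul' c x := by
    change T (c • x.1) + (k * (c * x.2)) • 1 = c • (T x.1 + (k * x.2) • 1)
    rw [map_smul, smul_add, smul_smul, mul_left_comm]
  map_lie' {x y} := by
    change T ⁅x.1, y.1⁆ + (k * (1 / (N : ℂ) * resForm _ _)) • 1 = _
    rw [← hT, Ring.lie_def]
    simp only [add_mul, mul_add, smul_mul_assoc, mul_smul_comm, one_mul, mul_one]
    module

theorem affRep_of (k : ℂ) (T : twLoop N ζ →ₗ[ℂ] Module.End ℂ E) (hT) (A : twLoop N ζ) :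
    affRep k T hT (Aff.of A) = T A := by
  change T A + (k * 0) • 1 = T A
  rw [mul_zero, zero_smul, add_zero]

theorem affRep_khat (k : ℂ) (T : twLoop N ζ →ₗ[ℂ] Module.End ℂ E) (hT) :
    affRep k T hT Aff.khat = k • 1 := by
  change T 0 + (k * 1) • 1 = _
  rw [map_zero, zero_add, mul_one]

/-- The universal property of `M(0)`. -/
theorem exists_lift (T : twLoop N ζ →ₗ[ℂ] Module.End ℂ E)
    (hT : ∀ A B, T A * T B - T B * T A = T ⁅A, B⁆ +
      (k * (1 / (N : ℂ) * resForm (A : Matrix (Fin N) (Fin N) Laur)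
        (B : Matrix (Fin N) (Fin N) Laur))) • 1)
    (δ : E) (hδ : ∀ A ∈ nPlus N ζ, T A δ = 0) :
    ∃ Ψ : UVerma N ζ k →ₗ[ℂ] E, Ψ (vac N ζ k) = δ ∧
      ∀ A v, Ψ ⁅(Aff.of A : AffTw N ζ), v⁆ = T A (Ψ v) := by
  let Φ := UniversalEnvelopingAlgebra.lift ℂ (affRep k T hT)
  have hΦ : ∀ x, Φ (UniversalEnvelopingAlgebra.ι ℂ x) = affRep k T hT x :=
    fun x => UniversalEnvelopingAlgebra.lift_ι_apply ℂ _ x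
  let f : UniversalEnvelopingAlgebra ℂ (AffTw N ζ) →ₗ[ℂ] E :=
    (LinearMap.applyₗ δ) ∘ₗ Φ.toLinearMap
  have hf : (vermaIdeal N ζ k).restrictScalars ℂ ≤ LinearMap.ker f := by
    intro x hx
    rw [Submodule.restrictScalars_mem] at hx
    change Φ x δ = 0
    induction hx using Submodule.span_induction with
    | mem x hx =>
      rcases hx with ⟨A, hA, rfl⟩ | hx
      · rw [hΦ, affRep_of, hδ A hA]
      · rw [Set.mem_singleton_iff.mp hx, map_sub, hΦ, affRep_khat, AlgHom.commutes,
          Algebra.algebraMap_eq_smul_one, sub_self, LinearMap.zero_apply]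
    | zero => rw [map_zero, LinearMap.zero_apply]
    | add x y _ _ hx hy => rw [map_add, LinearMap.add_apply, hx, hy, add_zero]
    | smul a x _ hx =>
      rw [smul_eq_mul, map_mul, Module.End.mul_apply, hx, map_zero]
  let Ψ : UVerma N ζ k →ₗ[ℂ] E :=
    (((vermaIdeal N ζ k).restrictScalars ℂ).liftQ f hf) ∘ₗ
      (Submodule.Quotient.restrictScalarsEquiv ℂ (vermaIdeal N ζ k)).symm.toLinearMap
  have hΨ : ∀ x, Ψ (mk N ζ k x) = Φ x δ := fun _ => rfl
  refine ⟨Ψ, ?_, fun A v => ?_⟩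
  · rw [vac, hΨ, map_one, Module.End.one_apply]
  · obtain ⟨x, rfl⟩ : ∃ x, mk N ζ k x = v := Submodule.mkQ_surjective _ v
    rw [lie_def, ← map_smul, hΨ, hΨ, smul_eq_mul, map_mul, hΦ, affRep_of, Module.End.mul_apply]

end UVerma

end Verma

/-! ### The pairing of the two universal Verma modules -/

section Pairing

variable {N : ℕ} {k : ℂ}

/-- The left ideal of `M(0)` imposes only the positive loops and the level, so any vector killed by
positive loops is the image of a cyclic vector. Using this at `∞` and then at `0` gives `B`. The
hypothesis on the pairs `(H, Ad β H)` enters only in the last relation, which holds at the cyclic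
vectors and spreads because right and left actions commute. -/
theorem exists_verma_pairing {E : Type*} [AddCommGroup E] [Module ℂ E]
    (T : twLoop N (eps N) × twLoop N (eps N)⁻¹ →ₗ[ℂ] Module.End ℂ E)
    (hT : ∀ a b, T a * T b - T b * T a = T ⁅a, b⁆ +
      (k * (1 / (N : ℂ) * (resForm (a.1 : Matrix (Fin N) (Fin N) Laur)
          (b.1 : Matrix (Fin N) (Fin N) Laur) +
        resForm (a.2 : Matrix (Fin N) (Fin N) Laur)
          (b.2 : Matrix (Fin N) (Fin N) Laur)))) • 1)
    (π : E) (hπ : ∀ a, a.1 ∈ nPlus N (eps N) → a.2 ∈ nPlus N (eps N)⁻¹ → T a π = 0)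
    (hπH : ∀ H : cartan N, T (constLoop (eps N) H, constLoop (eps N)⁻¹ (AdBeta H)) π = 0) :
    ∃ B : UVerma N (eps N) k →ₗ[ℂ] UVerma N (eps N)⁻¹ k →ₗ[ℂ] E,
      B (UVerma.vac _ _ _) (UVerma.vac _ _ _) = π ∧
      (∀ A x y, B ⁅(Aff.of A : AffTw N (eps N)), x⁆ y = T (A, 0) (B x y)) ∧
      (∀ A x y, B x ⁅(Aff.of A : AffTw N (eps N)⁻¹), y⁆ = T (0, A) (B x y)) ∧
      ∀ H x y, B (UVerma.right H x) y + B x (UVerma.right (AdBeta H) y) = 0 := by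
  have hT2 := fun A B : twLoop N (eps N)⁻¹ => hT (0, A) (0, B)
  have hT1 := fun A B : twLoop N (eps N) => hT (A, 0) (B, 0)
  have hT12 := fun (A : twLoop N (eps N)) (B : twLoop N (eps N)⁻¹) => hT (A, 0) (0, B)
  have hres0 : ∀ A : Matrix (Fin N) (Fin N) Laur, resForm A 0 = 0 := fun A => by simp [resForm]
  have hres0' : ∀ A : Matrix (Fin N) (Fin N) Laur, resForm 0 A = 0 := fun A => by
    have h := resForm_add_left 0 0 A
    rw [add_zero] at h
    exact left_eq_add.mp h
  simp only [LieAlgebra.Prod.bracket_apply, lie_zero, zero_lie, ZeroMemClass.coe_zero, hres0,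
    hres0', add_zero, zero_add, mul_zero, zero_smul] at hT1 hT2 hT12
  -- Loops at `0` and loops at `∞` have zero bracket and zero cocycle, so their actions commute.
  simp only [Prod.mk_zero_zero, map_zero, sub_eq_zero] at hT12
  obtain ⟨Ψ, hΨ0, hΨ⟩ := UVerma.exists_lift (k := k) (T ∘ₗ LinearMap.inr ℂ _ _) hT2 π
    (fun A hA => hπ (0, A) (Submodule.zero_mem _) hA)
  -- Loops at `0` act on linear maps from `M(0)_∞` to `E` by composition on the target; the lift `Ψ`
  -- plays the role of the vector killed by positive loops.
  let T1 : twLoop N (eps N) →ₗ[ℂ] Module.End ℂ (UVerma N (eps N)⁻¹ k →ₗ[ℂ] E) :=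
    LinearMap.mk₂ ℂ (fun A ψ => T (A, 0) ∘ₗ ψ)
      (fun A B ψ => by
        rw [← LinearMap.add_comp, ← map_add, Prod.mk_add_mk, add_zero])
      (fun c A ψ => by
        rw [← LinearMap.smul_comp, ← map_smul, Prod.smul_mk, smul_zero])
      (fun A ψ φ => LinearMap.comp_add _ _ _)
      (fun c A ψ => LinearMap.comp_smul _ _ _)
  have hcommΨ : ∀ A ∈ nPlus N (eps N), T1 A Ψ = 0 := by
    intro A hA
    refine LinearMap.ext fun y => ?_
    refine UVerma.mem_of_lie_of_mem (LinearMap.ker (T1 A Ψ)) ?_ (fun C y hy => ?_) y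
    · change T (A, 0) (Ψ _) = 0
      rw [hΨ0]
      exact hπ (A, 0) hA (Submodule.zero_mem _)
    · change T (A, 0) (Ψ y) = 0 at hy
      change T (A, 0) (Ψ _) = 0
      rw [hΨ]
      change (T (A, 0) * T (0, C)) (Ψ y) = 0
      rw [hT12, Module.End.mul_apply, hy, map_zero]
  obtain ⟨B, hB0, hB⟩ := UVerma.exists_lift (k := k) T1 (fun A C => by
    refine LinearMap.ext fun ψ => LinearMap.ext fun y => ?_
    exact LinearMap.congr_fun (hT1 A C) (ψ y)) Ψ hcommΨ
  have hB1 : ∀ A x y, B ⁅(Aff.of A : AffTw N (eps N)), x⁆ y = T (A, 0) (B x y) :=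
    fun A x y => by rw [hB]; rfl
  have hB2 : ∀ A x y, B x ⁅(Aff.of A : AffTw N (eps N)⁻¹), y⁆ = T (0, A) (B x y) := by
    intro A x y
    refine UVerma.mem_of_lie_of_mem (LinearMap.eqLocus
      (B.flip ⁅(Aff.of A : AffTw N (eps N)⁻¹), y⁆) (T (0, A) ∘ₗ B.flip y)) ?_ (fun C x hx => ?_) x
    · change B _ ⁅_, y⁆ = T (0, A) (B _ y)
      rw [hB0, hΨ]
      rfl
    · change B x ⁅_, y⁆ = T (0, A) (B x y) at hx
      change B ⁅_, x⁆ ⁅_, y⁆ = T (0, A) (B ⁅_, x⁆ y)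
      rw [hB1, hB1, hx]
      exact LinearMap.congr_fun (hT12 C A) (B x y)
  refine ⟨B, by rw [hB0, hΨ0], hB1, hB2, fun H x y => ?_⟩
  refine UVerma.mem_of_lie_of_mem (LinearMap.ker
    (B.flip y ∘ₗ UVerma.right H + B.flip (UVerma.right (AdBeta H) y))) ?_ (fun C x hx => ?_) x
  · refine UVerma.mem_of_lie_of_mem (LinearMap.ker
      (B (UVerma.right H (UVerma.vac _ _ _)) +
        B (UVerma.vac _ _ _) ∘ₗ UVerma.right (AdBeta H))) ?_ (fun C y hy => ?_) y
    · change B _ _ + B _ (UVerma.right (AdBeta H) (UVerma.vac _ _ _)) = 0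
      rw [UVerma.right_vac, UVerma.right_vac, hB1, hB2, hB0, hΨ0, ← LinearMap.add_apply,
        ← map_add, Prod.mk_add_mk, add_zero, zero_add, hπH]
    · change B _ y + B _ (UVerma.right (AdBeta H) y) = 0 at hy
      change B _ ⁅_, y⁆ + B _ (UVerma.right (AdBeta H) ⁅_, y⁆) = 0
      rw [UVerma.right_lie, hB2, hB2, ← map_add, hy, map_zero]
  · change B (UVerma.right H x) y + B x _ = 0 at hx
    change B (UVerma.right H ⁅_, x⁆) y + B ⁅_, x⁆ _ = 0
    rw [UVerma.right_lie, hB1, hB1, ← map_add, hx, map_zero]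

theorem rho_tmul {L : ℕ} {M : Fin L → Type u} [∀ i, AddCommGroup (M i)]
    [∀ i, Module ℂ (M i)] (H : cartan N) (x : VermaZero N k) (v : Tens M) (y : VermaInfty N k) :
    rho N k M H (x ⊗ₜ (v ⊗ₜ y)) =
      UVerma.right H x ⊗ₜ (v ⊗ₜ y) + x ⊗ₜ (v ⊗ₜ UVerma.right (AdBeta H) y) := rfl

end Pairing

/-! ### The sections of `g^trig` -/

section Trig

variable {N L : ℕ} {t : Fin L → ℂ}

theorem constMat_coeff (C : Matrix (Fin N) (Fin N) ℂ) (i j : Fin N) (m : ℤ) :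
    coeff m (constMat C i j) = if m = 0 then C i j else 0 := coeff_algebraMap m (C i j)

theorem vanishBelow_one_sub_constMat {A : Matrix (Fin N) (Fin N) Laur}
    {C : Matrix (Fin N) (Fin N) ℂ} :
    VanishBelow 1 (A - constMat C) ↔ VanishBelow 0 A ∧ A.map (coeff 0) = C := by
  constructor
  · intro h
    constructor
    · intro i j m hm
      have := h i j m (by omega)
      rwa [Matrix.sub_apply, map_sub, constMat_coeff, if_neg hm.ne, sub_zero] at this
    · ext i j
      have := h i j 0 (by omega)
      rwa [Matrix.sub_apply, map_sub, constMat_coeff, if_pos rfl, sub_eq_zero] at this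
  · rintro ⟨h, rfl⟩ i j m hm
    rw [Matrix.sub_apply, map_sub, constMat_coeff]
    split_ifs with h0
    · subst h0
      exact sub_self _
    · rw [h i j m (by omega), sub_zero]

theorem goutTrig_le_goutOrb : goutTrig N t ≤ goutOrb N t := fun _ hf P _ _ hP => hf.1 P hP

/-- Leading terms `H` and `Ad β (H)` encode at once the regularity at `0` and `∞` and the gluing
condition. -/
theorem mem_goutTrig {f : secOrb N} (hf : f ∈ goutOrb N t) (H : cartan N)
    (h0 : germZero f - constLoop (eps N) H ∈ nPlus N (eps N))
    (h1 : germInfty f - constLoop (eps N)⁻¹ (AdBeta H) ∈ nPlus N (eps N)⁻¹) :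
    f ∈ goutTrig N t := by
  obtain ⟨r0, v0⟩ := vanishBelow_one_sub_constMat.mp h0
  obtain ⟨r1, v1⟩ := vanishBelow_one_sub_constMat.mp h1
  refine ⟨fun P hP => ?_, r0, r1, ?_⟩
  · by_cases hP0 : P = ((0 : ℂ) : OnePoint ℂ)
    · rw [hP0]
      exact r0
    · by_cases hP1 : P = OnePoint.infty
      · rw [hP1]
        exact r1
      · exact hf P hP0 hP1 hP
  · exact v1.trans (congrArg (Ad (beta N)) v0.symm)

/-- The diagonal entries of `γ` are pairwise distinct, as `ε⁻¹` is a primitive `N`-th root of unity,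
so only diagonal matrices commute with `γ`. -/
theorem isDiag_of_Ad_gamma_eq (hN : N ≠ 0) {C : Matrix (Fin N) (Fin N) ℂ}
    (hC : C = Ad (gamma N) C) : C.IsDiag := by
  have hmap : ∀ g : Matrix (Fin N) (Fin N) ℂ, g.map (algebraMap ℂ ℂ) = g := fun g => by
    ext i j
    simp
  have h : C * gamma N = gamma N * C := by
    conv_lhs => rw [hC]
    rw [Ad, hmap, hmap, mul_assoc, Matrix.nonsing_inv_mul _ (isUnit_gamma N), mul_one]
  intro i j hij
  have h1 := congrFun (congrFun h i) j
  rw [gamma, Matrix.mul_diagonal, Matrix.diagonal_mul] at h1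
  by_contra h0
  have h2 : ((((eps N)⁻¹ : ℂˣ) : ℂ)) ^ (j : ℕ) = ((((eps N)⁻¹ : ℂˣ) : ℂ)) ^ (i : ℕ) :=
    mul_left_cancel₀ h0 (h1.trans (mul_comm _ _))
  have h3 : IsPrimitiveRoot (((eps N)⁻¹ : ℂˣ) : ℂ) N := by
    rw [Units.val_inv_eq_inv_val]
    exact (isPrimitiveRoot_eps hN).inv
  exact hij (Fin.ext (h3.pow_inj j.2 i.2 h2).symm)

/-- Equivariance at the fixed point `0` says that the value there commutes with `γ`, and is
therefore a Cartan element. -/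
theorem exists_cartan_of_mem_goutTrig (hN : N ≠ 0) {f : secOrb N} (hf : f ∈ goutTrig N t) :
    ∃ H : cartan N, germZero f - constLoop (eps N) H ∈ nPlus N (eps N) ∧
      germInfty f - constLoop (eps N)⁻¹ (AdBeta H) ∈ nPlus N (eps N)⁻¹ := by
  obtain ⟨h1, h2⟩ := coeff_twLoop (germZero f) 0
  rw [zpow_zero, Units.val_one, one_smul] at h2
  refine ⟨⟨_, isDiag_of_Ad_gamma_eq hN h2, h1⟩, ?_, ?_⟩
  · exact vanishBelow_one_sub_constMat.mpr ⟨hf.2.1, rfl⟩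
  · exact vanishBelow_one_sub_constMat.mpr ⟨hf.2.2.1, hf.2.2.2⟩

end Trig

/-! ### The map from the orbifold coinvariants to the trigonometric coinvariants -/

section Main

variable {N L : ℕ} {t : Fin L → ℂ} {k : ℂ}

/-- The filtration of the pairs of twisted loops by their orders at `0` and `∞`. -/
def loopFiltration (N : ℕ) (n : ℤ) : Submodule ℂ (twLoop N (eps N) × twLoop N (eps N)⁻¹) where
  carrier := {a | VanishBelow n (a.1 : Matrix (Fin N) (Fin N) Laur) ∧
    VanishBelow n (a.2 : Matrix (Fin N) (Fin N) Laur)}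
  add_mem' ha hb := ⟨ha.1.add hb.1, ha.2.add hb.2⟩
  zero_mem' := ⟨VanishBelow.zero, VanishBelow.zero⟩
  smul_mem' c _ ha := ⟨ha.1.smul c, ha.2.smul c⟩

theorem loopFiltration_antitone : Antitone (loopFiltration N) :=
  fun _ _ h _ ha => ⟨ha.1.anti h, ha.2.anti h⟩

/-- The 2-cocycle of the pairs of twisted loops at level `k`. -/
def loopCocycle (N : ℕ) (k : ℂ) (a b : twLoop N (eps N) × twLoop N (eps N)⁻¹) : ℂ :=
  k * (1 / (N : ℂ) * (resForm (a.1 : Matrix (Fin N) (Fin N) Laur)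
      (b.1 : Matrix (Fin N) (Fin N) Laur) +
    resForm (a.2 : Matrix (Fin N) (Fin N) Laur) (b.2 : Matrix (Fin N) (Fin N) Laur)))

theorem loopCocycle_add_left (a b d : twLoop N (eps N) × twLoop N (eps N)⁻¹) :
    loopCocycle N k (a + b) d = loopCocycle N k a d + loopCocycle N k b d := by
  simp only [loopCocycle, Prod.fst_add, Prod.snd_add, AddMemClass.coe_add, resForm_add_left]
  ring

theorem loopCocycle_add_right (a b d : twLoop N (eps N) × twLoop N (eps N)⁻¹) :
    loopCocycle N k a (b + d) = loopCocycle N k a b + loopCocycle N k a d := by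
  simp only [loopCocycle, Prod.fst_add, Prod.snd_add, AddMemClass.coe_add, resForm_add_right]
  ring

theorem exists_lie_mem_loopFiltration (a : twLoop N (eps N) × twLoop N (eps N)⁻¹) (n : ℤ) :
    ∃ m, ∀ b ∈ loopFiltration N m, ⁅b, a⁆ ∈ loopFiltration N n ∧ loopCocycle N k b a = 0 ∧
      loopCocycle N k a b = 0 := by
  obtain ⟨p, hp⟩ := exists_vanishBelow (a.1 : Matrix (Fin N) (Fin N) Laur)
  obtain ⟨q, hq⟩ := exists_vanishBelow (a.2 : Matrix (Fin N) (Fin N) Laur)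
  refine ⟨max (max (n - p) (n - q)) (max (1 - p) (1 - q)), fun b hb => ⟨⟨?_, ?_⟩, ?_, ?_⟩⟩
  · exact (hb.1.lie hp).anti (by omega)
  · exact (hb.2.lie hq).anti (by omega)
  · rw [loopCocycle, resForm_eq_zero_of_vanishBelow (by omega) hb.1 hp,
      resForm_eq_zero_of_vanishBelow (by omega) hb.2 hq, add_zero, mul_zero, mul_zero]
  · rw [loopCocycle, resForm_eq_zero_of_vanishBelow (by omega) hp hb.1,
      resForm_eq_zero_of_vanishBelow (by omega) hq hb.2, add_zero, mul_zero, mul_zero]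

/-- The germs at `0` and `∞` of a section in `g_out^orb`. -/
def germPair (N : ℕ) {L : ℕ} (t : Fin L → ℂ) :
    goutOrb N t →ₗ⁅ℂ⁆ twLoop N (eps N) × twLoop N (eps N)⁻¹ where
  toFun f := (germZero (f : secOrb N), germInfty (f : secOrb N))
  map_add' f g := Prod.ext (map_add germZero (f : secOrb N) g) (map_add germInfty (f : secOrb N) g)
  map_smul' c f := Prod.ext (map_smul germZero c (f : secOrb N))
    (map_smul germInfty c (f : secOrb N))
  map_lie' {f g} := Prod.ext (LieHom.map_lie germZero (f : secOrb N) g)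
    (LieHom.map_lie germInfty (f : secOrb N) g)

/-! ### The contragredient action and invariant extensions -/

variable {M : Fin L → Type u}
  [∀ i, AddCommGroup (M i)] [∀ i, Module ℂ (M i)] [∀ i, LieRingModule (AffLoc N) (M i)]
  [∀ i, LieModule ℂ (AffLoc N) (M i)]

/-- The contragredient action of the sections on the linear maps from `M₁ ⊗ ⋯ ⊗ M_L` to `V`. -/
def dualAction (t : Fin L → ℂ) (M : Fin L → Type u) [∀ i, AddCommGroup (M i)]
    [∀ i, Module ℂ (M i)] [∀ i, LieRingModule (AffLoc N) (M i)]
    [∀ i, LieModule ℂ (AffLoc N) (M i)] (V : Type*) [AddCommGroup V] [Module ℂ V] :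
    goutOrb N t →ₗ[ℂ] Module.End ℂ (Tens M →ₗ[ℂ] V) :=
  LinearMap.mk₂ ℂ (fun f φ => -(φ ∘ₗ actTrigLin t M (f : secOrb N)))
    (fun f g φ => by
      rw [AddMemClass.coe_add, map_add, LinearMap.comp_add, neg_add])
    (fun c f φ => by
      rw [SetLike.val_smul, map_smul, LinearMap.comp_smul, smul_neg])
    (fun f φ ψ => by rw [LinearMap.add_comp, neg_add])
    (fun c f φ => by rw [LinearMap.smul_comp, smul_neg])

theorem dualAction_apply {V : Type*} [AddCommGroup V] [Module ℂ V] (f : goutOrb N t)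
    (φ : Tens M →ₗ[ℂ] V) (v : Tens M) :
    dualAction t M V f φ v = -φ (actTrig N t M (f : secOrb N) v) := by
  rw [← actTrigLin_apply]
  rfl

/-- On `M` the anomaly is `k` times the sum of the residues at the `t_i`. Dualizing changes its
sign, and the residue theorem identifies the result with the twisted cocycle at `0` and `∞`, at the
same level `k` as the Verma modules. -/
theorem dualAction_commutator (hN : N ≠ 0) (ht_ne : ∀ i, t i ≠ 0)
    (ht_distinct : ∀ i j, i ≠ j → ∀ a : ℕ, t i ≠ (eps N : ℂ) ^ a * t j)
    (hlevel : ∀ i, HasLevel N k (M i)) {V : Type*} [AddCommGroup V] [Module ℂ V]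
    (f g : goutOrb N t) :
    dualAction t M V f * dualAction t M V g - dualAction t M V g * dualAction t M V f =
      dualAction t M V ⁅f, g⁆ + loopCocycle N k (germPair N t f) (germPair N t g) • 1 := by
  refine LinearMap.ext fun φ => LinearMap.ext fun v => ?_
  have h := LinearMap.congr_fun (actD_commutator hlevel
    (fun i => germ ((t i : ℂ) : OnePoint ℂ) (f : secOrb N))
    (fun i => germ ((t i : ℂ) : OnePoint ℂ) (g : secOrb N))) v
  have hlie : (fun i => ⁅germ ((t i : ℂ) : OnePoint ℂ) (f : secOrb N),
      germ ((t i : ℂ) : OnePoint ℂ) (g : secOrb N)⁆) =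
      fun i => germ ((t i : ℂ) : OnePoint ℂ) ((⁅f, g⁆ : goutOrb N t) : secOrb N) :=
    funext fun i => (LieHom.map_lie _ _ _).symm
  rw [hlie] at h
  have hres := sum_resForm_goutOrb hN ht_ne ht_distinct f.2 g.2
  set r := ∑ i, resForm (germ (t i : OnePoint ℂ) (f : secOrb N) : Matrix (Fin N) (Fin N) Laur)
    (germ (t i : OnePoint ℂ) (g : secOrb N) : Matrix (Fin N) (Fin N) Laur)
  have hc : loopCocycle N k (germPair N t f) (germPair N t g) = -(k * r) := by
    rw [eq_neg_of_add_eq_zero_left hres, loopCocycle]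
    change k * (1 / (N : ℂ) * (resForm (germZero (f : secOrb N) : Matrix (Fin N) (Fin N) Laur)
      (germZero (g : secOrb N) : Matrix (Fin N) (Fin N) Laur) + resForm (germInfty (f : secOrb N) :
        Matrix (Fin N) (Fin N) Laur) (germInfty (g : secOrb N) : Matrix (Fin N) (Fin N) Laur))) = _
    ring
  change actTrig N t M _ (actTrig N t M _ v) - actTrig N t M _ (actTrig N t M _ v) =
    actTrig N t M _ v + (k * r) • v at h
  rw [hc]
  change dualAction t M V f (dualAction t M V g φ) v - dualAction t M V g (dualAction t M V f φ) v =
    dualAction t M V ⁅f, g⁆ φ v + -(k * r) • φ v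
  simp only [dualAction_apply, neg_neg]
  rw [neg_smul, ← neg_add, ← map_smul, ← map_add, ← h, map_sub]
  abel

/-- The target of the Verma pairing is the space of smooth functionals on `M`, on which the
contragredient action extends to all pairs of twisted loops. -/
theorem exists_invariant_pairing (hN : N ≠ 0) (hL : 1 ≤ L) (ht_ne : ∀ i, t i ≠ 0)
    (ht_distinct : ∀ i j, i ≠ j → ∀ a : ℕ, t i ≠ (eps N : ℂ) ^ a * t j)
    (hlevel : ∀ i, HasLevel N k (M i)) {V : Type*} [AddCommGroup V] [Module ℂ V]
    (π : Tens M →ₗ[ℂ] V) (hπ : ∀ f ∈ goutTrig N t, ∀ v, π (actTrig N t M f v) = 0) :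
    ∃ B : VermaZero N k →ₗ[ℂ] VermaInfty N k →ₗ[ℂ] Tens M →ₗ[ℂ] V,
      B (UVerma.vac _ _ _) (UVerma.vac _ _ _) = π ∧
      (∀ f ∈ goutOrb N t, ∀ x v y, B ⁅(Aff.of (germZero f) : AffTw N (eps N)), x⁆ y v +
        B x y (actTrig N t M f v) + B x ⁅(Aff.of (germInfty f) : AffTw N (eps N)⁻¹), y⁆ v = 0) ∧
      ∀ H x y, B (UVerma.right H x) y + B x (UVerma.right (AdBeta H) y) = 0 := by
  have hdense : ∀ a n, ∃ g, germPair N t g - a ∈ loopFiltration N n := fun a n => by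
    obtain ⟨f, hf, h0, h1⟩ := exists_goutOrb_approx hN hL ht_ne a.1 a.2 n
    exact ⟨⟨f, hf⟩, h0, h1⟩
  have hsmall := exists_lie_mem_loopFiltration (N := N) (k := k)
  have hcomm := dualAction_commutator (M := M) (V := V) hN ht_ne ht_distinct hlevel
  obtain ⟨T, hT⟩ := exists_completion (hF := loopFiltration_antitone) hdense
    (fun g φ hφ => map_mem_smoothVectors hsmall hcomm g hφ)
  have hTcomm := completion_commutator hdense hsmall loopCocycle_add_left loopCocycle_add_right
    hcomm hT
  have hπ0 : ∀ f : goutOrb N t, (f : secOrb N) ∈ goutTrig N t → dualAction t M V f π = 0 :=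
    fun f hf => LinearMap.ext fun v => by
      rw [dualAction_apply, hπ f hf, neg_zero, LinearMap.zero_apply]
  -- Sections vanishing at both `0` and `∞` satisfy the gluing condition with `H = 0`; hence `π` is
  -- smooth, with depth `1`.
  have hπ1 : ∀ f, germPair N t f ∈ loopFiltration N 1 → dualAction t M V f π = 0 := by
    intro f hf
    have hz : ∀ ζ, constLoop (N := N) ζ 0 = 0 := fun ζ => Subtype.ext (by
      change constMat 0 = 0
      ext1 i j
      exact map_zero (Algebra.ofId ℂ Laur))
    refine hπ0 f (mem_goutTrig f.2 0 ?_ ?_)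
    · rw [hz, sub_zero]
      exact hf.1
    · rw [map_zero, hz, sub_zero]
      exact hf.2
  let π' : smoothVectors (dualAction t M V) (germPair N t) loopFiltration_antitone :=
    ⟨π, 1, hπ1⟩
  have hπ'H : ∀ H : cartan N, T (constLoop (eps N) H, constLoop (eps N)⁻¹ (AdBeta H)) π' = 0 := by
    intro H
    obtain ⟨f, hf⟩ := hdense (constLoop (eps N) H, constLoop (eps N)⁻¹ (AdBeta H)) 1
    refine Subtype.ext ((hT _ π' 1 f hπ1 hf).trans ?_)
    exact hπ0 f (mem_goutTrig f.2 H hf.1 hf.2)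
  have hπ'n : ∀ a : twLoop N (eps N) × twLoop N (eps N)⁻¹,
      a.1 ∈ nPlus N (eps N) → a.2 ∈ nPlus N (eps N)⁻¹ → T a π' = 0 := by
    intro a h0 h1
    -- A pair of positive loops is approximated to order `1` by the zero section.
    refine Subtype.ext ((hT a π' 1 0 hπ1 ?_).trans ?_)
    · rw [map_zero, zero_sub]
      exact Submodule.neg_mem _ ⟨h0, h1⟩
    · rw [map_zero]
      rfl
  obtain ⟨B, hB0, hB1, hB2, hBH⟩ := exists_verma_pairing T hTcomm π' hπ'n hπ'H
  refine ⟨B.compr₂ (Submodule.subtype _), congrArg Subtype.val hB0, fun f hf x v y => ?_,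
    fun H x y => congrArg Subtype.val (hBH H x y)⟩
  simp only [LinearMap.compr₂_apply, Submodule.subtype_apply]
  rw [hB1, hB2]
  have h1 : T (germZero f, 0) (B x y) + T (0, germInfty f) (B x y) =
      T (germZero f, germInfty f) (B x y) := by
    rw [← LinearMap.add_apply, ← map_add, Prod.mk_add_mk, add_zero, zero_add]
  obtain ⟨n, hn⟩ := (B x y).2
  -- The section `f` approximates its own pair of germs to every order, so the extended action of
  -- that pair is the contragredient action of `f`.
  have h2 := hT (germZero f, germInfty f) (B x y) n ⟨f, hf⟩ hn (by
    have h := sub_self (germPair N t ⟨f, hf⟩)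
    exact h.symm ▸ Submodule.zero_mem _)
  rw [← h1, Submodule.coe_add] at h2
  have h3 := LinearMap.congr_fun h2 v
  rw [dualAction_apply, LinearMap.add_apply] at h3
  rw [add_right_comm, h3, neg_add_cancel]

theorem exists_tensor_of_pairing {X Y Z W : Type*} [AddCommGroup X] [AddCommGroup Y]
    [AddCommGroup Z] [AddCommGroup W] [Module ℂ X] [Module ℂ Y] [Module ℂ Z] [Module ℂ W]
    (B : X →ₗ[ℂ] Y →ₗ[ℂ] Z →ₗ[ℂ] W) :
    ∃ Φ : X ⊗[ℂ] (Z ⊗[ℂ] Y) →ₗ[ℂ] W, ∀ x z y, Φ (x ⊗ₜ (z ⊗ₜ y)) = B x y z := by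
  let b : X →ₗ[ℂ] Z ⊗[ℂ] Y →ₗ[ℂ] W :=
    { toFun := fun x => TensorProduct.lift (B x).flip
      map_add' := fun x x' => TensorProduct.ext' fun z y => by simp
      map_smul' := fun c x => TensorProduct.ext' fun z y => by simp }
  exact ⟨TensorProduct.lift b, fun _ _ _ => rfl⟩

theorem eq_zero_of_tmul_eq_zero {X Y Z W : Type*} [AddCommGroup X] [AddCommGroup Y]
    [AddCommGroup Z] [AddCommGroup W] [Module ℂ X] [Module ℂ Y] [Module ℂ Z] [Module ℂ W]
    (Ψ : X ⊗[ℂ] (Z ⊗[ℂ] Y) →ₗ[ℂ] W) (h : ∀ x z y, Ψ (x ⊗ₜ (z ⊗ₜ y)) = 0) : Ψ = 0 :=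
  TensorProduct.ext' fun x w => by
    induction w using TensorProduct.induction_on with
    | zero => rw [TensorProduct.tmul_zero, map_zero, map_zero]
    | tmul v y => rw [h]; rfl
    | add a b ha hb => rw [TensorProduct.tmul_add, map_add, map_add, ha, hb]

theorem actOrb_tmul (f : secOrb N) (x : VermaZero N k) (v : Tens M) (y : VermaInfty N k) :
    actOrb N t k M f (x ⊗ₜ (v ⊗ₜ y)) =
      ⁅(Aff.of (germZero f) : AffTw N (eps N)), x⁆ ⊗ₜ (v ⊗ₜ y) +
        x ⊗ₜ (actTrig N t M f v ⊗ₜ y) +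
        x ⊗ₜ (v ⊗ₜ ⁅(Aff.of (germInfty f) : AffTw N (eps N)⁻¹), y⁆) := rfl

/-- A linear map on `M₁ ⊗ ⋯ ⊗ M_L` which is invariant under `g_out^trig` extends to a linear map
on `M(0)_0 ⊗ M ⊗ M(0)_∞` which is invariant under `g_out^orb` and the Cartan subalgebra. -/
theorem exists_invariant_extension (hN : N ≠ 0) (hL : 1 ≤ L) (ht_ne : ∀ i, t i ≠ 0)
    (ht_distinct : ∀ i j, i ≠ j → ∀ a : ℕ, t i ≠ (eps N : ℂ) ^ a * t j)
    (hlevel : ∀ i, HasLevel N k (M i)) {V : Type*} [AddCommGroup V] [Module ℂ V]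
    (π : Tens M →ₗ[ℂ] V) (hπ : ∀ f ∈ goutTrig N t, ∀ v, π (actTrig N t M f v) = 0) :
    ∃ Φ : TensOrb N k M →ₗ[ℂ] V,
      (∀ v, Φ (UVerma.vac N (eps N) k ⊗ₜ (v ⊗ₜ UVerma.vac N (eps N)⁻¹ k)) = π v) ∧
      (∀ f ∈ goutOrb N t, ∀ w, Φ (actOrb N t k M f w) = 0) ∧
      ∀ H w, Φ (rho N k M H w) = 0 := by
  obtain ⟨B, hB0, hBf, hBH⟩ := exists_invariant_pairing hN hL ht_ne ht_distinct hlevel π hπ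
  obtain ⟨Φ, hΦ⟩ := exists_tensor_of_pairing B
  refine ⟨Φ, fun v => ?_, fun f hf w => ?_, fun H w => ?_⟩
  · rw [hΦ, hB0]
  · refine LinearMap.congr_fun (eq_zero_of_tmul_eq_zero (Φ ∘ₗ actOrb N t k M f)
      fun x v y => ?_) w
    rw [LinearMap.comp_apply, actOrb_tmul, map_add, map_add, hΦ, hΦ, hΦ, hBf f hf]
  · refine LinearMap.congr_fun (eq_zero_of_tmul_eq_zero (Φ ∘ₗ rho N k M H) fun x v y => ?_) w
    rw [LinearMap.comp_apply, rho_tmul, map_add, hΦ, hΦ, ← LinearMap.add_apply, hBH,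
      LinearMap.zero_apply]

/-! ### Surjectivity -/

/-- Modulo `g_out^orb`, every vector of `M(0)_0 ⊗ M ⊗ M(0)_∞` comes from `M`. -/
theorem tmul_mem_of_vac_mem (hN : N ≠ 0) (hL : 1 ≤ L) (ht_ne : ∀ i, t i ≠ 0)
    (S : Submodule ℂ (TensOrb N k M)) (hS : goutOrbM N t k M ≤ S)
    (h : ∀ v, UVerma.vac N (eps N) k ⊗ₜ (v ⊗ₜ UVerma.vac N (eps N)⁻¹ k) ∈ S)
    (x : VermaZero N k) (v : Tens M) (y : VermaInfty N k) : x ⊗ₜ (v ⊗ₜ y) ∈ S := by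
  have key : ∀ (x : VermaZero N k) (y : VermaInfty N k) (A : twLoop N (eps N))
      (C : twLoop N (eps N)⁻¹), (∀ v : Tens M, x ⊗ₜ (v ⊗ₜ y) ∈ S) → ∀ v : Tens M,
      ⁅(Aff.of A : AffTw N (eps N)), x⁆ ⊗ₜ (v ⊗ₜ y) +
        x ⊗ₜ (v ⊗ₜ ⁅(Aff.of C : AffTw N (eps N)⁻¹), y⁆) ∈ S := by
    intro x y A C hxy v
    obtain ⟨n, hn⟩ := UVerma.exists_lie_of_eq_zero x
    obtain ⟨m, hm⟩ := UVerma.exists_lie_of_eq_zero y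
    -- To this precision the germs of `f` act on `x` and `y` exactly as `A` and `C`; the remaining
    -- term `x ⊗ f v ⊗ y` of the action lies in `S` by assumption.
    obtain ⟨f, hf, h0, h1⟩ := exists_goutOrb_approx hN hL ht_ne A C (max n m)
    have e0 := hn _ (h0.anti (le_max_left n m))
    have e1 := hm _ (h1.anti (le_max_right n m))
    rw [map_sub, sub_lie, sub_eq_zero] at e0 e1
    have h2 := S.sub_mem (hS (Submodule.subset_span ⟨f, hf, x ⊗ₜ (v ⊗ₜ y), rfl⟩))
      (hxy (actTrig N t M f v))
    rwa [actOrb_tmul, add_right_comm, add_sub_cancel_right, e0, e1] at h2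
  have hx : ∀ (x : VermaZero N k) (v : Tens M), x ⊗ₜ (v ⊗ₜ UVerma.vac N (eps N)⁻¹ k) ∈ S := by
    intro x
    let S' : Submodule ℂ (UVerma N (eps N) k) :=
      { carrier := {x | ∀ v : Tens M, x ⊗ₜ (v ⊗ₜ UVerma.vac N (eps N)⁻¹ k) ∈ S}
        add_mem' := fun ha hb v => by
          rw [TensorProduct.add_tmul]; exact S.add_mem (ha v) (hb v)
        zero_mem' := fun v => by rw [TensorProduct.zero_tmul]; exact S.zero_mem
        smul_mem' := fun c x hx v => by
          rw [← TensorProduct.smul_tmul']; exact S.smul_mem c (hx v) }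
    refine UVerma.mem_of_lie_of_mem S' h (fun A x hx v => ?_) x
    have h1 := key x _ A 0 hx v
    rwa [map_zero, zero_lie, TensorProduct.tmul_zero, TensorProduct.tmul_zero, add_zero] at h1
  let S' : Submodule ℂ (UVerma N (eps N)⁻¹ k) :=
    { carrier := {y | ∀ v : Tens M, x ⊗ₜ (v ⊗ₜ y) ∈ S}
      add_mem' := fun ha hb v => by
        rw [TensorProduct.tmul_add, TensorProduct.tmul_add]; exact S.add_mem (ha v) (hb v)
      zero_mem' := fun v => by
        rw [TensorProduct.tmul_zero, TensorProduct.tmul_zero]; exact S.zero_mem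
      smul_mem' := fun c x hx v => by
        rw [TensorProduct.tmul_smul, TensorProduct.tmul_smul]; exact S.smul_mem c (hx v) }
  refine UVerma.mem_of_lie_of_mem S' (hx x) (fun C y hy v => ?_) y v
  have h1 := key x y 0 C hy v
  rwa [map_zero, zero_lie, TensorProduct.zero_tmul, zero_add] at h1

/-! ### The comparison map -/

/-- The linear map `v ↦ [1_0 ⊗ v ⊗ 1_∞]`. -/
def vacClassLin (N : ℕ) {L : ℕ} (t : Fin L → ℂ) (k : ℂ) (M : Fin L → Type u)
    [∀ i, AddCommGroup (M i)] [∀ i, Module ℂ (M i)] [∀ i, LieRingModule (AffLoc N) (M i)]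
    [∀ i, LieModule ℂ (AffLoc N) (M i)] :
    Tens M →ₗ[ℂ] CCorb N t k M ⧸ CCorbCartan N t k M where
  toFun := vacClass N t k M
  map_add' v w := by
    simp only [vacClass, TensorProduct.add_tmul, TensorProduct.tmul_add, map_add]
  map_smul' c v := by
    simp only [vacClass, ← TensorProduct.smul_tmul', TensorProduct.tmul_smul, map_smul,
      RingHom.id_apply]

theorem vacClassLin_surjective (hN : N ≠ 0) (hL : 1 ≤ L) (ht_ne : ∀ i, t i ≠ 0) :
    Function.Surjective (vacClassLin N t k M) := by
  let q : TensOrb N k M →ₗ[ℂ] CCorb N t k M ⧸ CCorbCartan N t k M :=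
    (CCorbCartan N t k M).mkQ ∘ₗ (goutOrbM N t k M).mkQ
  have hq : Function.Surjective q :=
    (Submodule.mkQ_surjective _).comp (Submodule.mkQ_surjective _)
  intro z
  obtain ⟨w, rfl⟩ := hq z
  change w ∈ (LinearMap.range (vacClassLin N t k M)).comap q
  have hmem := tmul_mem_of_vac_mem hN hL ht_ne ((LinearMap.range (vacClassLin N t k M)).comap q)
    (fun w hw => by
      change q w ∈ LinearMap.range (vacClassLin N t k M)
      have : q w = 0 := by
        change (CCorbCartan N t k M).mkQ ((goutOrbM N t k M).mkQ w) = 0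
        rw [Submodule.mkQ_apply _ w, (Submodule.Quotient.mk_eq_zero _).mpr hw, map_zero]
      rw [this]
      exact Submodule.zero_mem _)
    (fun v => ⟨v, rfl⟩)
  induction w using TensorProduct.induction_on with
  | zero => exact Submodule.zero_mem _
  | tmul x z =>
    induction z using TensorProduct.induction_on with
    | zero => rw [TensorProduct.tmul_zero]; exact Submodule.zero_mem _
    | tmul v y => exact hmem x v y
    | add a b ha hb => rw [TensorProduct.tmul_add]; exact Submodule.add_mem _ ha hb
  | add a b ha hb => exact Submodule.add_mem _ ha hb

/-- On `1 ⊗ v ⊗ 1` the germs of `f` reduce to their constant terms `H` and `Ad β (H)`, which act as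
`ρ(H)`. Thus `1 ⊗ f v ⊗ 1` is an element of the image of `g_out^orb` minus an element of the image
of `ρ(H)`. -/
theorem goutTrigM_le_ker_vacClassLin (hN : N ≠ 0) :
    goutTrigM N t M ≤ LinearMap.ker (vacClassLin N t k M) := by
  refine Submodule.span_le.mpr ?_
  rintro _ ⟨f, hf, v, rfl⟩
  change vacClass N t k M _ = 0
  obtain ⟨H, h0, h1⟩ := exists_cartan_of_mem_goutTrig hN hf
  have e0 := UVerma.lie_of_vac (k := k) h0
  have e1 := UVerma.lie_of_vac (k := k) h1
  rw [map_sub, sub_lie, sub_eq_zero, ← UVerma.right_vac] at e0 e1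
  have h := actOrb_tmul (t := t) f (UVerma.vac N (eps N) k) v (UVerma.vac N (eps N)⁻¹ k)
  rw [e0, e1, add_right_comm] at h
  rw [← rho_tmul, ← sub_eq_iff_eq_add'] at h
  rw [vacClass, ← h, map_sub, map_sub]
  have z1 : (goutOrbM N t k M).mkQ (actOrb N t k M f
      (UVerma.vac N (eps N) k ⊗ₜ (v ⊗ₜ UVerma.vac N (eps N)⁻¹ k))) = 0 :=
    (Submodule.Quotient.mk_eq_zero _).mpr
      (Submodule.subset_span ⟨f, goutTrig_le_goutOrb hf, _, rfl⟩)
  have z2 : (CCorbCartan N t k M).mkQ ((goutOrbM N t k M).mkQ (rho N k M H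
      (UVerma.vac N (eps N) k ⊗ₜ (v ⊗ₜ UVerma.vac N (eps N)⁻¹ k)))) = 0 :=
    (Submodule.Quotient.mk_eq_zero _).mpr
      (Submodule.subset_span ⟨H, (goutOrbM N t k M).mkQ _, rfl⟩)
  rw [z1, z2, map_zero, sub_zero]

/-- The invariant extension of the projection onto `CC_trig(M)` descends through both quotients to a
left inverse of the induced map. -/
theorem ker_vacClassLin_le_goutTrigM (hN : N ≠ 0) (hL : 1 ≤ L) (ht_ne : ∀ i, t i ≠ 0)
    (ht_distinct : ∀ i j, i ≠ j → ∀ a : ℕ, t i ≠ (eps N : ℂ) ^ a * t j)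
    (hlevel : ∀ i, HasLevel N k (M i)) :
    LinearMap.ker (vacClassLin N t k M) ≤ goutTrigM N t M := by
  obtain ⟨Φ, hΦ, hΦf, hΦH⟩ := exists_invariant_extension (k := k) hN hL ht_ne ht_distinct hlevel
    (goutTrigM N t M).mkQ (fun f hf v =>
      (Submodule.Quotient.mk_eq_zero _).mpr (Submodule.subset_span ⟨f, hf, v, rfl⟩))
  let Φ₁ : CCorb N t k M →ₗ[ℂ] CCtrig N t M := (goutOrbM N t k M).liftQ Φ (by
    refine Submodule.span_le.mpr ?_
    rintro _ ⟨f, hf, w, rfl⟩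
    exact hΦf f hf w)
  let Φ₂ : (CCorb N t k M ⧸ CCorbCartan N t k M) →ₗ[ℂ] CCtrig N t M :=
    (CCorbCartan N t k M).liftQ Φ₁ (by
      refine Submodule.span_le.mpr ?_
      rintro _ ⟨H, x, rfl⟩
      obtain ⟨w, rfl⟩ := Submodule.mkQ_surjective _ x
      exact hΦH H w)
  intro v hv
  have h : Φ₂ (vacClassLin N t k M v) = (goutTrigM N t M).mkQ v := hΦ v
  rw [LinearMap.mem_ker.mp hv, map_zero] at h
  exact (Submodule.Quotient.mk_eq_zero _).mp h.symm

end Main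

end

end TwistedWZW

/-! ### The isomorphism of coinvariants -/

theorem mainTheorem1 (N L : ℕ) (hN : 2 ≤ N) (hL : 1 ≤ L)
    (t : Fin L → ℂ) (ht_ne : ∀ i, t i ≠ 0)
    (ht_distinct : ∀ i j, i ≠ j → ∀ a : ℕ, t i ≠ (TwistedWZW.eps N : ℂ) ^ a * t j)
    (k : ℂ) (M : Fin L → Type u) [∀ i, AddCommGroup (M i)] [∀ i, Module ℂ (M i)]
    [∀ i, LieRingModule (TwistedWZW.AffLoc N) (M i)]
    [∀ i, LieModule ℂ (TwistedWZW.AffLoc N) (M i)]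
    (hsmooth : ∀ i, TwistedWZW.IsSmooth N (M i))
    (hlevel : ∀ i, TwistedWZW.HasLevel N k (M i)) :
    ∃ e : TwistedWZW.CCtrig N t M ≃ₗ[ℂ]
        (TwistedWZW.CCorb N t k M ⧸ TwistedWZW.CCorbCartan N t k M),
      ∀ v : TwistedWZW.Tens M,
        e (Submodule.Quotient.mk v) = TwistedWZW.vacClass N t k M v := by
  have hN0 : N ≠ 0 := by omega
  have hker : TwistedWZW.goutTrigM N t M = LinearMap.ker (TwistedWZW.vacClassLin N t k M) :=
    le_antisymm (TwistedWZW.goutTrigM_le_ker_vacClassLin hN0)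
      (TwistedWZW.ker_vacClassLin_le_goutTrigM hN0 hL ht_ne ht_distinct hlevel)
  exact ⟨(Submodule.quotEquivOfEq _ _ hker).trans
    ((TwistedWZW.vacClassLin N t k M).quotKerEquivOfSurjective
      (TwistedWZW.vacClassLin_surjective hN0 hL ht_ne)), fun v => rfl⟩
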